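/- All Hilbert spaces are finite-dimensional (inputs non-zero) and logarithms are base two. A quantum channel is a map $\mathcal N(\rho)=\sum_k A_k\rho A_k^\dagger$ with $\sum_k A_k^\dagger A_k=I$; $U_{\mathcal N}^{A'\to BE}$ denotes an isometric extension of it, and $\mathcal N^c(\rho)=\mathrm{Tr}_B\{U_{\mathcal N}\rho U_{\mathcal N}^\dagger\}$ a complementary channel. $\mathcal N$ is degradable if $\mathcal D\circ\mathcal N=\mathcal N^c$ for some channel $\mathcal D$. It is entanglement-breaking if $(\mathrm{id}\otimes\mathcal N)(\Gamma)$ is separable, $\Gamma$ being the maximally entangled state. It is a quantum Hadamard channel if $\mathcal N^c$ is entanglement-breaking. For $\lambda,\mu\ge 0$ the private dynamic capacity formula is $$P_{\lambda,\mu}(\mathcal N)=\max_\sigma\; I(YX;B)_\sigma+\lambda\,[I(Y;B|X)_\sigma-I(Y;E|X)_\sigma]+\mu\,[I(YX;B)_\sigma-I(Y;E|X)_\sigma],$$ the maximum being over all states $\sigma^{XYBE}=\sum_{x,y}p(x,y)\,|x\rangle\langle x|^X\otimes|y\rangle\langle y|^Y\otimes U_{\mathcal N}\,\rho_{x,y}\,U_{\mathcal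 N}^\dagger$ with finite alphabets, a probability distribution $p$ and density operators $\rho_{x,y}$ on $A'$. Let $\mathcal C^{(1)}(\mathcal N)$ be the set of all $(R,P,S)\in\mathbb R^3$ such that for some such $\sigma$ $$R+P\le I(YX;B)_\sigma,\qquad P+S\le I(Y;B|X)_\sigma-I(Y;E|X)_\sigma,\qquad R+P+S\le I(YX;B)_\sigma-I(Y;E|X)_\sigma,$$ and let the private dynamic capacity region be given by its multi-letter expression $\mathcal C(\mathcal N)=\overline{\bigcup_{k\ge1}\tfrac1k\,\mathcal C^{(1)}(\mathcal N^{\otimes k})}$. **Lemma.** Let $\mathcal N_H$ be a quantum Hadamard channel and $\mathcal N_D$ a degradable quantum channel. Then for all $\lambda,\mu\ge0$ the maxima defining $P_{\lambda,\mu}(\mathcal N_H)$, $P_{\lambda,\mu}(\mathcal N_D)$ and $P_{\lambda,\mu}(\mathcal N_H\otimes\mathcal N_D)$ exist, and $$P_{\lambda,\mu}(\mathcal N_H\otimes\mathcal N_D)=P_{\lambda,\mu}(\mathcal N_H)+P_{\lambda,\mu}(\mathcal N_D).$$ Moreover, the region of a Hadamard channel single-letterizes: for all $\lambda,\mu\ge0$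 the maxima $P_{\lambda,\mu}(\mathcal N_H^{\otimes n})$ exist and $\lim_{n\to\infty}\frac1n P_{\lambda,\mu}(\mathcal N_H^{\otimes n})=P_{\lambda,\mu}(\mathcal N_H)$; and $\mathcal C(\mathcal N_H)=\mathcal C^{(1)}(\mathcal N_H)$. -/

import Mathlib

open scoped Matrix Kronecker Pointwise ComplexOrder

noncomputable section

namespace PrivateDynamic

/-! ## States and entropies -/

/-- A density operator on the finite-dimensional Hilbert space with orthonormal basis `A`. -/
def IsDensity {A : Type*} [Fintype A] (ρ : Matrix A A ℂ) : Prop :=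
  ρ.PosSemidef ∧ ρ.trace = 1

/-- The von Neumann entropy `-Tr (ρ log₂ ρ)`, computed from the eigenvalues of `ρ`. It is used only
for density operators; the value for a non-Hermitian matrix is a convention. -/
def entropy {A : Type*} [Fintype A] [DecidableEq A] (ρ : Matrix A A ℂ) : ℝ :=
  open Classical in
  if h : ρ.IsHermitian then -∑ i, h.eigenvalues i * Real.logb 2 (h.eigenvalues i) else 0

/-- Partial trace over the second system. -/
def traceSnd {A B : Type*} [Fintype B] (ρ : Matrix (A × B) (A × B) ℂ) : Matrix A A ℂ :=
  Matrix.of fun a a' => ∑ b, ρ (a, b) (a', b)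

/-- Partial trace over the first system. -/
def traceFst {A B : Type*} [Fintype A] (ρ : Matrix (A × B) (A × B) ℂ) : Matrix B B ℂ :=
  Matrix.of fun b b' => ∑ a, ρ (a, b) (a, b')

/-- Partial trace over the middle system of a tripartite state on `C ⊗ A ⊗ B`. -/
def traceMid {C A B : Type*} [Fintype A] (ρ : Matrix ((C × A) × B) ((C × A) × B) ℂ) :
    Matrix (C × B) (C × B) ℂ :=
  Matrix.of fun u v => ∑ a, ρ ((u.1, a), u.2) ((v.1, a), v.2)

/-- The quantum mutual information `I(A;B) = H(A) + H(B) - H(AB)`. -/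
def mutualInfo {A B : Type*} [Fintype A] [DecidableEq A] [Fintype B] [DecidableEq B]
    (ρ : Matrix (A × B) (A × B) ℂ) : ℝ :=
  entropy (traceSnd ρ) + entropy (traceFst ρ) - entropy ρ

/-- The conditional quantum mutual information `I(A;B|C) = H(AC) + H(BC) - H(C) - H(ABC)`
of a state on `C ⊗ A ⊗ B`. -/
def condMutualInfo {C A B : Type*} [Fintype C] [DecidableEq C] [Fintype A] [DecidableEq A]
    [Fintype B] [DecidableEq B] (ρ : Matrix ((C × A) × B) ((C × A) × B) ℂ) : ℝ :=
  entropy (traceSnd ρ) + entropy (traceMid ρ) - entropy (traceSnd (traceSnd ρ)) - entropy ρ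

/-! ## Channels -/

/-- A quantum channel: a completely positive trace-preserving map, in Kraus form
`ρ ↦ ∑ₖ Kₖ ρ Kₖ†` with `∑ₖ Kₖ† Kₖ = 1`. -/
def IsChannel {A B : Type*} [Fintype A] [DecidableEq A] [Fintype B]
    (N : Matrix A A ℂ →ₗ[ℂ] Matrix B B ℂ) : Prop :=
  ∃ (n : ℕ) (K : Fin n → Matrix B A ℂ),
    (∀ ρ, N ρ = ∑ k, K k * ρ * (K k)ᴴ) ∧ ∑ k, (K k)ᴴ * K k = 1

/-- `U : A → B ⊗ E` is an isometric extension of `N`: an isometry with `N ρ = Tr_E (U ρ U†)`. -/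
def IsIsometricExtension {A B E : Type*} [Fintype A] [DecidableEq A] [Fintype B] [Fintype E]
    (U : Matrix (B × E) A ℂ) (N : Matrix A A ℂ →ₗ[ℂ] Matrix B B ℂ) : Prop :=
  Uᴴ * U = 1 ∧ ∀ ρ, N ρ = traceSnd (U * ρ * Uᴴ)

/-- The complementary channel `ρ ↦ Tr_B (U ρ U†)` to the environment `E`. -/
def complementary {A B E : Type*} [Fintype A] [Fintype B]
    (U : Matrix (B × E) A ℂ) : Matrix A A ℂ →ₗ[ℂ] Matrix E E ℂ where
  toFun ρ := traceFst (U * ρ * Uᴴ)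
  map_add' ρ τ := by
    ext i j
    simp [traceFst, Matrix.mul_add, Matrix.add_mul, Finset.sum_add_distrib]
  map_smul' c ρ := by
    ext i j
    simp [traceFst, Finset.mul_sum]

/-- The tensor product of two maps on matrices, the linear map with
`(N ⊗ M) (ρ ⊗ τ) = N ρ ⊗ M τ`. -/
def channelTensor {A₁ B₁ A₂ B₂ : Type*} [Fintype A₁] [DecidableEq A₁] [Fintype A₂] [DecidableEq A₂]
    (N : Matrix A₁ A₁ ℂ →ₗ[ℂ] Matrix B₁ B₁ ℂ) (M : Matrix A₂ A₂ ℂ →ₗ[ℂ] Matrix B₂ B₂ ℂ) :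
    Matrix (A₁ × A₂) (A₁ × A₂) ℂ →ₗ[ℂ] Matrix (B₁ × B₂) (B₁ × B₂) ℂ where
  toFun ρ := ∑ s : A₁ × A₂, ∑ t : A₁ × A₂,
    ρ s t • (N (Matrix.single s.1 t.1 1) ⊗ₖ M (Matrix.single s.2 t.2 1))
  map_add' ρ τ := by simp [add_smul, Finset.sum_add_distrib]
  map_smul' c ρ := by simp [mul_smul, Finset.smul_sum]

theorem channelTensor_kronecker {A₁ B₁ A₂ B₂ : Type*} [Fintype A₁] [DecidableEq A₁] [Fintype A₂]
    [DecidableEq A₂] (N : Matrix A₁ A₁ ℂ →ₗ[ℂ] Matrix B₁ B₁ ℂ)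
    (M : Matrix A₂ A₂ ℂ →ₗ[ℂ] Matrix B₂ B₂ ℂ) (ρ : Matrix A₁ A₁ ℂ) (τ : Matrix A₂ A₂ ℂ) :
    channelTensor N M (ρ ⊗ₖ τ) = N ρ ⊗ₖ M τ := by
  have hN : N ρ = ∑ i, ∑ j, ρ i j • N (Matrix.single i j 1) := by
    conv_lhs => rw [Matrix.matrix_eq_sum_single ρ]
    simp only [map_sum]
    refine Finset.sum_congr rfl fun i _ => Finset.sum_congr rfl fun j _ => ?_
    rw [← map_smul, Matrix.smul_single, smul_eq_mul, mul_one]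
  have hM : M τ = ∑ i, ∑ j, τ i j • M (Matrix.single i j 1) := by
    conv_lhs => rw [Matrix.matrix_eq_sum_single τ]
    simp only [map_sum]
    refine Finset.sum_congr rfl fun i _ => Finset.sum_congr rfl fun j _ => ?_
    rw [← map_smul, Matrix.smul_single, smul_eq_mul, mul_one]
  ext u v
  rw [hN, hM]
  simp only [channelTensor, LinearMap.coe_mk, AddHom.coe_mk, Matrix.sum_apply, Matrix.smul_apply,
    Matrix.kroneckerMap_apply, smul_eq_mul, Fintype.sum_prod_type]
  rw [Finset.sum_mul_sum]
  refine Finset.sum_congr rfl fun i _ => Finset.sum_congr rfl fun k _ => ?_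
  rw [Finset.sum_mul_sum]
  refine Finset.sum_congr rfl fun j _ => Finset.sum_congr rfl fun l _ => ?_
  ring

/-- The tensor power `N^{⊗ k}` of a map on matrices, acting on `k` copies of the system. -/
def channelPow {A B : Type*} [Fintype A] [DecidableEq A]
    (N : Matrix A A ℂ →ₗ[ℂ] Matrix B B ℂ) (k : ℕ) :
    Matrix (Fin k → A) (Fin k → A) ℂ →ₗ[ℂ] Matrix (Fin k → B) (Fin k → B) ℂ where
  toFun ρ := ∑ s : Fin k → A, ∑ t : Fin k → A,
    ρ s t • Matrix.of fun u v => ∏ i, N (Matrix.single (s i) (t i) 1) (u i) (v i)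
  map_add' ρ τ := by simp only [Matrix.add_apply, add_smul, Finset.sum_add_distrib]
  map_smul' c ρ := by
    simp only [Matrix.smul_apply, smul_eq_mul, mul_smul, Finset.smul_sum, RingHom.id_apply]

theorem channelPow_product {A B : Type*} [Fintype A] [DecidableEq A]
    (N : Matrix A A ℂ →ₗ[ℂ] Matrix B B ℂ) (k : ℕ) (ρ : Fin k → Matrix A A ℂ) :
    channelPow N k (Matrix.of fun s t => ∏ i, ρ i (s i) (t i)) =
      Matrix.of fun u v => ∏ i, N (ρ i) (u i) (v i) := by
  have hN : ∀ τ : Matrix A A ℂ, N τ = ∑ p : A × A, τ p.1 p.2 • N (Matrix.single p.1 p.2 1) := by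
    intro τ
    conv_lhs => rw [Matrix.matrix_eq_sum_single τ]
    simp only [map_sum, Fintype.sum_prod_type]
    refine Finset.sum_congr rfl fun i _ => Finset.sum_congr rfl fun j _ => ?_
    rw [← map_smul, Matrix.smul_single, smul_eq_mul, mul_one]
  ext u v
  simp only [channelPow, LinearMap.coe_mk, AddHom.coe_mk, Matrix.sum_apply, Matrix.smul_apply,
    Matrix.of_apply, smul_eq_mul]
  have h : ∀ i, N (ρ i) (u i) (v i) =
      ∑ p : A × A, ρ i p.1 p.2 * N (Matrix.single p.1 p.2 1) (u i) (v i) := by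
    intro i
    rw [hN (ρ i)]
    simp only [Matrix.sum_apply, Matrix.smul_apply, smul_eq_mul]
  simp only [h]
  rw [Finset.prod_univ_sum, Fintype.piFinset_univ,
    ← Equiv.sum_comp (Equiv.arrowProdEquivProdArrow (Fin k) (fun _ => A) (fun _ => A)).symm,
    Fintype.sum_prod_type]
  refine Finset.sum_congr rfl fun s _ => Finset.sum_congr rfl fun t _ => ?_
  rw [← Finset.prod_mul_distrib]
  rfl

/-- A channel is degradable if some channel `D` from the output to the environment satisfies
`D ∘ N = Nᶜ`, where `Nᶜ` is complementary to `N`. -/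
def IsDegradable {A B : Type*} [Fintype A] [DecidableEq A] [Fintype B] [DecidableEq B]
    (N : Matrix A A ℂ →ₗ[ℂ] Matrix B B ℂ) : Prop :=
  IsChannel N ∧ ∃ (e : ℕ) (U : Matrix (B × Fin e) A ℂ)
    (D : Matrix B B ℂ →ₗ[ℂ] Matrix (Fin e) (Fin e) ℂ),
      IsIsometricExtension U N ∧ IsChannel D ∧
        ∀ ρ, IsDensity ρ → D (N ρ) = complementary U ρ

/-- A separable state: a finite convex combination of product states. -/
def IsSeparable {A B : Type*} [Fintype A] [Fintype B] (M : Matrix (A × B) (A × B) ℂ) : Prop :=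
  ∃ (n : ℕ) (p : Fin n → ℝ) (σ : Fin n → Matrix A A ℂ) (θ : Fin n → Matrix B B ℂ),
    (∀ x, 0 ≤ p x) ∧ ∑ x, p x = 1 ∧ (∀ x, IsDensity (σ x)) ∧ (∀ x, IsDensity (θ x)) ∧
      M = ∑ x, (p x : ℂ) • (σ x ⊗ₖ θ x)

/-- The maximally entangled state `|Γ⟩⟨Γ|` on `A ⊗ A`, with `|Γ⟩ = |A|^{-1/2} ∑ᵢ |i⟩|i⟩`. -/
def maxEntangled (A : Type*) [Fintype A] [DecidableEq A] : Matrix (A × A) (A × A) ℂ :=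
  Matrix.of fun u v => if u.1 = u.2 ∧ v.1 = v.2 then (Fintype.card A : ℂ)⁻¹ else 0

/-- A channel is entanglement-breaking if, applied to one half of the maximally entangled state,
it yields a separable state. -/
def IsEntanglementBreaking {A B : Type*} [Fintype A] [DecidableEq A] [Fintype B]
    (N : Matrix A A ℂ →ₗ[ℂ] Matrix B B ℂ) : Prop :=
  IsChannel N ∧
    IsSeparable (channelTensor (LinearMap.id : Matrix A A ℂ →ₗ[ℂ] Matrix A A ℂ) N (maxEntangled A))

/-- A quantum Hadamard channel: a channel whose complementary channel is entanglement-breaking. -/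
def IsHadamard {A B : Type*} [Fintype A] [DecidableEq A] [Fintype B]
    (N : Matrix A A ℂ →ₗ[ℂ] Matrix B B ℂ) : Prop :=
  IsChannel N ∧ ∃ (e : ℕ) (U : Matrix (B × Fin e) A ℂ),
    IsIsometricExtension U N ∧ IsEntanglementBreaking (complementary U)

/-! ## The private dynamic capacity formula -/

/-- An ensemble `{p(x,y), ρ_{x,y}}` of (mixed) states on `A`, with finite alphabets. -/
structure Ensemble (m n : ℕ) (A : Type*) [Fintype A] where
  p : Fin m → Fin n → ℝ
  ρ : Fin m → Fin n → Matrix A A ℂ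
  p_nonneg : ∀ x y, 0 ≤ p x y
  p_sum : ∑ x, ∑ y, p x y = 1
  density : ∀ x y, IsDensity (ρ x y)

/-- The classical-quantum state
`σ^{XYBE} = ∑_{x,y} p(x,y) |x⟩⟨x| ⊗ |y⟩⟨y| ⊗ U ρ_{x,y} U†`. -/
def cqState {m n : ℕ} {A B E : Type*} [Fintype A] (U : Matrix (B × E) A ℂ) (S : Ensemble m n A) :
    Matrix ((Fin m × Fin n) × (B × E)) ((Fin m × Fin n) × (B × E)) ℂ :=
  ∑ x, ∑ y, (S.p x y : ℂ) •
    ((Matrix.single x x (1 : ℂ) ⊗ₖ Matrix.single y y (1 : ℂ)) ⊗ₖ (U * S.ρ x y * Uᴴ))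

/-- The reduction `σ^{XYB}` of a state `σ^{XYBE}`. -/
def reduceB {W B E : Type*} [Fintype E] (σ : Matrix (W × (B × E)) (W × (B × E)) ℂ) :
    Matrix (W × B) (W × B) ℂ :=
  Matrix.of fun u v => ∑ e, σ (u.1, (u.2, e)) (v.1, (v.2, e))

/-- The reduction `σ^{XYE}` of a state `σ^{XYBE}`. -/
def reduceE {W B E : Type*} [Fintype B] (σ : Matrix (W × (B × E)) (W × (B × E)) ℂ) :
    Matrix (W × E) (W × E) ℂ :=
  Matrix.of fun u v => ∑ b, σ (u.1, (b, u.2)) (v.1, (b, v.2))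

section Rates

variable {X Y B E : Type*} [Fintype X] [DecidableEq X] [Fintype Y] [DecidableEq Y]
  [Fintype B] [DecidableEq B] [Fintype E] [DecidableEq E]

/-- `I(YX;B)_σ`. -/
def infoYXB (σ : Matrix ((X × Y) × (B × E)) ((X × Y) × (B × E)) ℂ) : ℝ :=
  mutualInfo (reduceB σ)

/-- `I(Y;B|X)_σ`. -/
def infoYBgivenX (σ : Matrix ((X × Y) × (B × E)) ((X × Y) × (B × E)) ℂ) : ℝ :=
  condMutualInfo (reduceB σ)

/-- `I(Y;E|X)_σ`. -/
def infoYEgivenX (σ : Matrix ((X × Y) × (B × E)) ((X × Y) × (B × E)) ℂ) : ℝ :=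
  condMutualInfo (reduceE σ)

/-- The objective
`I(YX;B) + lam * [I(Y;B|X) - I(Y;E|X)] + mu * [I(YX;B) - I(Y;E|X)]`. -/
def objective (lam mu : ℝ) (σ : Matrix ((X × Y) × (B × E)) ((X × Y) × (B × E)) ℂ) : ℝ :=
  infoYXB σ + lam * (infoYBgivenX σ - infoYEgivenX σ) + mu * (infoYXB σ - infoYEgivenX σ)

end Rates

section Formula

variable {A B : Type*} [Fintype A] [DecidableEq A] [Fintype B] [DecidableEq B]

/-- All values of the objective, over all isometric extensions of `N` and all finite ensembles. -/
def objectiveValues (N : Matrix A A ℂ →ₗ[ℂ] Matrix B B ℂ) (lam mu : ℝ) : Set ℝ :=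
  {v | ∃ (e m n : ℕ) (U : Matrix (B × Fin e) A ℂ) (S : Ensemble m n A),
    IsIsometricExtension U N ∧ v = objective lam mu (cqState U S)}

/-- The private dynamic capacity formula `P_{λ,μ}(N) = max_σ (objective)`. -/
def privateDynamicFormula (N : Matrix A A ℂ →ₗ[ℂ] Matrix B B ℂ) (lam mu : ℝ) : ℝ :=
  sSup (objectiveValues N lam mu)

/-- The one-shot, one-state region of rate triples `(R, P, S)`. -/
def oneShotOneState {X Y E : Type*} [Fintype X] [DecidableEq X] [Fintype Y] [DecidableEq Y]
    [Fintype E] [DecidableEq E] (σ : Matrix ((X × Y) × (B × E)) ((X × Y) × (B × E)) ℂ) :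
    Set (ℝ × ℝ × ℝ) :=
  {r | r.1 + r.2.1 ≤ infoYXB σ ∧
    r.2.1 + r.2.2 ≤ infoYBgivenX σ - infoYEgivenX σ ∧
    r.1 + r.2.1 + r.2.2 ≤ infoYXB σ - infoYEgivenX σ}

/-- The one-shot region: the union of the one-shot, one-state regions. -/
def oneShotRegion (N : Matrix A A ℂ →ₗ[ℂ] Matrix B B ℂ) : Set (ℝ × ℝ × ℝ) :=
  {r | ∃ (e m n : ℕ) (U : Matrix (B × Fin e) A ℂ) (S : Ensemble m n A),
    IsIsometricExtension U N ∧ r ∈ oneShotOneState (cqState U S)}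

/-- The private dynamic capacity region in its multi-letter form, the closure of
`⋃_{k ≥ 1} (1/k) C⁽¹⁾(N^{⊗ k})`. -/
def capacityRegion (N : Matrix A A ℂ →ₗ[ℂ] Matrix B B ℂ) : Set (ℝ × ℝ × ℝ) :=
  closure (⋃ k ∈ Set.Ici (1 : ℕ), (k : ℝ)⁻¹ • oneShotRegion (channelPow N k))

end Formula

end PrivateDynamic

end

/-! Assign to an unnormalized state M the homogeneous entropy Tr M · H(M / Tr M). For the ensemble
G(x,y) = p(x,y) ρ(x,y), each information quantity in the formula is then a difference of sums of
such entropies at the outputs B and E. Purifying the input shows that the entropy at one output is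
determined by the map to the other output. Hence the rates depend on the channel alone, and an
isometry may be replaced by any other with the same map to E.

The analytic input is the monotonicity of the Holevo information under channels,
`entropy_holevo_monotone`. A Holevo quantity is a sum of relative entropies of the members to their
sum. Each relative entropy is an integral over u in (0,1) of suprema of quadratic functionals, and
these functionals decrease under Kraus maps by an operator Schwarz inequality. Concavity of the
entropy and the inequality I(Y;E) ≤ I(Y;B) for degradable channels are direct consequences.

Upper bound on the product. A product of degradable isometries is degradable, and for these,
refining an ensemble into pure states lowers none of the three bounds (`exists_pureFamily`). For
pure states the bounds are H(B) - H(E|XY), H(B|X) - H(E|X) and H(B) - H(E|X). An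
entanglement-breaking complement measures the input with rank-one operators ψ_z and prepares φ_z, so
the Hadamard factor may be taken to be ∑_z |z⟩ ⊗ |φ_z⟩⟨ψ_z|. Monotonicity then gives H(B₁B₂|X) ≤
H(B₁|X) + H(B₂|XZ) (`hB_tensorIso_le`) and H(E₁E₂|X) ≥ H(E₁|X) + H(E₂|XZ) (`hE_tensorIso_ge`).
Letting Z join X in the ensemble for the second channel, every triple of bounds for the product is
dominated by a sum of triples for the factors (`exists_le_add_of_hadamardIso`). Product ensembles
give the converse (`add_mem_rateSet_tensorIso`).

The maxima exist although the alphabets are unbounded: the set of triples is a continuous image of a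
twofold convex hull of a compact set (`rateSet_eq_image`). For tensor powers one Hadamard factor is
split off at a time, and the remaining power need only be degradable. For the region, time sharing
supplies convexity and compactness supplies closedness. -/

set_option linter.unusedSectionVars false
noncomputable section

namespace PrivateDynamic

open Matrix

/-! ## Entropy of positive semidefinite matrices -/

section EntropyBasics

open Polynomial

variable {A B C : Type*} [Fintype A] [DecidableEq A] [Fintype B] [DecidableEq B]
  [Fintype C] [DecidableEq C]

/-- The function `t ↦ -t log₂ t`. -/
def nml (t : ℝ) : ℝ := -(t * Real.logb 2 t)

@[simp] theorem nml_zero : nml 0 = 0 := by simp [nml]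

@[simp] theorem nml_one : nml 1 = 0 := by simp [nml]

theorem nml_eq (t : ℝ) : nml t = Real.negMulLog t / Real.log 2 := by
  simp only [nml, Real.negMulLog, Real.logb]; ring

theorem continuous_nml : Continuous nml := by
  have : nml = fun t => Real.negMulLog t / Real.log 2 := funext nml_eq
  rw [this]
  exact Real.continuous_negMulLog.div_const _

theorem nml_mul (s t : ℝ) : nml (s * t) = s * nml t + t * nml s := by
  simp only [nml_eq, Real.negMulLog_mul]; ring

theorem entropy_eq_sum {M : Matrix A A ℂ} (h : M.IsHermitian) :
    entropy M = ∑ i, nml (h.eigenvalues i) := by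
  simp only [entropy, dif_pos h, nml, Finset.sum_neg_distrib]

/-- This makes the entropy a function of the characteristic polynomial, so its invariances reduce to
those of the polynomial. -/
theorem entropy_eq_roots {M : Matrix A A ℂ} (h : M.IsHermitian) :
    entropy M = (M.charpoly.roots.map fun z => nml z.re).sum := by
  rw [entropy_eq_sum h, h.roots_charpoly_eq_eigenvalues, Multiset.map_map]
  simp

theorem entropy_congr_charpoly {M : Matrix A A ℂ} {M' : Matrix B B ℂ} (h : M.IsHermitian)
    (h' : M'.IsHermitian) (hc : M.charpoly = M'.charpoly) : entropy M = entropy M' := by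
  rw [entropy_eq_roots h, entropy_eq_roots h', hc]

/-- The two characteristic polynomials agree up to powers of X, that is, up to zero eigenvalues, and
`nml 0 = 0`. -/
theorem entropy_mul_comm {K : Matrix A B ℂ} {K' : Matrix B A ℂ} (h : (K * K').IsHermitian)
    (h' : (K' * K).IsHermitian) : entropy (K * K') = entropy (K' * K) := by
  have key := congrArg (fun p : ℂ[X] => (p.roots.map fun z => nml z.re).sum)
    (charpoly_mul_comm' K K')
  have hX : ∀ k : ℕ, (X ^ k : ℂ[X]) ≠ 0 := fun k => pow_ne_zero _ X_ne_zero
  simp only [roots_mul (mul_ne_zero (hX _) (charpoly_monic (K * K')).ne_zero),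
    roots_mul (mul_ne_zero (hX _) (charpoly_monic (K' * K)).ne_zero), roots_X_pow,
    Multiset.map_add, Multiset.sum_add, Multiset.map_nsmul, Multiset.sum_nsmul,
    Multiset.map_singleton, Multiset.sum_singleton, Complex.zero_re, nml_zero, smul_zero,
    zero_add] at key
  rw [entropy_eq_roots h, entropy_eq_roots h', key]

theorem entropy_mul_conjTranspose (K : Matrix A B ℂ) : entropy (K * Kᴴ) = entropy (Kᴴ * K) :=
  entropy_mul_comm (isHermitian_mul_conjTranspose_self K) (isHermitian_conjTranspose_mul_self K)

theorem entropy_transpose {M : Matrix A A ℂ} (h : M.IsHermitian) : entropy Mᵀ = entropy M :=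
  entropy_congr_charpoly h.transpose h (charpoly_transpose M)

theorem entropy_submatrix {M : Matrix A A ℂ} (h : M.IsHermitian) (e : B ≃ A) :
    entropy (M.submatrix e e) = entropy M :=
  entropy_congr_charpoly (h.submatrix e) h (charpoly_reindex e.symm M)

theorem entropy_diagonal (d : A → ℝ) :
    entropy (diagonal fun i => (d i : ℂ)) = ∑ i, nml (d i) := by
  have h : (diagonal fun i => (d i : ℂ)).IsHermitian :=
    isHermitian_diagonal_of_self_adjoint _ (by ext i; simp)
  rw [entropy_eq_roots h, charpoly_diagonal, roots_prod _ _ (by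
    simp [Finset.prod_ne_zero_iff, X_sub_C_ne_zero])]
  simp

theorem isHermitian_conj_diagonal (V : Matrix A B ℂ) (d : B → ℝ) :
    (V * diagonal (fun i => (d i : ℂ)) * Vᴴ).IsHermitian :=
  isHermitian_mul_mul_conjTranspose V (isHermitian_diagonal_of_self_adjoint _ (by ext i; simp))

/-- `V` may be a rectangular isometry: moving it cyclically to the other side produces `Vᴴ * V = 1`.
Tensor products and block sums are handled by assembling such decompositions. -/
theorem entropy_conj_diagonal {V : Matrix A B ℂ} (hV : Vᴴ * V = 1) (d : B → ℝ) :
    entropy (V * diagonal (fun i => (d i : ℂ)) * Vᴴ) = ∑ i, nml (d i) := by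
  have h1 := isHermitian_conj_diagonal V d
  have h2 : Vᴴ * (V * diagonal (fun i => (d i : ℂ))) = diagonal fun i => (d i : ℂ) := by
    rw [← Matrix.mul_assoc, hV, Matrix.one_mul]
  rw [entropy_mul_comm h1 (by
    rw [h2]; exact isHermitian_diagonal_of_self_adjoint _ (by ext i; simp)), h2, entropy_diagonal]

/-- Spectral decomposition of a Hermitian matrix. -/
theorem exists_diagonalization {M : Matrix A A ℂ} (h : M.IsHermitian) :
    ∃ (V : Matrix A A ℂ) (d : A → ℝ), Vᴴ * V = 1 ∧ V * Vᴴ = 1 ∧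
      M = V * diagonal (fun i => (d i : ℂ)) * Vᴴ ∧ (M.PosSemidef → ∀ i, 0 ≤ d i) := by
  refine ⟨h.eigenvectorUnitary, h.eigenvalues, ?_, ?_, ?_, fun hp i => ?_⟩
  · exact Unitary.coe_star_mul_self h.eigenvectorUnitary
  · exact Unitary.coe_mul_star_self h.eigenvectorUnitary
  · conv_lhs => rw [h.spectral_theorem]
    rfl
  · exact hp.eigenvalues_nonneg i

/-- A positive semidefinite matrix is of the form `T * Tᴴ`. -/
theorem exists_eq_mul_conjTranspose {M : Matrix A A ℂ} (h : M.PosSemidef) :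
    ∃ T : Matrix A A ℂ, M = T * Tᴴ := by
  obtain ⟨V, d, -, -, hM, hd⟩ := exists_diagonalization h.1
  refine ⟨V * diagonal (fun i => ((Real.sqrt (d i) : ℝ) : ℂ)), ?_⟩
  rw [conjTranspose_mul, diagonal_conjTranspose, Matrix.mul_assoc, ← Matrix.mul_assoc (diagonal _),
    diagonal_mul_diagonal, ← Matrix.mul_assoc]
  have : (fun i => ((Real.sqrt (d i) : ℝ) : ℂ) * star (fun i => ((Real.sqrt (d i) : ℝ) : ℂ)) i) =
      fun i => (d i : ℂ) := by
    ext i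
    simp only [Pi.star_apply, RCLike.star_def, Complex.conj_ofReal, ← Complex.ofReal_mul]
    rw [Real.mul_self_sqrt (hd h i)]
  rw [this]
  exact hM

theorem trace_conj_diagonal {V : Matrix A B ℂ} (hV : Vᴴ * V = 1) (d : B → ℝ) :
    (V * diagonal (fun i => (d i : ℂ)) * Vᴴ).trace = ((∑ i, d i : ℝ) : ℂ) := by
  rw [trace_mul_comm, ← Matrix.mul_assoc, hV, Matrix.one_mul, trace_diagonal]
  simp

theorem entropy_smul {M : Matrix A A ℂ} (h : M.IsHermitian) (c : ℝ) :
    entropy ((c : ℂ) • M) = c * entropy M + M.trace.re * nml c := by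
  obtain ⟨V, d, hV, -, hM, -⟩ := exists_diagonalization h
  have h1 : (c : ℂ) • M = V * diagonal (fun i => ((c * d i : ℝ) : ℂ)) * Vᴴ := by
    have : (diagonal fun i => ((c * d i : ℝ) : ℂ)) = (c : ℂ) • diagonal fun i => (d i : ℂ) := by
      rw [← diagonal_smul]; congr 1; ext i; simp
    rw [this, hM]; simp
  rw [h1, entropy_conj_diagonal hV, hM, entropy_conj_diagonal hV, trace_conj_diagonal hV]
  simp only [nml_mul, Finset.sum_add_distrib, Finset.mul_sum, Finset.sum_mul, Complex.ofReal_re]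

theorem entropy_kronecker {M : Matrix A A ℂ} {M' : Matrix B B ℂ} (h : M.IsHermitian)
    (h' : M'.IsHermitian) :
    entropy (M ⊗ₖ M') = M'.trace.re * entropy M + M.trace.re * entropy M' := by
  obtain ⟨V, d, hV, -, hM, -⟩ := exists_diagonalization h
  obtain ⟨V', d', hV', -, hM', -⟩ := exists_diagonalization h'
  have h1 : M ⊗ₖ M' = (V ⊗ₖ V') *
      diagonal (fun i : A × B => ((d i.1 * d' i.2 : ℝ) : ℂ)) * (V ⊗ₖ V')ᴴ := by
    have : (diagonal (fun i : A × B => ((d i.1 * d' i.2 : ℝ) : ℂ))) =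
        (diagonal fun i => (d i : ℂ)) ⊗ₖ (diagonal fun i => (d' i : ℂ)) := by
      rw [diagonal_kronecker_diagonal]; simp
    rw [this, conjTranspose_kronecker, ← mul_kronecker_mul, ← mul_kronecker_mul, ← hM, ← hM']
  rw [h1, entropy_conj_diagonal (by
    rw [conjTranspose_kronecker, ← mul_kronecker_mul, hV, hV', one_kronecker_one]), hM, hM',
    entropy_conj_diagonal hV, entropy_conj_diagonal hV', trace_conj_diagonal hV,
    trace_conj_diagonal hV']
  simp only [nml_mul, Complex.ofReal_re, Fintype.sum_prod_type, Finset.sum_add_distrib,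
    Finset.sum_mul, Finset.mul_sum]
  rw [add_comm]
  congr 1
  rw [Finset.sum_comm]

theorem entropy_blockDiagonal {M : B → Matrix A A ℂ} (h : ∀ b, (M b).IsHermitian) :
    entropy (blockDiagonal M) = ∑ b, entropy (M b) := by
  choose V d hV hV' hM hd using fun b => exists_diagonalization (h b)
  have h1 : blockDiagonal M = blockDiagonal V *
      diagonal (fun i : A × B => ((d i.2 i.1 : ℝ) : ℂ)) * (blockDiagonal V)ᴴ := by
    rw [← blockDiagonal_diagonal (fun b a => ((d b a : ℝ) : ℂ)), blockDiagonal_conjTranspose,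
      ← blockDiagonal_mul, ← blockDiagonal_mul]
    congr 1
    exact funext hM
  rw [h1, entropy_conj_diagonal (by
    rw [blockDiagonal_conjTranspose, ← blockDiagonal_mul]
    simp only [hV]
    exact blockDiagonal_one)]
  rw [Fintype.sum_prod_type, Finset.sum_comm]
  refine Finset.sum_congr rfl fun b _ => ?_
  conv_rhs => rw [hM b, entropy_conj_diagonal (hV b)]

/-- The entropy of an unnormalized state, made homogeneous: `Tr M` times the entropy of
`M / Tr M`. -/
def homEntropy (M : Matrix A A ℂ) : ℝ := entropy M - nml M.trace.re

/-- Homogeneity is the reason for the correction by `nml` of the trace: probabilities can be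
absorbed into the states. -/
theorem homEntropy_smul {M : Matrix A A ℂ} (h : M.IsHermitian) (c : ℝ) :
    homEntropy ((c : ℂ) • M) = c * homEntropy M := by
  simp only [homEntropy, entropy_smul h, trace_smul, smul_eq_mul, Complex.re_ofReal_mul, nml_mul]
  ring

theorem homEntropy_kronecker {M : Matrix A A ℂ} {M' : Matrix B B ℂ} (h : M.IsHermitian)
    (h' : M'.IsHermitian) :
    homEntropy (M ⊗ₖ M') = M'.trace.re * homEntropy M + M.trace.re * homEntropy M' := by
  have him : M.trace.im = 0 := by
    have := congrArg Matrix.trace h.eq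
    rw [trace_conjTranspose] at this
    exact Complex.conj_eq_iff_im.1 this
  simp only [homEntropy, entropy_kronecker h h', trace_kronecker, Complex.mul_re, him, zero_mul,
    sub_zero, nml_mul]
  ring

theorem homEntropy_submatrix {M : Matrix A A ℂ} (h : M.IsHermitian) (e : B ≃ A) :
    homEntropy (M.submatrix e e) = homEntropy M := by
  have : (M.submatrix e e).trace = M.trace := by
    simp only [trace, diag_apply, submatrix_apply]
    exact Equiv.sum_comp e fun i => M i i
  rw [homEntropy, homEntropy, entropy_submatrix h, this]

theorem homEntropy_transpose {M : Matrix A A ℂ} (h : M.IsHermitian) :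
    homEntropy Mᵀ = homEntropy M := by
  rw [homEntropy, homEntropy, entropy_transpose h, trace_transpose]

theorem homEntropy_mul_conjTranspose (K : Matrix A B ℂ) :
    homEntropy (K * Kᴴ) = homEntropy (Kᴴ * K) := by
  rw [homEntropy, homEntropy, entropy_mul_conjTranspose, trace_mul_comm]

theorem homEntropy_of_unique [Unique A] {M : Matrix A A ℂ} (h : M.IsHermitian) :
    homEntropy M = 0 := by
  rw [homEntropy, entropy_eq_sum h, h.trace_eq_sum_eigenvalues]
  simp

/-- A rank-one matrix has the spectrum of a 1 × 1 matrix up to zeros, and there the entropy is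
exactly `nml` of the trace. -/
theorem homEntropy_vecMulVec (v : A → ℂ) : homEntropy (vecMulVec v (star v)) = 0 := by
  have : vecMulVec v (star v) = replicateCol Unit v * (replicateCol Unit v)ᴴ := by
    ext i j; simp [vecMulVec_apply, Matrix.mul_apply]
  rw [this, homEntropy_mul_conjTranspose]
  exact homEntropy_of_unique (isHermitian_conjTranspose_mul_self _)

theorem homEntropy_zero : homEntropy (0 : Matrix A A ℂ) = 0 := by
  have := homEntropy_smul (isHermitian_zero (n := A) (α := ℂ)) 0
  simpa using this

end EntropyBasics

/-! ## Monotonicity of the Holevo information under channels -/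

section Scalar

/-- For positive `p` an antiderivative is (q - p) u - p log (p + u (q - p)). The support condition
excludes the divergent case p > 0 = q. -/
theorem intervalIntegrable_and_integral_quadratic {p q : ℝ} (hp : 0 ≤ p) (hq : 0 ≤ q)
    (h : q = 0 → p = 0) :
    IntervalIntegrable (fun u => u * ((p - q) ^ 2 / (u * q + (1 - u) * p)))
        MeasureTheory.volume 0 1 ∧
      ∫ u in (0 : ℝ)..1, u * ((p - q) ^ 2 / (u * q + (1 - u) * p)) =
        p * Real.log p - p * Real.log q - p + q := by
  -- For `p = 0` the integrand is the constant `q` away from the endpoint `u = 0`.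
  rcases hp.eq_or_lt with rfl | hp
  · have hE : Set.EqOn (fun _ => q)
        (fun u : ℝ => u * ((0 - q) ^ 2 / (u * q + (1 - u) * 0))) (Set.uIoc 0 1) := by
      intro u hu
      rw [Set.uIoc_of_le zero_le_one] at hu
      have hu0 : u ≠ 0 := hu.1.ne'
      rcases eq_or_ne q 0 with rfl | hq0
      · simp
      · simp only; field_simp; ring
    refine ⟨(intervalIntegrable_const (c := q)).congr hE, ?_⟩
    rw [← intervalIntegral.integral_congr_ae (Filter.Eventually.of_forall hE)]
    simp
  · have hq : 0 < q := hq.lt_of_ne fun hq0 => hp.ne' (h hq0.symm)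
    have hden : ∀ u ∈ Set.uIcc (0 : ℝ) 1, 0 < p + u * (q - p) := by
      intro u hu
      rw [Set.uIcc_of_le zero_le_one] at hu
      rcases hu.1.eq_or_lt with rfl | h0
      · simpa using hp
      · nlinarith [mul_pos h0 hq, mul_nonneg (sub_nonneg.2 hu.2) hp.le]
    have hfun : (fun u : ℝ => u * ((p - q) ^ 2 / (u * q + (1 - u) * p))) =
        fun u => u * ((p - q) ^ 2 / (p + u * (q - p))) := by
      ext u; congr 2; ring
    rw [hfun]
    have hint : IntervalIntegrable (fun u => u * ((p - q) ^ 2 / (p + u * (q - p))))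
        MeasureTheory.volume 0 1 := by
      apply ContinuousOn.intervalIntegrable
      refine continuousOn_id.mul (continuousOn_const.div (by fun_prop) fun u hu => ?_)
      exact (hden u hu).ne'
    refine ⟨hint, ?_⟩
    rw [intervalIntegral.integral_eq_sub_of_hasDerivAt
      (f := fun u => (q - p) * u - p * Real.log (p + u * (q - p))) _ hint]
    · have : p + 1 * (q - p) = q := by ring
      rw [this]
      simp
      ring
    · intro u hu
      have hd := hden u hu
      have h1 : HasDerivAt (fun u : ℝ => p + u * (q - p)) (q - p) u := by
        simpa using ((hasDerivAt_id u).mul_const (q - p)).const_add p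
      have h2 := ((hasDerivAt_id u).const_mul (q - p)).sub ((h1.log hd.ne').const_mul p)
      have h3 : u * ((p - q) ^ 2 / (p + u * (q - p))) =
          (q - p) * 1 - p * ((q - p) / (p + u * (q - p))) := by
        field_simp
        ring
      rw [h3]
      exact h2

/-- Completing the square in `y`; the maximizer is `(a / D) * o`, as `quadratic_eq` records. If `D =
0` then `a = 0`, and the convention `x / 0 = 0` gives the correct value. -/
theorem quadratic_le {a D : ℝ} (hD : 0 ≤ D) (h : D = 0 → a = 0) (y o : ℂ) :
    2 * (star y * o).re * a - D * Complex.normSq y ≤ Complex.normSq o * (a ^ 2 / D) := by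
  rcases hD.eq_or_lt with rfl | hD
  · simp [h rfl]
  · rw [← mul_div_assoc, le_div_iff₀ hD]
    simp only [RCLike.star_def, Complex.mul_re, Complex.conj_re, Complex.conj_im,
      Complex.normSq_apply]
    nlinarith [sq_nonneg (o.re * a - D * y.re), sq_nonneg (o.im * a - D * y.im)]

theorem quadratic_eq {a D : ℝ} (h : D = 0 → a = 0) (o : ℂ) :
    2 * (star (((a / D : ℝ) : ℂ) * o) * o).re * a - D * Complex.normSq (((a / D : ℝ) : ℂ) * o) =
      Complex.normSq o * (a ^ 2 / D) := by
  rcases eq_or_ne D 0 with hD | hD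
  · simp [hD, h hD]
  · simp only [RCLike.star_def, map_mul, Complex.conj_ofReal, Complex.normSq_ofReal]
    rw [mul_assoc _ _ o, ← Complex.normSq_eq_conj_mul_self, ← Complex.ofReal_mul,
      Complex.ofReal_re]
    field_simp
    ring

end Scalar

/-! ### Quadratic divergences, Kraus maps and relative entropy -/

section Kraus

variable {A B : Type*} [Fintype A] [DecidableEq A] [Fintype B] [DecidableEq B]
  {κ : Type*} [Fintype κ]

/-- The map `M ↦ ∑ₖ Kₖ M Kₖ†` with Kraus operators `Kₖ`. -/
def krausMap (K : κ → Matrix B A ℂ) (M : Matrix A A ℂ) : Matrix B B ℂ := ∑ k, K k * M * (K k)ᴴ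

theorem krausMap_sum {ι : Type*} (s : Finset ι) (K : κ → Matrix B A ℂ) (M : ι → Matrix A A ℂ) :
    krausMap K (∑ i ∈ s, M i) = ∑ i ∈ s, krausMap K (M i) := by
  simp only [krausMap, Matrix.mul_sum, Matrix.sum_mul]
  exact Finset.sum_comm

theorem krausMap_posSemidef (K : κ → Matrix B A ℂ) {M : Matrix A A ℂ} (hM : M.PosSemidef) :
    (krausMap K M).PosSemidef :=
  posSemidef_sum _ fun k _ => hM.mul_mul_conjTranspose_same (K k)

theorem trace_krausMap {K : κ → Matrix B A ℂ} (hK : ∑ k, (K k)ᴴ * K k = 1) (M : Matrix A A ℂ) :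
    (krausMap K M).trace = M.trace := by
  simp only [krausMap, trace_sum]
  simp_rw [fun k => trace_mul_cycle (K k) M (K k)ᴴ]
  rw [← trace_sum, ← Matrix.sum_mul, hK, Matrix.one_mul]

/-- The quadratic functional `2 Re Tr X†(ρ - σ) - u Tr X†σX - (1 - u) Tr X†Xρ`, whose supremum
over `X` is a monotone divergence of `ρ` and `σ`. -/
def quadVal (u : ℝ) (X ρ σ : Matrix A A ℂ) : ℝ :=
  2 * ((Xᴴ * ρ).trace.re - (Xᴴ * σ).trace.re) - u * (Xᴴ * σ * X).trace.re -
    (1 - u) * (Xᴴ * X * ρ).trace.re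

/-- Operator Schwarz inequality for the dual map `Y = ∑ₖ Kₖ† X Kₖ`: the defect is the trace of ∑ₖ
(X†Kₖ - KₖY†) σ (X†Kₖ - KₖY†)†. Both cross terms and the last square equal Tr Y†σY, the latter by
`∑ₖ Kₖ† Kₖ = 1`. -/
theorem trace_kraus_sq_nonneg (K : κ → Matrix B A ℂ) (hK : ∑ k, (K k)ᴴ * K k = 1)
    {σ : Matrix A A ℂ} (hσ : σ.PosSemidef) (X : Matrix B B ℂ) :
    ((∑ k, (K k)ᴴ * X * K k)ᴴ * σ * (∑ k, (K k)ᴴ * X * K k)).trace.re ≤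
      (Xᴴ * krausMap K σ * X).trace.re := by
  set Y := ∑ k, (K k)ᴴ * X * K k with hY
  have hYs : Yᴴ = ∑ k, (K k)ᴴ * Xᴴ * K k := by
    simp [hY, conjTranspose_sum, Matrix.mul_assoc]
  have h0 : 0 ≤ (∑ k, (Xᴴ * K k - K k * Yᴴ) * σ * (Xᴴ * K k - K k * Yᴴ)ᴴ).trace :=
    (posSemidef_sum _ fun k _ => hσ.mul_mul_conjTranspose_same _).trace_nonneg
  have h1 : (∑ k, (Xᴴ * K k - K k * Yᴴ) * σ * (Xᴴ * K k - K k * Yᴴ)ᴴ).trace =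
      (Xᴴ * krausMap K σ * X).trace - (Yᴴ * σ * Y).trace := by
    have e1 : ∑ k, (Xᴴ * K k * σ * ((K k)ᴴ * X)).trace = (Xᴴ * krausMap K σ * X).trace := by
      simp only [krausMap, Matrix.mul_sum, Matrix.sum_mul, trace_sum, Matrix.mul_assoc]
    have e2 : ∑ k, (Xᴴ * K k * σ * (Y * (K k)ᴴ)).trace = (Yᴴ * σ * Y).trace := by
      rw [hYs]
      simp only [Matrix.sum_mul, trace_sum]
      refine Finset.sum_congr rfl fun k _ => ?_
      rw [← Matrix.mul_assoc, trace_mul_comm]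
      simp only [Matrix.mul_assoc]
    have e3 : ∑ k, (K k * Yᴴ * σ * ((K k)ᴴ * X)).trace = (Yᴴ * σ * Y).trace := by
      conv_rhs => rw [hY]
      simp only [Matrix.mul_sum, trace_sum]
      refine Finset.sum_congr rfl fun k _ => ?_
      rw [trace_mul_comm (Yᴴ * σ), Matrix.mul_assoc, Matrix.mul_assoc, trace_mul_comm (K k)]
      simp only [Matrix.mul_assoc]
      rw [← Matrix.mul_assoc, trace_mul_comm]
      simp only [Matrix.mul_assoc]
    have e4 : ∑ k, (K k * Yᴴ * σ * (Y * (K k)ᴴ)).trace = (Yᴴ * σ * Y).trace := by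
      have : ∀ k, (K k * Yᴴ * σ * (Y * (K k)ᴴ)).trace = ((K k)ᴴ * K k * (Yᴴ * σ * Y)).trace := by
        intro k
        rw [← Matrix.mul_assoc, trace_mul_comm]
        simp only [Matrix.mul_assoc]
      simp only [this]
      rw [← trace_sum, ← Matrix.sum_mul, hK, Matrix.one_mul]
    simp only [trace_sum, conjTranspose_sub, conjTranspose_mul, conjTranspose_conjTranspose,
      Matrix.sub_mul, Matrix.mul_sub, trace_sub, Finset.sum_sub_distrib]
    rw [e1, e2, e3, e4]
    ring
  rw [h1] at h0
  have := (Complex.le_def.1 h0).1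
  simp only [Complex.zero_re, Complex.sub_re] at this
  linarith

/-- The linear terms agree by duality. The two quadratic terms are controlled by the Schwarz
inequality, used for `X` with `σ` and for `Xᴴ` with `ρ`. -/
theorem quadVal_krausMap_le (K : κ → Matrix B A ℂ) (hK : ∑ k, (K k)ᴴ * K k = 1)
    {ρ σ : Matrix A A ℂ} (hρ : ρ.PosSemidef) (hσ : σ.PosSemidef) {u : ℝ} (hu0 : 0 ≤ u)
    (hu1 : u ≤ 1) (X : Matrix B B ℂ) :
    quadVal u X (krausMap K ρ) (krausMap K σ) ≤ quadVal u (∑ k, (K k)ᴴ * X * K k) ρ σ := by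
  have hlin : ∀ τ : Matrix A A ℂ,
      ((∑ k, (K k)ᴴ * X * K k)ᴴ * τ).trace = (Xᴴ * krausMap K τ).trace := by
    intro τ
    simp only [krausMap, conjTranspose_sum, Matrix.mul_sum, Matrix.sum_mul, trace_sum,
      conjTranspose_mul, conjTranspose_conjTranspose]
    refine Finset.sum_congr rfl fun k _ => ?_
    rw [Matrix.mul_assoc, trace_mul_comm]
    simp only [Matrix.mul_assoc]
  have h1 := trace_kraus_sq_nonneg K hK hσ X
  have h2 := trace_kraus_sq_nonneg K hK hρ Xᴴ
  have hs : (∑ k, (K k)ᴴ * Xᴴ * K k) = (∑ k, (K k)ᴴ * X * K k)ᴴ := by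
    simp [conjTranspose_sum, Matrix.mul_assoc]
  rw [hs, conjTranspose_conjTranspose, conjTranspose_conjTranspose, ← trace_mul_cycle,
    trace_mul_cycle X, ← trace_mul_cycle _ _ ρ] at h2
  simp only [quadVal, hlin]
  have := mul_le_mul_of_nonneg_left h1 hu0
  have := mul_le_mul_of_nonneg_left h2 (sub_nonneg.2 hu1)
  linarith

/-- The supremum of `quadVal` in terms of spectral decompositions with overlap matrix `O`. -/
def quadDiv (u : ℝ) (O : Matrix A A ℂ) (p q : A → ℝ) : ℝ :=
  ∑ j, ∑ i, Complex.normSq (O j i) * ((p i - q j) ^ 2 / (u * q j + (1 - u) * p i))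

/-- Written between the eigenbases of the two matrices, the functional decouples into one scalar
quadratic for each entry of `Y`. -/
theorem quadVal_eq (u : ℝ) {V W : Matrix A A ℂ} (hV : Vᴴ * V = 1) (hW : Wᴴ * W = 1)
    (Y : Matrix A A ℂ) (p q : A → ℝ) :
    quadVal u (W * Y * Vᴴ) (V * diagonal (fun i => (p i : ℂ)) * Vᴴ)
        (W * diagonal (fun i => (q i : ℂ)) * Wᴴ) =
      ∑ j, ∑ i, (2 * (star (Y j i) * (Wᴴ * V) j i).re * (p i - q j) -
        (u * q j + (1 - u) * p i) * Complex.normSq (Y j i)) := by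
  have e1 : ((W * Y * Vᴴ)ᴴ * (V * diagonal (fun i => (p i : ℂ)) * Vᴴ)).trace =
      (Yᴴ * ((Wᴴ * V) * diagonal (fun i => (p i : ℂ)))).trace := by
    simp only [conjTranspose_mul, conjTranspose_conjTranspose]
    rw [trace_mul_comm]
    simp only [Matrix.mul_assoc]
    rw [← Matrix.mul_assoc Vᴴ V, hV, Matrix.one_mul, trace_mul_comm, Matrix.mul_assoc,
      trace_mul_comm]
    simp only [Matrix.mul_assoc]
  have e2 : ((W * Y * Vᴴ)ᴴ * (W * diagonal (fun i => (q i : ℂ)) * Wᴴ)).trace =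
      (Yᴴ * (diagonal (fun i => (q i : ℂ)) * (Wᴴ * V))).trace := by
    simp only [conjTranspose_mul, conjTranspose_conjTranspose, Matrix.mul_assoc]
    rw [← Matrix.mul_assoc Wᴴ W, hW, Matrix.one_mul, trace_mul_comm]
    simp only [Matrix.mul_assoc]
  have e3 : ((W * Y * Vᴴ)ᴴ * (W * diagonal (fun i => (q i : ℂ)) * Wᴴ) * (W * Y * Vᴴ)).trace =
      (Yᴴ * (diagonal (fun i => (q i : ℂ)) * Y)).trace := by
    simp only [conjTranspose_mul, conjTranspose_conjTranspose, Matrix.mul_assoc]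
    rw [← Matrix.mul_assoc Wᴴ W, hW, Matrix.one_mul, ← Matrix.mul_assoc Wᴴ W, hW, Matrix.one_mul,
      trace_mul_comm]
    simp only [Matrix.mul_assoc]
    rw [hV, Matrix.mul_one]
  have e4 : ((W * Y * Vᴴ)ᴴ * (W * Y * Vᴴ) * (V * diagonal (fun i => (p i : ℂ)) * Vᴴ)).trace =
      (Yᴴ * (Y * diagonal (fun i => (p i : ℂ)))).trace := by
    simp only [conjTranspose_mul, conjTranspose_conjTranspose, Matrix.mul_assoc]
    rw [← Matrix.mul_assoc Wᴴ W, hW, Matrix.one_mul, ← Matrix.mul_assoc Vᴴ V, hV, Matrix.one_mul,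
      trace_mul_comm]
    simp only [Matrix.mul_assoc]
    rw [hV, Matrix.mul_one]
  have t : ∀ Z : Matrix A A ℂ, (Yᴴ * Z).trace.re = ∑ j, ∑ i, (star (Y j i) * Z j i).re := by
    intro Z
    simp only [trace, diag_apply, Matrix.mul_apply, conjTranspose_apply, Complex.re_sum]
    exact Finset.sum_comm
  rw [quadVal, e1, e2, e3, e4, t, t, t, t]
  simp only [mul_sub, Finset.mul_sum, ← Finset.sum_sub_distrib]
  refine Finset.sum_congr rfl fun j _ => Finset.sum_congr rfl fun i _ => ?_
  rw [mul_diagonal, mul_diagonal, diagonal_mul, diagonal_mul]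
  simp only [RCLike.star_def, Complex.mul_re, Complex.mul_im, Complex.conj_re, Complex.conj_im,
    Complex.normSq_apply, Complex.ofReal_re, Complex.ofReal_im]
  ring

/-- The optimal `X` for the outputs, pulled back by the dual map, is a competitor in the supremum
for the inputs. -/
theorem quadDiv_monotone (K : κ → Matrix B A ℂ) (hK : ∑ k, (K k)ᴴ * K k = 1)
    {V W : Matrix A A ℂ} (hV : Vᴴ * V = 1) (hV' : V * Vᴴ = 1) (hW : Wᴴ * W = 1)
    (hW' : W * Wᴴ = 1) {p q : A → ℝ}
    {V' W' : Matrix B B ℂ} (hV1 : V'ᴴ * V' = 1) (hW1 : W'ᴴ * W' = 1)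
    {p' q' : B → ℝ} (hp : ∀ i, 0 ≤ p i) (hq : ∀ i, 0 ≤ q i) (hp' : ∀ i, 0 ≤ p' i)
    (hq' : ∀ i, 0 ≤ q' i)
    (hρ : krausMap K (V * diagonal (fun i => (p i : ℂ)) * Vᴴ) =
      V' * diagonal (fun i => (p' i : ℂ)) * V'ᴴ)
    (hσ : krausMap K (W * diagonal (fun i => (q i : ℂ)) * Wᴴ) =
      W' * diagonal (fun i => (q' i : ℂ)) * W'ᴴ)
    {u : ℝ} (hu0 : 0 < u) (hu1 : u < 1) :
    quadDiv u (W'ᴴ * V') p' q' ≤ quadDiv u (Wᴴ * V) p q := by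
  have hpsd : ∀ (V : Matrix A A ℂ) (p : A → ℝ), (∀ i, 0 ≤ p i) →
      (V * diagonal (fun i => (p i : ℂ)) * Vᴴ).PosSemidef := by
    intro V p hp
    refine PosSemidef.mul_mul_conjTranspose_same (PosSemidef.diagonal fun i => ?_) V
    simpa using hp i
  -- Here 0 < u < 1 matters: the denominator can vanish only if both eigenvalues do.
  have hz : ∀ {a b : ℝ}, 0 ≤ a → 0 ≤ b → u * b + (1 - u) * a = 0 → a - b = 0 := by
    intro a b ha hb h
    have h1 : 0 ≤ u * b := by positivity
    have h2 : 0 ≤ (1 - u) * a := mul_nonneg (by linarith) ha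
    have hb0 : b = 0 := by
      rcases mul_eq_zero.1 (show u * b = 0 by linarith) with h | h
      · exact absurd h hu0.ne'
      · exact h
    have ha0 : a = 0 := by
      rcases mul_eq_zero.1 (show (1 - u) * a = 0 by linarith) with h | h
      · linarith
      · exact h
    simp [ha0, hb0]
  -- The entrywise maximizer from `quadratic_eq`.
  set Y' : Matrix B B ℂ := of fun j i =>
    (((p' i - q' j) / (u * q' j + (1 - u) * p' i) : ℝ) : ℂ) * (W'ᴴ * V') j i with hY'
  have h1 : quadDiv u (W'ᴴ * V') p' q' = quadVal u (W' * Y' * V'ᴴ)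
      (V' * diagonal (fun i => (p' i : ℂ)) * V'ᴴ) (W' * diagonal (fun i => (q' i : ℂ)) * W'ᴴ) := by
    rw [quadVal_eq u hV1 hW1, quadDiv]
    refine Finset.sum_congr rfl fun j _ => Finset.sum_congr rfl fun i _ => ?_
    exact (quadratic_eq (hz (hp' i) (hq' j)) _).symm
  rw [h1, ← hρ, ← hσ]
  refine (quadVal_krausMap_le K hK (hpsd V p hp) (hpsd W q hq) hu0.le hu1.le _).trans ?_
  set X := ∑ k, (K k)ᴴ * (W' * Y' * V'ᴴ) * K k
  have hX : X = W * (Wᴴ * X * V) * Vᴴ := by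
    simp only [← Matrix.mul_assoc]
    rw [hW', Matrix.one_mul, Matrix.mul_assoc, hV', Matrix.mul_one]
  rw [hX, quadVal_eq u hV hW, quadDiv]
  refine Finset.sum_le_sum fun j _ => Finset.sum_le_sum fun i _ => ?_
  refine quadratic_le ?_ (hz (hp i) (hq j)) _ _
  have := hp i
  have := hq j
  have : 0 ≤ 1 - u := by linarith
  positivity

/-- The relative entropy (in nats, up to the traces) of matrices with spectra `p`, `q` and overlap
matrix `O`. -/
def overlapDiv (O : Matrix A A ℂ) (p q : A → ℝ) : ℝ :=
  ∑ j, ∑ i, Complex.normSq (O j i) *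
    (p i * Real.log (p i) - p i * Real.log (q j) - p i + q j)

/-- The scalar integral formula is summed over pairs of eigenvectors. Orthogonal pairs contribute
nothing, so the support condition is needed only where the overlap is nonzero. -/
theorem overlapDiv_integral (O : Matrix A A ℂ) {p q : A → ℝ} (hp : ∀ i, 0 ≤ p i)
    (hq : ∀ i, 0 ≤ q i) (h : ∀ j i, q j = 0 → O j i = 0 ∨ p i = 0) :
    IntervalIntegrable (fun u => u * quadDiv u O p q) MeasureTheory.volume 0 1 ∧
      ∫ u in (0 : ℝ)..1, u * quadDiv u O p q = overlapDiv O p q := by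
  have hfun : (fun u => u * quadDiv u O p q) = fun u => ∑ j, ∑ i, Complex.normSq (O j i) *
      (u * ((p i - q j) ^ 2 / (u * q j + (1 - u) * p i))) := by
    ext u
    simp only [quadDiv, Finset.mul_sum]
    refine Finset.sum_congr rfl fun j _ => Finset.sum_congr rfl fun i _ => by ring
  have key : ∀ j i, IntervalIntegrable (fun u => Complex.normSq (O j i) *
        (u * ((p i - q j) ^ 2 / (u * q j + (1 - u) * p i)))) MeasureTheory.volume 0 1 ∧
      ∫ u in (0 : ℝ)..1, Complex.normSq (O j i) *
        (u * ((p i - q j) ^ 2 / (u * q j + (1 - u) * p i))) = Complex.normSq (O j i) *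
          (p i * Real.log (p i) - p i * Real.log (q j) - p i + q j) := by
    intro j i
    by_cases hO : O j i = 0
    · simp [hO]
    · obtain ⟨h1, h2⟩ := intervalIntegrable_and_integral_quadratic (hp i) (hq j)
        fun h0 => (h j i h0).resolve_left hO
      exact ⟨h1.const_mul _, by rw [intervalIntegral.integral_const_mul, h2]⟩
  have hi : ∀ j, IntervalIntegrable (fun u => ∑ i, Complex.normSq (O j i) *
      (u * ((p i - q j) ^ 2 / (u * q j + (1 - u) * p i)))) MeasureTheory.volume 0 1 := by
    intro j
    simpa only [Finset.sum_fn] using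
      IntervalIntegrable.sum Finset.univ fun i _ => (key j i).1
  rw [hfun]
  constructor
  · simpa only [Finset.sum_fn] using IntervalIntegrable.sum Finset.univ fun j _ => hi j
  · rw [intervalIntegral.integral_finsetSum fun j _ => hi j, overlapDiv]
    refine Finset.sum_congr rfl fun j _ => ?_
    rw [intervalIntegral.integral_finsetSum fun i _ => (key j i).1]
    exact Finset.sum_congr rfl fun i _ => (key j i).2

theorem conj_diagonal_apply_diag (W V : Matrix A A ℂ) (p : A → ℝ) (j : A) :
    (Wᴴ * (V * diagonal (fun i => (p i : ℂ)) * Vᴴ) * W) j j =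
      ((∑ i, Complex.normSq ((Wᴴ * V) j i) * p i : ℝ) : ℂ) := by
  have : Wᴴ * (V * diagonal (fun i => (p i : ℂ)) * Vᴴ) * W =
      (Wᴴ * V) * diagonal (fun i => (p i : ℂ)) * (Wᴴ * V)ᴴ := by
    simp only [conjTranspose_mul, conjTranspose_conjTranspose, Matrix.mul_assoc]
  rw [this, Matrix.mul_apply, Complex.ofReal_sum]
  refine Finset.sum_congr rfl fun i _ => ?_
  rw [mul_diagonal, conjTranspose_apply, Complex.ofReal_mul, ← Complex.mul_conj]
  simp only [RCLike.star_def]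
  ring

theorem sum_normSq_row {O : Matrix A A ℂ} (h : O * Oᴴ = 1) (j : A) :
    ∑ i, Complex.normSq (O j i) = 1 := by
  have := congrFun (congrFun h j) j
  rw [Matrix.mul_apply, one_apply_eq] at this
  have h2 : ((∑ i, Complex.normSq (O j i) : ℝ) : ℂ) = 1 := by
    rw [← this, Complex.ofReal_sum]
    exact Finset.sum_congr rfl fun i _ => by rw [← Complex.mul_conj]; rfl
  exact_mod_cast h2

theorem sum_normSq_col {O : Matrix A A ℂ} (h : Oᴴ * O = 1) (i : A) :
    ∑ j, Complex.normSq (O j i) = 1 := by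
  have := congrFun (congrFun h i) i
  rw [Matrix.mul_apply, one_apply_eq] at this
  have h2 : ((∑ j, Complex.normSq (O j i) : ℝ) : ℂ) = 1 := by
    rw [← this, Complex.ofReal_sum]
    refine Finset.sum_congr rfl fun j _ => ?_
    rw [← Complex.mul_conj, mul_comm]; rfl
  exact_mod_cast h2

/-- The data of spectral decompositions of a family and of its sum, with the resulting expression
of the Holevo information as an integral of `quadDiv`. -/
theorem holevo_eq_sum_overlapDiv {ι : Type*} [Fintype ι] {M : ι → Matrix A A ℂ}
    {V : ι → Matrix A A ℂ} {W : Matrix A A ℂ} (hV : ∀ i, (V i)ᴴ * V i = 1)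
    (hV' : ∀ i, V i * (V i)ᴴ = 1) (hW : Wᴴ * W = 1) (hW' : W * Wᴴ = 1)
    {p : ι → A → ℝ} {q : A → ℝ} (hM : ∀ i, M i = V i * diagonal (fun a => (p i a : ℂ)) * (V i)ᴴ)
    (hS : ∑ i, M i = W * diagonal (fun a => (q a : ℂ)) * Wᴴ) :
    Real.log 2 * (entropy (∑ i, M i) - ∑ i, entropy (M i)) =
      ∑ i, overlapDiv (Wᴴ * V i) (p i) q + (1 - Fintype.card ι) * (∑ i, M i).trace.re := by
  have hl : Real.log 2 ≠ 0 := (Real.log_pos one_lt_two).ne'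
  have hO1 : ∀ i, (Wᴴ * V i)ᴴ * (Wᴴ * V i) = 1 := by
    intro i
    rw [conjTranspose_mul, conjTranspose_conjTranspose, Matrix.mul_assoc, ← Matrix.mul_assoc W,
      hW', Matrix.one_mul, hV]
  have hO2 : ∀ i, (Wᴴ * V i) * (Wᴴ * V i)ᴴ = 1 := by
    intro i
    rw [conjTranspose_mul, conjTranspose_conjTranspose, Matrix.mul_assoc, ← Matrix.mul_assoc (V i),
      hV', Matrix.one_mul, hW]
  -- The diagonal of the sum in its own eigenbasis `W`, computed from the members.
  have hsum : ∀ j, ∑ i, ∑ a, Complex.normSq ((Wᴴ * V i) j a) * p i a = q j := by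
    intro j
    have h1 : (Wᴴ * (∑ i, M i) * W) j j = q j := by
      rw [hS, conj_diagonal_apply_diag, hW]
      simp [one_apply, apply_ite Complex.normSq]
    rw [Matrix.mul_sum, Matrix.sum_mul, Matrix.sum_apply] at h1
    simp only [hM, conj_diagonal_apply_diag] at h1
    rw [← Complex.ofReal_sum] at h1
    exact_mod_cast h1
  -- The squared overlaps are doubly stochastic. The terms `-p + q` contribute the trace of the sum
  -- minus that of the member; over all `i` this is `card ι - 1` times the trace of the sum, which
  -- the last term of the statement removes.
  have hdiv : ∀ i, overlapDiv (Wᴴ * V i) (p i) q = ∑ a, p i a * Real.log (p i a) -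
      ∑ j, (∑ a, Complex.normSq ((Wᴴ * V i) j a) * p i a) * Real.log (q j) -
        ∑ a, p i a + ∑ j, q j := by
    intro i
    have a1 : ∀ f : A → ℝ, ∑ j, ∑ a, Complex.normSq ((Wᴴ * V i) j a) * f a = ∑ a, f a := by
      intro f
      rw [Finset.sum_comm]
      refine Finset.sum_congr rfl fun a _ => ?_
      rw [← Finset.sum_mul, sum_normSq_col (hO1 i), one_mul]
    have a2 : ∑ j, ∑ a, Complex.normSq ((Wᴴ * V i) j a) * q j = ∑ j, q j := by
      refine Finset.sum_congr rfl fun j _ => ?_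
      rw [← Finset.sum_mul, sum_normSq_row (hO2 i), one_mul]
    rw [← a1 (fun a => p i a * Real.log (p i a)), ← a1 (p i), ← a2, overlapDiv]
    simp only [Finset.sum_mul, ← Finset.sum_sub_distrib, ← Finset.sum_add_distrib]
    refine Finset.sum_congr rfl fun j _ => Finset.sum_congr rfl fun a _ => by ring
  have hent : ∀ i, entropy (M i) = ∑ a, nml (p i a) := by
    intro i; rw [hM i, entropy_conj_diagonal (hV i)]
  have htr : ∀ i, (M i).trace.re = ∑ a, p i a := by
    intro i; rw [hM i, trace_conj_diagonal (hV i), Complex.ofReal_re]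
  have htrS : (∑ i, M i).trace.re = ∑ j, q j := by
    rw [hS, trace_conj_diagonal hW, Complex.ofReal_re]
  have htrs : ∑ i, ∑ a, p i a = ∑ j, q j := by
    rw [← htrS, trace_sum, Complex.re_sum]
    exact Finset.sum_congr rfl fun i _ => (htr i).symm
  have hnml : ∀ t, Real.log 2 * nml t = -(t * Real.log t) := by
    intro t; rw [nml_eq, Real.negMulLog]; field_simp
  have hlogq : ∑ i, ∑ j, (∑ a, Complex.normSq ((Wᴴ * V i) j a) * p i a) * Real.log (q j) =
      ∑ j, q j * Real.log (q j) := by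
    rw [Finset.sum_comm]
    refine Finset.sum_congr rfl fun j _ => ?_
    rw [← Finset.sum_mul, hsum]
  rw [htrS, hS, entropy_conj_diagonal hW]
  have e : Real.log 2 * (∑ j, nml (q j) - ∑ i, ∑ a, nml (p i a)) =
      -∑ j, q j * Real.log (q j) + ∑ i, ∑ a, p i a * Real.log (p i a) := by
    simp only [mul_sub, Finset.mul_sum, hnml, Finset.sum_neg_distrib]
    ring
  simp only [hent, hdiv, e, Finset.sum_add_distrib, Finset.sum_sub_distrib, hlogq, htrs,
    Finset.sum_const, Finset.card_univ, nsmul_eq_mul]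
  ring

/-- Each member lies below the sum, so a null vector of the sum is a null vector of every member: a
vanishing sum of nonnegative terms vanishes termwise. -/
theorem overlap_eq_zero_or {ι : Type*} [Fintype ι] {M V : ι → Matrix A A ℂ} {p : ι → A → ℝ}
    {W : Matrix A A ℂ} {q : A → ℝ} (hM : ∀ i, M i = V i * diagonal (fun a => (p i a : ℂ)) * (V i)ᴴ)
    (hS : ∑ i, M i = W * diagonal (fun a => (q a : ℂ)) * Wᴴ) (hW : Wᴴ * W = 1)
    (hp : ∀ i a, 0 ≤ p i a) (i : ι) (j a : A) (hqj : q j = 0) :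
    (Wᴴ * V i) j a = 0 ∨ p i a = 0 := by
  have h1 : (Wᴴ * (∑ i, M i) * W) j j = q j := by
    rw [hS, conj_diagonal_apply_diag, hW]
    simp [one_apply, apply_ite Complex.normSq]
  rw [Matrix.mul_sum, Matrix.sum_mul, Matrix.sum_apply] at h1
  simp only [hM, conj_diagonal_apply_diag] at h1
  rw [← Complex.ofReal_sum, hqj, Complex.ofReal_inj] at h1
  have h2 := (Finset.sum_eq_zero_iff_of_nonneg fun i _ => Finset.sum_nonneg fun a _ =>
    mul_nonneg (Complex.normSq_nonneg _) (hp i a)).1 h1 i (Finset.mem_univ _)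
  have h3 := (Finset.sum_eq_zero_iff_of_nonneg fun a _ =>
    mul_nonneg (Complex.normSq_nonneg _) (hp i a)).1 h2 a (Finset.mem_univ _)
  rcases mul_eq_zero.1 h3 with h | h
  · exact Or.inl (Complex.normSq_eq_zero.1 h)
  · exact Or.inr h

/-- **Monotonicity of the Holevo information** under channels. -/
theorem entropy_holevo_monotone {ι : Type*} [Fintype ι] (K : κ → Matrix B A ℂ)
    (hK : ∑ k, (K k)ᴴ * K k = 1) {M : ι → Matrix A A ℂ} (hM : ∀ i, (M i).PosSemidef) :
    entropy (krausMap K (∑ i, M i)) - ∑ i, entropy (krausMap K (M i)) ≤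
      entropy (∑ i, M i) - ∑ i, entropy (M i) := by
  have hS : (∑ i, M i).PosSemidef := posSemidef_sum _ fun i _ => hM i
  have hM' : ∀ i, (krausMap K (M i)).PosSemidef := fun i => krausMap_posSemidef K (hM i)
  have hS' : (krausMap K (∑ i, M i)).PosSemidef := krausMap_posSemidef K hS
  choose V p hV hVV hMV hp using fun i => exists_diagonalization (hM i).1
  obtain ⟨W, q, hW, hWW, hSW, hq⟩ := exists_diagonalization hS.1
  choose V' p' hV' hVV' hMV' hp' using fun i => exists_diagonalization (hM' i).1
  obtain ⟨W', q', hW', hWW', hSW', hq'⟩ := exists_diagonalization hS'.1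
  have hs1 := overlap_eq_zero_or hMV hSW hW fun i => hp i (hM i)
  have hSW'' : ∑ i, krausMap K (M i) = W' * diagonal (fun a => (q' a : ℂ)) * W'ᴴ := by
    rw [← krausMap_sum]; exact hSW'
  have hs2 := overlap_eq_zero_or hMV' hSW'' hW' fun i => hp' i (hM' i)
  have hdiv : ∀ i, overlapDiv (W'ᴴ * V' i) (p' i) q' ≤ overlapDiv (Wᴴ * V i) (p i) q := by
    intro i
    obtain ⟨a1, a2⟩ := overlapDiv_integral (Wᴴ * V i) (hp i (hM i)) (hq hS) (hs1 i)
    obtain ⟨b1, b2⟩ := overlapDiv_integral (W'ᴴ * V' i) (hp' i (hM' i)) (hq' hS') (hs2 i)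
    rw [← a2, ← b2]
    refine intervalIntegral.integral_mono_on_of_le_Ioo zero_le_one b1 a1 fun u hu => ?_
    refine mul_le_mul_of_nonneg_left ?_ hu.1.le
    refine quadDiv_monotone K hK (hV i) (hVV i) hW hWW (hV' i) hW' (hp i (hM i)) (hq hS)
      (hp' i (hM' i)) (hq' hS') ?_ ?_ hu.1 hu.2
    · rw [← hMV, ← hMV']
    · rw [← hSW, ← hSW']
  have e1 := holevo_eq_sum_overlapDiv hV hVV hW hWW hMV hSW
  have e2 := holevo_eq_sum_overlapDiv hV' hVV' hW' hWW' hMV' hSW''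
  -- The trace corrections on both sides coincide, as Kraus maps preserve the trace, and so they
  -- cancel.
  rw [← krausMap_sum, trace_krausMap hK] at e2
  have := Finset.sum_le_sum fun i (_ : i ∈ Finset.univ) => hdiv i
  have hl : 0 < Real.log 2 := Real.log_pos one_lt_two
  refine le_of_mul_le_mul_left ?_ hl
  rw [e1, e2]
  linarith

theorem homEntropy_holevo_monotone {ι : Type*} [Fintype ι] (K : κ → Matrix B A ℂ)
    (hK : ∑ k, (K k)ᴴ * K k = 1) {M : ι → Matrix A A ℂ} (hM : ∀ i, (M i).PosSemidef) :
    homEntropy (krausMap K (∑ i, M i)) - ∑ i, homEntropy (krausMap K (M i)) ≤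
      homEntropy (∑ i, M i) - ∑ i, homEntropy (M i) := by
  have := entropy_holevo_monotone K hK hM
  simp only [homEntropy, trace_krausMap hK, Finset.sum_sub_distrib]
  linarith

end Kraus

/-! ## Outputs of an isometry -/

section Outputs

variable {A B E R P Q : Type*} [Fintype A] [DecidableEq A] [Fintype B] [DecidableEq B]
  [Fintype E] [DecidableEq E] [Fintype R] [DecidableEq R] [Fintype P] [DecidableEq P]
  [Fintype Q] [DecidableEq Q]

/-- The two marginals of a bipartite pure state have the same entropy. -/
theorem homEntropy_complement (K : Matrix P Q ℂ) :
    homEntropy (of fun q q' => ∑ p, K p q * star (K p q')) =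
      homEntropy (of fun p p' => ∑ q, K p q * star (K p' q)) := by
  have h1 : (of fun p p' => ∑ q, K p q * star (K p' q)) = K * Kᴴ := by
    ext; simp [Matrix.mul_apply]
  have h2 : (of fun q q' => ∑ p, K p q * star (K p q')) = (Kᴴ * K)ᵀ := by
    ext; simp [Matrix.mul_apply, mul_comm]
  rw [h1, h2, homEntropy_transpose (isHermitian_conjTranspose_mul_self K),
    homEntropy_mul_conjTranspose]

/-- Exhibits discarding a system as a Kraus map, to which monotonicity applies. -/
theorem traceSnd_eq_krausMap (M : Matrix (A × B) (A × B) ℂ) :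
    traceSnd M = krausMap (fun b => of fun (a : A) (s : A × B) => if s = (a, b) then 1 else 0) M := by
  ext a a'
  simp only [traceSnd, krausMap, Matrix.sum_apply, of_apply]
  refine Finset.sum_congr rfl fun b _ => ?_
  simp [Matrix.mul_apply, apply_ite]

theorem sum_kraus_traceSnd : ∑ b, (of fun (a : A) (s : A × B) => if s = (a, b) then (1 : ℂ) else 0)ᴴ *
    (of fun (a : A) (s : A × B) => if s = (a, b) then (1 : ℂ) else 0) = 1 := by
  ext s t
  simp only [Matrix.sum_apply, Matrix.mul_apply, conjTranspose_apply, of_apply, one_apply]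
  rw [← Fintype.sum_prod_type_right' (f := fun (a : A) (b : B) =>
    star (if s = (a, b) then (1 : ℂ) else 0) * if t = (a, b) then 1 else 0)]
  rw [Finset.sum_eq_single s (fun u _ hu => by simp [Ne.symm hu]) (by simp)]
  simp [eq_comm]

theorem traceSnd_posSemidef {M : Matrix (A × B) (A × B) ℂ} (hM : M.PosSemidef) :
    (traceSnd M).PosSemidef := by
  rw [traceSnd_eq_krausMap]; exact krausMap_posSemidef _ hM

theorem trace_traceSnd (M : Matrix (A × B) (A × B) ℂ) : (traceSnd M).trace = M.trace := by
  rw [traceSnd_eq_krausMap, trace_krausMap sum_kraus_traceSnd]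

theorem traceSnd_sum {ι : Type*} (s : Finset ι) (M : ι → Matrix (A × B) (A × B) ℂ) :
    traceSnd (∑ i ∈ s, M i) = ∑ i ∈ s, traceSnd (M i) := by
  simp only [traceSnd_eq_krausMap, krausMap_sum]

/-- Superadditivity of the homogeneous entropy (concavity of the entropy). -/
theorem sum_homEntropy_le {ι : Type*} [Fintype ι] {M : ι → Matrix A A ℂ}
    (hM : ∀ i, (M i).PosSemidef) : ∑ i, homEntropy (M i) ≤ homEntropy (∑ i, M i) := by
  -- Concavity is monotonicity under discarding the whole system, realized as the second factor of
  -- `Unit × A`; the one-dimensional remainder has homogeneous entropy zero.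
  have h := homEntropy_holevo_monotone
    (fun b => of fun (a : Unit) (s : Unit × A) => if s = (a, b) then (1 : ℂ) else 0)
    sum_kraus_traceSnd (M := fun i => (M i).submatrix Prod.snd Prod.snd)
    fun i => (hM i).submatrix _
  have hs : ∑ i, (M i).submatrix (Prod.snd : Unit × A → A) (Prod.snd : Unit × A → A) =
      (∑ i, M i).submatrix Prod.snd Prod.snd := by
    ext; simp [Matrix.sum_apply]
  have he : ∀ N : Matrix A A ℂ, N.PosSemidef →
      homEntropy (N.submatrix (Prod.snd : Unit × A → A) (Prod.snd : Unit × A → A)) = homEntropy N := fun N hN =>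
    homEntropy_submatrix hN.1 (Equiv.uniqueProd A Unit)
  have hu : ∀ N : Matrix (Unit × A) (Unit × A) ℂ, N.PosSemidef → homEntropy (krausMap
      (fun b => of fun (a : Unit) (s : Unit × A) => if s = (a, b) then (1 : ℂ) else 0) N) = 0 :=
    fun N hN => homEntropy_of_unique (krausMap_posSemidef _ hN).1
  have hS : (∑ i, M i).PosSemidef := posSemidef_sum _ fun i _ => hM i
  rw [hs, hu _ (hS.submatrix _), he _ hS, Finset.sum_congr rfl fun i _ => hu _ ((hM i).submatrix _),
    Finset.sum_congr rfl fun i _ => he _ (hM i)] at h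
  simpa using h

/-- The output of an isometry `U : A → B ⊗ E` on the system `B`. -/
def outB (U : Matrix (B × E) A ℂ) (M : Matrix A A ℂ) : Matrix B B ℂ := traceSnd (U * M * Uᴴ)

/-- The output of an isometry `U : A → B ⊗ E` on the system `E`. -/
def outE (U : Matrix (B × E) A ℂ) (M : Matrix A A ℂ) : Matrix E E ℂ := traceFst (U * M * Uᴴ)

/-- The isometry with its two output systems exchanged. -/
def swapOut (U : Matrix (B × E) A ℂ) : Matrix (E × B) A ℂ := U.submatrix Prod.swap id

theorem outE_eq_outB_swapOut (U : Matrix (B × E) A ℂ) (M : Matrix A A ℂ) :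
    outE U M = outB (swapOut U) M := by
  ext e e'
  simp [outE, outB, traceFst, traceSnd, swapOut, Matrix.mul_apply]

theorem outB_eq_outE_swapOut (U : Matrix (B × E) A ℂ) (M : Matrix A A ℂ) :
    outB U M = outE (swapOut U) M := by
  rw [outE_eq_outB_swapOut]; rfl

theorem swapOut_isometry {U : Matrix (B × E) A ℂ} (hU : Uᴴ * U = 1) :
    (swapOut U)ᴴ * swapOut U = 1 := by
  rw [← hU]
  ext a a'
  simp only [Matrix.mul_apply, swapOut, conjTranspose_apply, submatrix_apply, id]
  exact Equiv.sum_comp (Equiv.prodComm E B) fun s => star (U s a) * U s a'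

theorem outB_apply (U : Matrix (B × E) A ℂ) (M : Matrix A A ℂ) (b b' : B) :
    outB U M b b' = ∑ e, ∑ a, ∑ a', U (b, e) a * M a a' * star (U (b', e) a') := by
  simp only [outB, traceSnd, of_apply, Matrix.mul_apply, conjTranspose_apply, Finset.sum_mul]
  exact Finset.sum_congr rfl fun e _ => Finset.sum_comm

theorem outE_apply (U : Matrix (B × E) A ℂ) (M : Matrix A A ℂ) (e e' : E) :
    outE U M e e' = ∑ b, ∑ a, ∑ a', U (b, e) a * M a a' * star (U (b, e') a') := by
  rw [outE_eq_outB_swapOut, outB_apply]; rfl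

theorem outB_sum {ι : Type*} (U : Matrix (B × E) A ℂ) (s : Finset ι) (M : ι → Matrix A A ℂ) :
    outB U (∑ i ∈ s, M i) = ∑ i ∈ s, outB U (M i) := by
  simp only [outB, Matrix.mul_sum, Matrix.sum_mul, traceSnd_sum]

theorem outE_sum {ι : Type*} (U : Matrix (B × E) A ℂ) (s : Finset ι) (M : ι → Matrix A A ℂ) :
    outE U (∑ i ∈ s, M i) = ∑ i ∈ s, outE U (M i) := by
  simp only [outE_eq_outB_swapOut, outB_sum]

theorem outB_posSemidef (U : Matrix (B × E) A ℂ) {M : Matrix A A ℂ} (hM : M.PosSemidef) :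
    (outB U M).PosSemidef :=
  traceSnd_posSemidef (hM.mul_mul_conjTranspose_same U)

theorem outE_posSemidef (U : Matrix (B × E) A ℂ) {M : Matrix A A ℂ} (hM : M.PosSemidef) :
    (outE U M).PosSemidef := by
  rw [outE_eq_outB_swapOut]; exact outB_posSemidef _ hM

theorem trace_outB {U : Matrix (B × E) A ℂ} (hU : Uᴴ * U = 1) (M : Matrix A A ℂ) :
    (outB U M).trace = M.trace := by
  rw [outB, trace_traceSnd, trace_mul_comm, ← Matrix.mul_assoc, hU, Matrix.one_mul]

theorem trace_outE {U : Matrix (B × E) A ℂ} (hU : Uᴴ * U = 1) (M : Matrix A A ℂ) :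
    (outE U M).trace = M.trace := by
  rw [outE_eq_outB_swapOut, trace_outB (swapOut_isometry hU)]

/-- The entropy at the output `B`. -/
def hB (U : Matrix (B × E) A ℂ) (M : Matrix A A ℂ) : ℝ := homEntropy (outB U M)

/-- The entropy at the output `E`. -/
def hE (U : Matrix (B × E) A ℂ) (M : Matrix A A ℂ) : ℝ := homEntropy (outE U M)

theorem hE_eq_hB_swapOut (U : Matrix (B × E) A ℂ) (M : Matrix A A ℂ) :
    hE U M = hB (swapOut U) M := by
  rw [hE, hB, outE_eq_outB_swapOut]

theorem sum_hB_le {ι : Type*} [Fintype ι] (U : Matrix (B × E) A ℂ) {M : ι → Matrix A A ℂ}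
    (hM : ∀ i, (M i).PosSemidef) : ∑ i, hB U (M i) ≤ hB U (∑ i, M i) := by
  simp only [hB, outB_sum]
  exact sum_homEntropy_le fun i => outB_posSemidef U (hM i)

theorem sum_hE_le {ι : Type*} [Fintype ι] (U : Matrix (B × E) A ℂ) {M : ι → Matrix A A ℂ}
    (hM : ∀ i, (M i).PosSemidef) : ∑ i, hE U (M i) ≤ hE U (∑ i, M i) := by
  simp only [hE_eq_hB_swapOut]
  exact sum_hB_le _ hM

theorem outB_smul (U : Matrix (B × E) A ℂ) (c : ℂ) (M : Matrix A A ℂ) :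
    outB U (c • M) = c • outB U M := by
  ext; simp [outB, traceSnd, Finset.mul_sum]

theorem hB_smul (U : Matrix (B × E) A ℂ) (c : ℝ) {M : Matrix A A ℂ} (hM : M.PosSemidef) :
    hB U ((c : ℂ) • M) = c * hB U M := by
  rw [hB, outB_smul, homEntropy_smul (outB_posSemidef U hM).1, hB]

theorem hE_smul (U : Matrix (B × E) A ℂ) (c : ℝ) {M : Matrix A A ℂ} (hM : M.PosSemidef) :
    hE U ((c : ℂ) • M) = c * hE U M := by
  rw [hE_eq_hB_swapOut, hB_smul _ _ hM, hE_eq_hB_swapOut]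

theorem outB_mul_conjTranspose (U : Matrix (B × E) A ℂ) (T : Matrix A R ℂ) :
    outB U (T * Tᴴ) =
      of fun b b' => ∑ q : E × R, (U * T) (b, q.1) q.2 * star ((U * T) (b', q.1) q.2) := by
  have : U * (T * Tᴴ) * Uᴴ = (U * T) * (U * T)ᴴ := by
    rw [conjTranspose_mul]; simp only [Matrix.mul_assoc]
  ext b b'
  rw [outB, this]
  simp only [traceSnd, of_apply, Fintype.sum_prod_type]
  exact Finset.sum_congr rfl fun e _ => by
    rw [Matrix.mul_apply]
    rfl

theorem outE_mul_conjTranspose (U : Matrix (B × E) A ℂ) (T : Matrix A R ℂ) :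
    outE U (T * Tᴴ) =
      of fun e e' => ∑ q : B × R, (U * T) (q.1, e) q.2 * star ((U * T) (q.1, e') q.2) := by
  rw [outE_eq_outB_swapOut, outB_mul_conjTranspose]; rfl

/-- The entropy of the output `B` is that of the complementary output, together with the purifying
system of the input. -/
theorem hB_mul_conjTranspose (U : Matrix (B × E) A ℂ) (T : Matrix A R ℂ) :
    hB U (T * Tᴴ) = homEntropy (of fun q q' : E × R =>
      ∑ b, (U * T) (b, q.1) q.2 * star ((U * T) (b, q'.1) q'.2)) := by
  rw [hB, outB_mul_conjTranspose]
  exact (homEntropy_complement (of fun (b : B) (q : E × R) => (U * T) (b, q.1) q.2)).symm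

/-- The blocks of the joint state of environment and reference are values of the complementary map,
whence `hB` depends on that map only. -/
theorem sum_mul_star_eq_outE (U : Matrix (B × E) A ℂ) (T : Matrix A R ℂ) (q q' : E × R) :
    ∑ b, (U * T) (b, q.1) q.2 * star ((U * T) (b, q'.1) q'.2) =
      outE U (T * single q.2 q'.2 (1 : ℂ) * Tᴴ) q.1 q'.1 := by
  have : U * (T * single q.2 q'.2 (1 : ℂ) * Tᴴ) * Uᴴ = (U * T) * single q.2 q'.2 (1 : ℂ) * (U * T)ᴴ := by
    rw [conjTranspose_mul]; simp only [Matrix.mul_assoc]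
  rw [outE, this]
  simp only [traceFst, of_apply]
  refine Finset.sum_congr rfl fun b _ => ?_
  rw [Matrix.mul_apply (M := U * T * single q.2 q'.2 (1 : ℂ)), Finset.sum_eq_single q'.2 (fun c _ hc => by
    rw [Matrix.mul_single_apply_of_ne _ _ _ _ _ hc, zero_mul]) (by simp),
    Matrix.mul_single_apply_same, mul_one, conjTranspose_apply]

theorem hB_eq_of_outE_eq {B' : Type*} [Fintype B'] [DecidableEq B'] {U : Matrix (B × E) A ℂ}
    {U' : Matrix (B' × E) A ℂ} (h : ∀ M, outE U M = outE U' M) {M : Matrix A A ℂ}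
    (hM : M.PosSemidef) : hB U M = hB U' M := by
  obtain ⟨T, rfl⟩ := exists_eq_mul_conjTranspose hM
  rw [hB_mul_conjTranspose, hB_mul_conjTranspose]
  congr 1
  ext q q'
  rw [of_apply, of_apply]
  rw [sum_mul_star_eq_outE U, sum_mul_star_eq_outE U', h]

theorem hE_eq_of_outB_eq {E' : Type*} [Fintype E'] [DecidableEq E'] {U : Matrix (B × E) A ℂ}
    {U' : Matrix (B × E') A ℂ} (h : ∀ M, outB U M = outB U' M) {M : Matrix A A ℂ}
    (hM : M.PosSemidef) : hE U M = hE U' M := by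
  rw [hE_eq_hB_swapOut, hE_eq_hB_swapOut]
  refine hB_eq_of_outE_eq (fun M => ?_) hM
  rw [← outB_eq_outE_swapOut, ← outB_eq_outE_swapOut, h]

/-- A pure input makes the joint output on B and E pure; the purifying system is one-dimensional. -/
theorem hB_vecMulVec (U : Matrix (B × E) A ℂ) (v : A → ℂ) :
    hB U (vecMulVec v (star v)) = hE U (vecMulVec v (star v)) := by
  have : vecMulVec v (star v) = replicateCol Unit v * (replicateCol Unit v)ᴴ := by
    ext i j; simp [vecMulVec_apply, Matrix.mul_apply]
  rw [this, hB_mul_conjTranspose, hE, outE_mul_conjTranspose]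
  have h := homEntropy_submatrix (M := of fun e e' : E => ∑ q : B × Unit,
    (U * replicateCol Unit v) (q.1, e) q.2 * star ((U * replicateCol Unit v) (q.1, e') q.2))
    (by rw [← outE_mul_conjTranspose]
        exact (outE_posSemidef U (posSemidef_self_mul_conjTranspose _)).1) (Equiv.prodPUnit E)
  rw [← h]
  congr 1
  ext q q'
  simp [Fintype.sum_prod_type]

end Outputs

/-! ## Tensor products of isometries -/

section Tensor

variable {A₁ B₁ E₁ A₂ B₂ E₂ R : Type*} [Fintype A₁] [DecidableEq A₁] [Fintype B₁] [DecidableEq B₁]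
  [Fintype E₁] [DecidableEq E₁] [Fintype A₂] [DecidableEq A₂] [Fintype B₂] [DecidableEq B₂]
  [Fintype E₂] [DecidableEq E₂] [Fintype R] [DecidableEq R]

/-- Matrix units of a product are products of matrix units, so additive identities need only be
checked on Kronecker products. -/
theorem kronecker_induction {p : Matrix (A₁ × A₂) (A₁ × A₂) ℂ → Prop} (M)
    (hadd : ∀ M N, p M → p N → p (M + N)) (h0 : p 0) (hk : ∀ M N, p (M ⊗ₖ N)) : p M := by
  refine Matrix.induction_on' M h0 hadd fun i j x => ?_
  have : single i j x = single i.1 j.1 x ⊗ₖ single i.2 j.2 (1 : ℂ) := by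
    rw [single_kronecker_single]; simp
  rw [this]
  exact hk _ _

theorem krausMap_add {κ : Type*} [Fintype κ] (K : κ → Matrix B₁ A₁ ℂ) (M N : Matrix A₁ A₁ ℂ) :
    krausMap K (M + N) = krausMap K M + krausMap K N := by
  simp [krausMap, Matrix.mul_add, Matrix.add_mul, Finset.sum_add_distrib]

theorem krausMap_zero {κ : Type*} [Fintype κ] (K : κ → Matrix B₁ A₁ ℂ) :
    krausMap K 0 = 0 := by
  simp [krausMap]

theorem traceSnd_add (M N : Matrix (A₁ × A₂) (A₁ × A₂) ℂ) :
    traceSnd (M + N) = traceSnd M + traceSnd N := by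
  simp only [traceSnd_eq_krausMap, krausMap_add]

theorem traceSnd_zero : traceSnd (0 : Matrix (A₁ × A₂) (A₁ × A₂) ℂ) = 0 := by
  simp only [traceSnd_eq_krausMap, krausMap_zero]

theorem traceSnd_kronecker (M : Matrix A₁ A₁ ℂ) (N : Matrix A₂ A₂ ℂ) :
    traceSnd (M ⊗ₖ N) = N.trace • M := by
  ext; simp [traceSnd, trace, Finset.mul_sum, mul_comm]

theorem outB_add (U : Matrix (B₁ × E₁) A₁ ℂ) (M N : Matrix A₁ A₁ ℂ) :
    outB U (M + N) = outB U M + outB U N := by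
  simp only [outB, Matrix.mul_add, Matrix.add_mul, traceSnd_add]

theorem outB_zero (U : Matrix (B₁ × E₁) A₁ ℂ) : outB U 0 = 0 := by
  simp [outB, traceSnd_zero]

theorem outE_add (U : Matrix (B₁ × E₁) A₁ ℂ) (M N : Matrix A₁ A₁ ℂ) :
    outE U (M + N) = outE U M + outE U N := by
  simp only [outE_eq_outB_swapOut, outB_add]

theorem outE_zero (U : Matrix (B₁ × E₁) A₁ ℂ) : outE U 0 = 0 := by
  simp only [outE_eq_outB_swapOut, outB_zero]

/-- The tensor product of two isometries, with the outputs grouped. -/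
def tensorIso (U₁ : Matrix (B₁ × E₁) A₁ ℂ) (U₂ : Matrix (B₂ × E₂) A₂ ℂ) :
    Matrix ((B₁ × B₂) × (E₁ × E₂)) (A₁ × A₂) ℂ :=
  of fun o a => U₁ (o.1.1, o.2.1) a.1 * U₂ (o.1.2, o.2.2) a.2

theorem tensorIso_eq (U₁ : Matrix (B₁ × E₁) A₁ ℂ) (U₂ : Matrix (B₂ × E₂) A₂ ℂ) :
    tensorIso U₁ U₂ = (U₁ ⊗ₖ U₂).submatrix (Equiv.prodProdProdComm B₁ B₂ E₁ E₂) id := rfl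

theorem tensorIso_isometry {U₁ : Matrix (B₁ × E₁) A₁ ℂ} {U₂ : Matrix (B₂ × E₂) A₂ ℂ}
    (h₁ : U₁ᴴ * U₁ = 1) (h₂ : U₂ᴴ * U₂ = 1) : (tensorIso U₁ U₂)ᴴ * tensorIso U₁ U₂ = 1 := by
  have h : (U₁ ⊗ₖ U₂)ᴴ * (U₁ ⊗ₖ U₂) = 1 := by
    rw [conjTranspose_kronecker, ← mul_kronecker_mul, h₁, h₂, one_kronecker_one]
  rw [tensorIso_eq, conjTranspose_submatrix, submatrix_mul_equiv, h, submatrix_id_id]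

theorem outB_tensorIso_kronecker (U₁ : Matrix (B₁ × E₁) A₁ ℂ) (U₂ : Matrix (B₂ × E₂) A₂ ℂ)
    (M : Matrix A₁ A₁ ℂ) (N : Matrix A₂ A₂ ℂ) :
    outB (tensorIso U₁ U₂) (M ⊗ₖ N) = outB U₁ M ⊗ₖ outB U₂ N := by
  have : tensorIso U₁ U₂ * (M ⊗ₖ N) * (tensorIso U₁ U₂)ᴴ =
      ((U₁ * M * U₁ᴴ) ⊗ₖ (U₂ * N * U₂ᴴ)).submatrix (Equiv.prodProdProdComm B₁ B₂ E₁ E₂)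
        (Equiv.prodProdProdComm B₁ B₂ E₁ E₂) := by
    rw [tensorIso_eq, conjTranspose_submatrix, mul_kronecker_mul, mul_kronecker_mul,
      ← conjTranspose_kronecker]
    ext; rfl
  rw [outB, this]
  ext b b'
  simp only [traceSnd, of_apply, submatrix_apply, kroneckerMap_apply, outB,
    Fintype.sum_prod_type, Finset.sum_mul_sum]
  rfl

theorem swapOut_tensorIso (U₁ : Matrix (B₁ × E₁) A₁ ℂ) (U₂ : Matrix (B₂ × E₂) A₂ ℂ) :
    swapOut (tensorIso U₁ U₂) = tensorIso (swapOut U₁) (swapOut U₂) := rfl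

theorem outE_tensorIso_kronecker (U₁ : Matrix (B₁ × E₁) A₁ ℂ) (U₂ : Matrix (B₂ × E₂) A₂ ℂ)
    (M : Matrix A₁ A₁ ℂ) (N : Matrix A₂ A₂ ℂ) :
    outE (tensorIso U₁ U₂) (M ⊗ₖ N) = outE U₁ M ⊗ₖ outE U₂ N := by
  simp only [outE_eq_outB_swapOut, swapOut_tensorIso, outB_tensorIso_kronecker]

theorem outE_tensorIso_congr {B₁' B₂' : Type*} [Fintype B₁'] [DecidableEq B₁'] [Fintype B₂']
    [DecidableEq B₂'] {U₁ : Matrix (B₁ × E₁) A₁ ℂ} {U₂ : Matrix (B₂ × E₂) A₂ ℂ}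
    {V₁ : Matrix (B₁' × E₁) A₁ ℂ} {V₂ : Matrix (B₂' × E₂) A₂ ℂ}
    (h₁ : ∀ M, outE V₁ M = outE U₁ M) (h₂ : ∀ M, outE V₂ M = outE U₂ M) (M) :
    outE (tensorIso V₁ V₂) M = outE (tensorIso U₁ U₂) M := by
  induction M using kronecker_induction with
  | hadd M N hM hN => rw [outE_add, outE_add, hM, hN]
  | h0 => rw [outE_zero, outE_zero]
  | hk M N => rw [outE_tensorIso_kronecker, outE_tensorIso_kronecker, h₁, h₂]

theorem traceSnd_outB_tensorIso (U₁ : Matrix (B₁ × E₁) A₁ ℂ) {U₂ : Matrix (B₂ × E₂) A₂ ℂ}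
    (h₂ : U₂ᴴ * U₂ = 1) (M) :
    traceSnd (outB (tensorIso U₁ U₂) M) = outB U₁ (traceSnd M) := by
  induction M using kronecker_induction with
  | hadd M N hM hN => rw [outB_add, traceSnd_add, traceSnd_add, hM, hN, outB_add]
  | h0 => simp only [outB_zero, traceSnd_zero]
  | hk M N =>
    rw [outB_tensorIso_kronecker, traceSnd_kronecker, traceSnd_kronecker, outB_smul,
      trace_outB h₂]

theorem traceSnd_outE_tensorIso (U₁ : Matrix (B₁ × E₁) A₁ ℂ) {U₂ : Matrix (B₂ × E₂) A₂ ℂ}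
    (h₂ : U₂ᴴ * U₂ = 1) (M) :
    traceSnd (outE (tensorIso U₁ U₂) M) = outE U₁ (traceSnd M) := by
  rw [outE_eq_outB_swapOut, outE_eq_outB_swapOut, swapOut_tensorIso,
    traceSnd_outB_tensorIso _ (swapOut_isometry h₂)]

/-! ## Hadamard isometries -/

/-- The operator `⟨ψ| ⊗ 1`. -/
def sliceOp (A₂ : Type*) [DecidableEq A₂] (ψ : A₁ → ℂ) : Matrix A₂ (A₁ × A₂) ℂ :=
  of fun a s => if s.2 = a then star (ψ s.1) else 0

/-- The state `⟨ψ| M |ψ⟩` on the second system. -/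
def slice (ψ : A₁ → ℂ) (M : Matrix (A₁ × A₂) (A₁ × A₂) ℂ) : Matrix A₂ A₂ ℂ :=
  sliceOp A₂ ψ * M * (sliceOp A₂ ψ)ᴴ

theorem slice_add (ψ : A₁ → ℂ) (M N : Matrix (A₁ × A₂) (A₁ × A₂) ℂ) :
    slice ψ (M + N) = slice ψ M + slice ψ N := by
  simp only [slice, Matrix.mul_add, Matrix.add_mul]

theorem slice_zero (ψ : A₁ → ℂ) : slice ψ (0 : Matrix (A₁ × A₂) (A₁ × A₂) ℂ) = 0 := by
  simp [slice]

theorem slice_sum {ι : Type*} (s : Finset ι) (ψ : A₁ → ℂ)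
    (M : ι → Matrix (A₁ × A₂) (A₁ × A₂) ℂ) :
    slice ψ (∑ i ∈ s, M i) = ∑ i ∈ s, slice ψ (M i) := by
  simp only [slice, Matrix.mul_sum, Matrix.sum_mul]

theorem slice_posSemidef (ψ : A₁ → ℂ) {M : Matrix (A₁ × A₂) (A₁ × A₂) ℂ} (hM : M.PosSemidef) :
    (slice ψ M).PosSemidef := hM.mul_mul_conjTranspose_same _

theorem sliceOp_mul_apply (ψ : A₁ → ℂ) (T : Matrix (A₁ × A₂) R ℂ) (a : A₂) (r : R) :
    (sliceOp A₂ ψ * T) a r = ∑ a₁, star (ψ a₁) * T (a₁, a) r := by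
  simp [sliceOp, Matrix.mul_apply, Fintype.sum_prod_type]

theorem slice_kronecker (ψ : A₁ → ℂ) (M : Matrix A₁ A₁ ℂ) (N : Matrix A₂ A₂ ℂ) :
    slice ψ (M ⊗ₖ N) = (star ψ ⬝ᵥ (M *ᵥ ψ)) • N := by
  ext a a'
  have : (sliceOp A₂ ψ)ᴴ = of fun (s : A₁ × A₂) a => if s.2 = a then ψ s.1 else 0 := by
    ext; simp [sliceOp, apply_ite star]
  rw [slice, Matrix.mul_assoc, sliceOp_mul_apply, this]
  simp only [Matrix.mul_apply, of_apply, Fintype.sum_prod_type, kroneckerMap_apply, mul_ite,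
    mul_zero, Finset.sum_ite_eq', Finset.mem_univ, if_true, Matrix.smul_apply, smul_eq_mul, dotProduct,
    mulVec, Pi.star_apply, Finset.mul_sum, Finset.sum_mul]
  refine Finset.sum_congr rfl fun i _ => Finset.sum_congr rfl fun j _ => by ring

theorem slice_vecMulVec (ψ : A₁ → ℂ) (v : A₁ × A₂ → ℂ) :
    slice ψ (vecMulVec v (star v)) =
      vecMulVec (sliceOp A₂ ψ *ᵥ v) (star (sliceOp A₂ ψ *ᵥ v)) := by
  rw [slice, mul_vecMulVec, vecMulVec_mul, star_mulVec]

/-- The isometry `∑_z |z⟩ ⊗ |φ_z⟩⟨ψ_z|` of a Hadamard channel. -/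
def hadamardIso {Z : Type*} (ψ : Z → A₁ → ℂ) (φ : Z → E₁ → ℂ) : Matrix (Z × E₁) A₁ ℂ :=
  of fun o a => φ o.1 o.2 * star (ψ o.1 a)

variable {Z : Type*} [Fintype Z] [DecidableEq Z] {ψ : Z → A₁ → ℂ} {φ : Z → E₁ → ℂ}

theorem outE_hadamardIso (ψ : Z → A₁ → ℂ) (φ : Z → E₁ → ℂ) (M : Matrix A₁ A₁ ℂ) :
    outE (hadamardIso ψ φ) M =
      ∑ z, (star (ψ z) ⬝ᵥ (M *ᵥ ψ z)) • vecMulVec (φ z) (star (φ z)) := by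
  ext e e'
  simp only [outE_apply, hadamardIso, of_apply, Matrix.sum_apply, Matrix.smul_apply, smul_eq_mul,
    vecMulVec_apply, dotProduct, mulVec, Pi.star_apply, Finset.mul_sum, Finset.sum_mul, star_mul',
    star_star]
  refine Finset.sum_congr rfl fun z _ => Finset.sum_congr rfl fun i _ =>
    Finset.sum_congr rfl fun j _ => by ring

/-- The first environment holds a record `φ z` of the outcome z, and `slice (ψ z) M` is the
unnormalized state of the second input given that outcome. -/
theorem outE_tensorIso_hadamardIso (ψ : Z → A₁ → ℂ) (φ : Z → E₁ → ℂ)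
    (U₂ : Matrix (B₂ × E₂) A₂ ℂ) (M) :
    outE (tensorIso (hadamardIso ψ φ) U₂) M =
      ∑ z, vecMulVec (φ z) (star (φ z)) ⊗ₖ outE U₂ (slice (ψ z) M) := by
  induction M using kronecker_induction with
  | hadd M N hM hN =>
    simp only [outE_add, slice_add, hM, hN, kronecker_add, Finset.sum_add_distrib]
  | h0 => simp [outE_zero, slice_zero]
  | hk M N =>
    rw [outE_tensorIso_kronecker, outE_hadamardIso]
    have : ∀ z, outE U₂ (slice (ψ z) (M ⊗ₖ N)) = (star (ψ z) ⬝ᵥ (M *ᵥ ψ z)) • outE U₂ N := by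
      intro z
      rw [slice_kronecker, outE_eq_outB_swapOut, outB_smul, ← outE_eq_outB_swapOut]
    simp only [this]
    ext e e'
    simp only [kroneckerMap_apply, Matrix.sum_apply, Matrix.smul_apply, smul_eq_mul, Finset.sum_mul]
    exact Finset.sum_congr rfl fun z _ => by ring

theorem trace_vecMulVec_of_normalized {v : E₁ → ℂ} (h : star v ⬝ᵥ v = 1) :
    (vecMulVec v (star v)).trace = 1 := by
  rw [trace_vecMulVec, dotProduct_comm, h]

theorem vecMulVec_star_posSemidef (v : E₁ → ℂ) : (vecMulVec v (star v)).PosSemidef :=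
  posSemidef_vecMulVec_self_star v

/-- The environment entropy of a Hadamard channel is superadditive. -/
theorem hE_tensorIso_ge (hφ : ∀ z, star (φ z) ⬝ᵥ φ z = 1) {U₂ : Matrix (B₂ × E₂) A₂ ℂ}
    (h₂ : U₂ᴴ * U₂ = 1) {M} (hM : M.PosSemidef) :
    hE (hadamardIso ψ φ) (traceSnd M) + ∑ z, hE U₂ (slice (ψ z) M) ≤
      hE (tensorIso (hadamardIso ψ φ) U₂) M := by
  have hp : ∀ z, (outE U₂ (slice (ψ z) M)).PosSemidef := fun z =>
    outE_posSemidef _ (slice_posSemidef _ hM)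
  -- Monotonicity for the ensemble of the product states φ_z ⊗ τ_z, with τ_z the second environment
  -- given z, when E₂ is discarded. What remains of each member is a multiple of a pure state and
  -- has no entropy.
  have h := homEntropy_holevo_monotone _ (sum_kraus_traceSnd (A := E₁) (B := E₂))
    (M := fun z => vecMulVec (φ z) (star (φ z)) ⊗ₖ outE U₂ (slice (ψ z) M))
    fun z => (vecMulVec_star_posSemidef _).kronecker (hp z)
  simp only [← traceSnd_eq_krausMap, ← outE_tensorIso_hadamardIso, traceSnd_outE_tensorIso _ h₂,
    traceSnd_kronecker] at h
  have e1 : ∀ z, homEntropy ((outE U₂ (slice (ψ z) M)).trace • vecMulVec (φ z) (star (φ z))) = 0 := by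
    intro z
    have : (outE U₂ (slice (ψ z) M)).trace = (((outE U₂ (slice (ψ z) M)).trace.re : ℝ) : ℂ) :=
      Complex.ext (by simp) (by simpa using ((Complex.le_def.1 (hp z).trace_nonneg).2).symm)
    rw [this, homEntropy_smul (vecMulVec_star_posSemidef _).1, homEntropy_vecMulVec, mul_zero]
  have e2 : ∀ z, homEntropy (vecMulVec (φ z) (star (φ z)) ⊗ₖ outE U₂ (slice (ψ z) M)) =
      hE U₂ (slice (ψ z) M) := by
    intro z
    rw [homEntropy_kronecker (vecMulVec_star_posSemidef _).1 (hp z).1, homEntropy_vecMulVec,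
      trace_vecMulVec_of_normalized (hφ z), hE]
    simp
  simp only [e1, e2, Finset.sum_const_zero] at h
  simp only [hE] at h ⊢
  linarith

theorem tensorIso_hadamardIso_mul_apply (ψ : Z → A₁ → ℂ) (φ : Z → E₁ → ℂ)
    (U₂ : Matrix (B₂ × E₂) A₂ ℂ) (T : Matrix (A₁ × A₂) R ℂ) (z : Z) (b : B₂) (e₁ : E₁) (e₂ : E₂)
    (r : R) :
    (tensorIso (hadamardIso ψ φ) U₂ * T) ((z, b), (e₁, e₂)) r =
      φ z e₁ * (U₂ * (sliceOp A₂ (ψ z) * T)) (b, e₂) r := by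
  rw [Matrix.mul_apply, Matrix.mul_apply, Fintype.sum_prod_type_right, Finset.mul_sum]
  refine Finset.sum_congr rfl fun a₂ _ => ?_
  rw [sliceOp_mul_apply, Finset.mul_sum, Finset.mul_sum]
  refine Finset.sum_congr rfl fun a₁ _ => ?_
  simp only [tensorIso, hadamardIso, of_apply]
  ring

/-- The output entropy of a Hadamard channel is bounded by means of a measurement of the first
output. -/
theorem hB_tensorIso_le (hφ : ∀ z, star (φ z) ⬝ᵥ φ z = 1) {U₂ : Matrix (B₂ × E₂) A₂ ℂ}
    (h₂ : U₂ᴴ * U₂ = 1) {M} (hM : M.PosSemidef) :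
    hB (tensorIso (hadamardIso ψ φ) U₂) M ≤
      hB (hadamardIso ψ φ) (traceSnd M) + ∑ z, hB U₂ (slice (ψ z) M) := by
  obtain ⟨T, rfl⟩ := exists_eq_mul_conjTranspose hM
  -- `T` purifies the input with reference R = `A₁ × A₂`. The joint output vector is ∑_z |z⟩ ⊗ v_z,
  -- where v_z is the product of φ_z and the vector ω_z on E₂, R and B₂. Monotonicity is applied to
  -- the pure states v_z when B₂ is discarded.
  set ω : Z → B₂ → E₂ × (A₁ × A₂) → ℂ := fun z b q => (U₂ * (sliceOp A₂ (ψ z) * T)) (b, q.1) q.2 with hω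
  set v : Z → (E₁ × (E₂ × (A₁ × A₂))) × B₂ → ℂ := fun z s => φ z s.1.1 * ω z s.2 s.1.2 with hv
  have h := homEntropy_holevo_monotone _ (sum_kraus_traceSnd (A := E₁ × (E₂ × (A₁ × A₂))) (B := B₂))
    (M := fun z => vecMulVec (v z) (star (v z))) fun z => vecMulVec_star_posSemidef _
  simp only [← traceSnd_eq_krausMap, homEntropy_vecMulVec, Finset.sum_const_zero, sub_zero] at h
  have hΨ : ∀ z b e₁ q, (tensorIso (hadamardIso ψ φ) U₂ * T) ((z, b), (e₁, q.1)) q.2 =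
      v z ((e₁, q), b) := fun z b e₁ q => tensorIso_hadamardIso_mul_apply _ _ _ _ _ _ _ _ _
  -- the entropy of the first output
  have e1 : homEntropy (∑ z, vecMulVec (v z) (star (v z))) =
      hB (hadamardIso ψ φ) (traceSnd (T * Tᴴ)) := by
    have := homEntropy_complement (of v)
    rw [hB, ← traceSnd_outB_tensorIso _ h₂, outB_mul_conjTranspose]
    convert this using 2
    · ext; simp [Matrix.sum_apply, vecMulVec_apply]
    · ext z z'
      simp only [traceSnd, of_apply]
      rw [Fintype.sum_prod_type_right (α₁ := E₁ × (E₂ × (A₁ × A₂)))]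
      refine Finset.sum_congr rfl fun b _ => ?_
      rw [← Equiv.sum_comp (Equiv.prodAssoc E₁ E₂ (A₁ × A₂))]
      exact Finset.sum_congr rfl fun q _ => by simp only [← hΨ, Equiv.prodAssoc_apply]
  -- the entropy of both outputs
  have e2 : homEntropy (traceSnd (∑ z, vecMulVec (v z) (star (v z)))) =
      hB (tensorIso (hadamardIso ψ φ) U₂) (T * Tᴴ) := by
    have := homEntropy_complement
      (of fun (p : Z × B₂) (q : E₁ × (E₂ × (A₁ × A₂))) => v p.1 (q, p.2))
    rw [hB, outB_mul_conjTranspose]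
    convert this using 2
    · ext
      simp only [traceSnd, of_apply, Matrix.sum_apply, vecMulVec_apply, Fintype.sum_prod_type,
        Pi.star_apply]
      exact Finset.sum_comm
    · ext p p'
      simp only [of_apply, Fintype.sum_prod_type, ← hΨ]
  -- the entropy of the second output, given the outcome of the measurement
  have e3 : ∀ z, homEntropy (traceSnd (vecMulVec (v z) (star (v z)))) =
      hB U₂ (slice (ψ z) (T * Tᴴ)) := by
    intro z
    have h3 : slice (ψ z) (T * Tᴴ) = (sliceOp A₂ (ψ z) * T) * (sliceOp A₂ (ψ z) * T)ᴴ := by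
      rw [slice, conjTranspose_mul]; simp only [Matrix.mul_assoc]
    have h4 : traceSnd (vecMulVec (v z) (star (v z))) = vecMulVec (φ z) (star (φ z)) ⊗ₖ
        of fun q q' : E₂ × (A₁ × A₂) => ∑ b, ω z b q * star (ω z b q') := by
      ext s s'
      simp only [traceSnd, of_apply, vecMulVec_apply, Pi.star_apply, kroneckerMap_apply,
        Finset.mul_sum, hv, star_mul']
      exact Finset.sum_congr rfl fun b _ => by ring
    have h5 : (of fun q q' : E₂ × (A₁ × A₂) => ∑ b, ω z b q * star (ω z b q')).IsHermitian := by
      ext q q'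
      simp [mul_comm]
    rw [h3, hB_mul_conjTranspose, h4, homEntropy_kronecker (vecMulVec_star_posSemidef _).1 h5,
      homEntropy_vecMulVec, trace_vecMulVec_of_normalized (hφ z)]
    simp only [mul_zero, Complex.one_re, one_mul, zero_add]
    rfl
  rw [e1, e2, Finset.sum_congr rfl fun z _ => e3 z] at h
  linarith

/-- Trace preservation makes the operators |ψ_z⟩⟨ψ_z| a resolution of the identity, so summing over
the outcomes ignores the measurement. -/
theorem sum_slice (hiso : (hadamardIso ψ φ)ᴴ * hadamardIso ψ φ = 1)
    (hφ : ∀ z, star (φ z) ⬝ᵥ φ z = 1) (M : Matrix (A₁ × A₂) (A₁ × A₂) ℂ) :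
    ∑ z, slice (ψ z) M = traceFst M := by
  have hsum : ∀ N : Matrix A₁ A₁ ℂ, ∑ z, (star (ψ z) ⬝ᵥ (N *ᵥ ψ z)) = N.trace := by
    intro N
    rw [← trace_outE hiso N, outE_hadamardIso, trace_sum]
    refine Finset.sum_congr rfl fun z _ => ?_
    rw [trace_smul, trace_vecMulVec_of_normalized (hφ z), smul_eq_mul, mul_one]
  induction M using kronecker_induction with
  | hadd M N hM hN =>
    have : traceFst (M + N) = traceFst M + traceFst N := by
      ext; simp [traceFst, Finset.sum_add_distrib]
    simp only [slice_add, Finset.sum_add_distrib, hM, hN, this]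
  | h0 =>
    ext; simp [slice_zero, traceFst]
  | hk M N =>
    simp only [slice_kronecker]
    rw [← Finset.sum_smul, hsum]
    ext
    simp [traceFst, trace, Finset.sum_mul]

/-- Subadditivity of the output entropy. -/
theorem hB_tensorIso_le_add (hiso : (hadamardIso ψ φ)ᴴ * hadamardIso ψ φ = 1)
    (hφ : ∀ z, star (φ z) ⬝ᵥ φ z = 1) {U₂ : Matrix (B₂ × E₂) A₂ ℂ}
    (h₂ : U₂ᴴ * U₂ = 1) {M} (hM : M.PosSemidef) :
    hB (tensorIso (hadamardIso ψ φ) U₂) M ≤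
      hB (hadamardIso ψ φ) (traceSnd M) + hB U₂ (traceFst M) := by
  -- Forgetting the outcome z does not decrease entropy, by concavity.
  have := sum_hB_le U₂ fun z => slice_posSemidef (ψ z) hM
  rw [sum_slice hiso hφ] at this
  linarith [hB_tensorIso_le (ψ := ψ) hφ h₂ hM]

/-! ## Degradable isometries -/

/-- The isometry `U` has the same environment as an isometry whose output can be degraded to the
environment. -/
def IsDegradableIso (U : Matrix (B₁ × E₁) A₁ ℂ) : Prop :=
  ∃ (Z : Type) (_ : Fintype Z) (_ : DecidableEq Z) (V : Matrix (Z × E₁) A₁ ℂ) (κ : Type)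
    (_ : Fintype κ) (K : κ → Matrix E₁ Z ℂ),
    Vᴴ * V = 1 ∧ (∀ M, outE V M = outE U M) ∧ ∑ k, (K k)ᴴ * K k = 1 ∧
      ∀ M, krausMap K (outB V M) = outE V M

/-- The isometry `U` has the same environment as a Hadamard isometry. -/
def IsHadamardIso (U : Matrix (B₁ × E₁) A₁ ℂ) : Prop :=
  ∃ (Z : Type) (_ : Fintype Z) (_ : DecidableEq Z) (ψ : Z → A₁ → ℂ) (φ : Z → E₁ → ℂ),
    (hadamardIso ψ φ)ᴴ * hadamardIso ψ φ = 1 ∧ (∀ z, star (φ z) ⬝ᵥ φ z = 1) ∧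
      ∀ M, outE (hadamardIso ψ φ) M = outE U M

/-- Data processing through the degrading map, after replacing `U` by the isometry with the same
environment. -/
theorem IsDegradableIso.holevo_le {U : Matrix (B₁ × E₁) A₁ ℂ} (hU : IsDegradableIso U)
    {ι : Type*} [Fintype ι] {M : ι → Matrix A₁ A₁ ℂ} (hM : ∀ i, (M i).PosSemidef) :
    hE U (∑ i, M i) - ∑ i, hE U (M i) ≤ hB U (∑ i, M i) - ∑ i, hB U (M i) := by
  obtain ⟨Z, _, _, V, κ, _, K, -, hVU, hK, hKV⟩ := hU
  have hS : (∑ i, M i).PosSemidef := posSemidef_sum _ fun i _ => hM i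
  have h := homEntropy_holevo_monotone K hK (M := fun i => outB V (M i))
    fun i => outB_posSemidef V (hM i)
  rw [← outB_sum] at h
  simp only [hKV, hVU] at h
  rw [← hB_eq_of_outE_eq hVU hS, ← Finset.sum_congr rfl fun i _ => hB_eq_of_outE_eq hVU (hM i)]
  exact h

/-- The degrading map measures the output in the basis `Z` and prepares `φ z`. -/
theorem IsHadamardIso.isDegradableIso {U : Matrix (B₁ × E₁) A₁ ℂ} (hU : IsHadamardIso U) :
    IsDegradableIso U := by
  obtain ⟨Z, _, _, ψ, φ, hiso, hφ, hU⟩ := hU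
  refine ⟨Z, inferInstance, inferInstance, hadamardIso ψ φ, Z, inferInstance,
    fun z => of fun e z' => if z' = z then φ z e else 0, hiso, hU, ?_, fun M => ?_⟩
  · ext z z'
    simp only [Matrix.sum_apply, Matrix.mul_apply, conjTranspose_apply, of_apply, one_apply]
    rw [Finset.sum_eq_single z (fun y _ hy => by simp [Ne.symm hy]) (by simp)]
    by_cases h : z = z'
    · subst h
      simpa [dotProduct] using hφ z
    · simp [h, Ne.symm h]
  · rw [outE_hadamardIso]
    refine Finset.sum_congr rfl fun z _ => ?_
    have h1 : outB (hadamardIso ψ φ) M z z = star (ψ z) ⬝ᵥ (M *ᵥ ψ z) := by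
      have := hφ z
      simp only [dotProduct, Pi.star_apply] at this
      simp only [outB_apply, hadamardIso, of_apply, dotProduct, mulVec, Finset.mul_sum, star_mul',
        star_star, Pi.star_apply]
      calc _ = ∑ e, (star (φ z e) * φ z e) * ∑ i, ∑ j, star (ψ z i) * (M i j * ψ z j) := by
            simp only [Finset.mul_sum]
            refine Finset.sum_congr rfl fun e _ => Finset.sum_congr rfl fun i _ =>
              Finset.sum_congr rfl fun j _ => by ring
        _ = _ := by rw [← Finset.sum_mul, this, one_mul]
    ext e e'
    rw [Matrix.smul_apply, ← h1]
    simp only [Matrix.mul_apply, of_apply, conjTranspose_apply, ite_mul, zero_mul,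
      Finset.sum_ite_eq', Finset.mem_univ, if_true, smul_eq_mul, vecMulVec_apply, Pi.star_apply,
      apply_ite star, star_zero, mul_ite, mul_zero]
    ring

theorem krausMap_kronecker {κ₁ κ₂ : Type*} [Fintype κ₁] [Fintype κ₂] (K₁ : κ₁ → Matrix B₁ A₁ ℂ)
    (K₂ : κ₂ → Matrix B₂ A₂ ℂ) (M : Matrix A₁ A₁ ℂ) (N : Matrix A₂ A₂ ℂ) :
    krausMap (fun k : κ₁ × κ₂ => K₁ k.1 ⊗ₖ K₂ k.2) (M ⊗ₖ N) = krausMap K₁ M ⊗ₖ krausMap K₂ N := by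
  simp only [krausMap, conjTranspose_kronecker, ← mul_kronecker_mul, Fintype.sum_prod_type]
  ext
  simp only [Matrix.sum_apply, kroneckerMap_apply, Finset.sum_mul_sum]

theorem IsDegradableIso.tensorIso {U₁ : Matrix (B₁ × E₁) A₁ ℂ} {U₂ : Matrix (B₂ × E₂) A₂ ℂ}
    (h₁ : IsDegradableIso U₁) (h₂ : IsDegradableIso U₂) :
    IsDegradableIso (tensorIso U₁ U₂) := by
  obtain ⟨Z₁, _, _, V₁, κ₁, _, K₁, hV₁, hVU₁, hK₁, hKV₁⟩ := h₁
  obtain ⟨Z₂, _, _, V₂, κ₂, _, K₂, hV₂, hVU₂, hK₂, hKV₂⟩ := h₂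
  refine ⟨Z₁ × Z₂, inferInstance, inferInstance, PrivateDynamic.tensorIso V₁ V₂, κ₁ × κ₂,
    inferInstance, fun k => K₁ k.1 ⊗ₖ K₂ k.2, tensorIso_isometry hV₁ hV₂,
    outE_tensorIso_congr hVU₁ hVU₂, ?_, fun M => ?_⟩
  · simp only [conjTranspose_kronecker, ← mul_kronecker_mul, Fintype.sum_prod_type]
    have : ∑ x, ∑ y, ((K₁ x)ᴴ * K₁ x) ⊗ₖ ((K₂ y)ᴴ * K₂ y) =
        (∑ x, (K₁ x)ᴴ * K₁ x) ⊗ₖ (∑ y, (K₂ y)ᴴ * K₂ y) := by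
      ext
      simp only [Matrix.sum_apply, kroneckerMap_apply, Finset.sum_mul_sum]
    rw [this, hK₁, hK₂, one_kronecker_one]
  · induction M using kronecker_induction with
    | hadd M N hM hN => rw [outB_add, krausMap_add, hM, hN, outE_add]
    | h0 => rw [outB_zero, krausMap_zero, outE_zero]
    | hk M N =>
      rw [outB_tensorIso_kronecker, krausMap_kronecker, hKV₁, hKV₂, outE_tensorIso_kronecker]

end Tensor

/-! ## Rates of unnormalized ensembles -/

section Rate

variable {A B E : Type*} [Fintype A] [DecidableEq A] [Fintype B] [DecidableEq B]
  [Fintype E] [DecidableEq E] {X Y : Type*} [Fintype X] [Fintype Y]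

/-- An ensemble of unnormalized states. -/
structure IsFamily (G : X → Y → Matrix A A ℂ) : Prop where
  posSemidef : ∀ x y, (G x y).PosSemidef
  trace_sum : ∑ x, ∑ y, (G x y).trace = 1

/-- `I(XY;B)`. -/
def holevoB (U : Matrix (B × E) A ℂ) (G : X → Y → Matrix A A ℂ) : ℝ :=
  hB U (∑ x, ∑ y, G x y) - ∑ x, ∑ y, hB U (G x y)

/-- `I(Y;B|X)`. -/
def condB (U : Matrix (B × E) A ℂ) (G : X → Y → Matrix A A ℂ) : ℝ :=
  ∑ x, hB U (∑ y, G x y) - ∑ x, ∑ y, hB U (G x y)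

/-- `I(Y;E|X)`. -/
def condE (U : Matrix (B × E) A ℂ) (G : X → Y → Matrix A A ℂ) : ℝ :=
  ∑ x, hE U (∑ y, G x y) - ∑ x, ∑ y, hE U (G x y)

/-- The bounds on the rates `R + P`, `P + S`, `R + P + S`. -/
def rateTriple (U : Matrix (B × E) A ℂ) (G : X → Y → Matrix A A ℂ) : ℝ × ℝ × ℝ :=
  (holevoB U G, condB U G - condE U G, holevoB U G - condE U G)

/-- All triples of bounds on the rates. -/
def rateSet (U : Matrix (B × E) A ℂ) : Set (ℝ × ℝ × ℝ) :=
  {v | ∃ (m n : ℕ) (G : Fin m → Fin n → Matrix A A ℂ), IsFamily G ∧ v = rateTriple U G}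

/-- All triples satisfying the bounds for some ensemble. -/
def rateRegion (U : Matrix (B × E) A ℂ) : Set (ℝ × ℝ × ℝ) := {r | ∃ v ∈ rateSet U, r ≤ v}

/-- Frees the constructions below to index ensembles by products, sums and sigma types. -/
theorem rateTriple_mem_rateSet (U : Matrix (B × E) A ℂ) {G : X → Y → Matrix A A ℂ}
    (hG : IsFamily G) : rateTriple U G ∈ rateSet U := by
  set e := (Fintype.equivFin X).symm
  set f := (Fintype.equivFin Y).symm
  have hx : ∀ {α : Type} [AddCommMonoid α] (g : X → α), ∑ i, g (e i) = ∑ x, g x :=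
    fun g => Equiv.sum_comp e g
  refine ⟨_, _, fun i j => G (e i) (f j), ⟨fun i j => hG.posSemidef _ _, ?_⟩, ?_⟩
  · rw [← hG.trace_sum]
    have h1 : ∀ x, ∑ j, (G x (f j)).trace = ∑ y, (G x y).trace :=
      fun x => Equiv.sum_comp f fun y => (G x y).trace
    simp only [h1]
    exact hx fun x => ∑ y, (G x y).trace
  · have h1 : ∀ x, ∑ j, G x (f j) = ∑ y, G x y := fun x => Equiv.sum_comp f fun y => G x y
    have h2 : ∀ x, ∑ j, hB U (G x (f j)) = ∑ y, hB U (G x y) :=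
      fun x => Equiv.sum_comp f fun y => hB U (G x y)
    have h3 : ∀ x, ∑ j, hE U (G x (f j)) = ∑ y, hE U (G x y) :=
      fun x => Equiv.sum_comp f fun y => hE U (G x y)
    have h4 : ∑ i, ∑ y, G (e i) y = ∑ x, ∑ y, G x y := Equiv.sum_comp e fun x => ∑ y, G x y
    simp only [rateTriple, holevoB, condB, condE, h1, h2, h3, h4,
      hx fun x => ∑ y, hB U (G x y), hx fun x => ∑ y, hE U (G x y),
      hx fun x => hB U (∑ y, G x y), hx fun x => hE U (∑ y, G x y)]

theorem IsFamily.sum_posSemidef {G : X → Y → Matrix A A ℂ} (hG : IsFamily G) (x : X) :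
    (∑ y, G x y).PosSemidef := posSemidef_sum _ fun y _ => hG.posSemidef x y

theorem IsFamily.sum_sum_posSemidef {G : X → Y → Matrix A A ℂ} (hG : IsFamily G) :
    (∑ x, ∑ y, G x y).PosSemidef := posSemidef_sum _ fun x _ => hG.sum_posSemidef x

theorem rateTriple_congr {B' E' : Type*} [Fintype B'] [DecidableEq B'] [Fintype E']
    [DecidableEq E'] {U : Matrix (B × E) A ℂ} {U' : Matrix (B' × E') A ℂ}
    (h₁ : ∀ M, M.PosSemidef → hB U M = hB U' M) (h₂ : ∀ M, M.PosSemidef → hE U M = hE U' M)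
    {G : X → Y → Matrix A A ℂ} (hG : IsFamily G) : rateTriple U G = rateTriple U' G := by
  simp only [rateTriple, holevoB, condB, condE, h₁ _ hG.sum_sum_posSemidef,
    h₁ _ (hG.posSemidef _ _), h₁ _ (hG.sum_posSemidef _), h₂ _ (hG.posSemidef _ _),
    h₂ _ (hG.sum_posSemidef _)]

theorem rateSet_congr {B' E' : Type*} [Fintype B'] [DecidableEq B'] [Fintype E']
    [DecidableEq E'] {U : Matrix (B × E) A ℂ} {U' : Matrix (B' × E') A ℂ}
    (h₁ : ∀ M, M.PosSemidef → hB U M = hB U' M) (h₂ : ∀ M, M.PosSemidef → hE U M = hE U' M) :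
    rateSet U = rateSet U' := by
  ext v
  constructor <;> rintro ⟨m, n, G, hG, rfl⟩
  · exact ⟨m, n, G, hG, rateTriple_congr h₁ h₂ hG⟩
  · exact ⟨m, n, G, hG, (rateTriple_congr h₁ h₂ hG).symm⟩

theorem rateSet_eq_of_outE_eq {B' : Type*} [Fintype B'] [DecidableEq B'] {U : Matrix (B × E) A ℂ}
    {U' : Matrix (B' × E) A ℂ} (h : ∀ M, outE U M = outE U' M) : rateSet U = rateSet U' :=
  rateSet_congr (fun _ hM => hB_eq_of_outE_eq h hM) fun M _ => by rw [hE, hE, h]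

theorem rateSet_eq_of_outB_eq {E' : Type*} [Fintype E'] [DecidableEq E'] {U : Matrix (B × E) A ℂ}
    {U' : Matrix (B × E') A ℂ} (h : ∀ M, outB U M = outB U' M) : rateSet U = rateSet U' :=
  rateSet_congr (fun M _ => by rw [hB, hB, h]) fun _ hM => hE_eq_of_outB_eq h hM

/-- A family of vectors as an ensemble of pure states. -/
def pureFamily (v : X → Y → A → ℂ) (x : X) (y : Y) : Matrix A A ℂ :=
  vecMulVec (v x y) (star (v x y))

/-- For pure members the entropies at B and E coincide, so their contributions to `condB` and
`condE` cancel. -/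
theorem rateTriple_pureFamily (U : Matrix (B × E) A ℂ) (v : X → Y → A → ℂ) :
    rateTriple U (pureFamily v) =
      (hB U (∑ x, ∑ y, pureFamily v x y) - ∑ x, ∑ y, hE U (pureFamily v x y),
        ∑ x, hB U (∑ y, pureFamily v x y) - ∑ x, hE U (∑ y, pureFamily v x y),
        hB U (∑ x, ∑ y, pureFamily v x y) - ∑ x, hE U (∑ y, pureFamily v x y)) := by
  have h : ∀ x y, hB U (pureFamily v x y) = hE U (pureFamily v x y) := fun x y => hB_vecMulVec U _
  simp only [rateTriple, holevoB, condB, condE, h, Prod.mk.injEq, true_and]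
  constructor <;> ring

/-- For a degradable channel, ensembles of pure states suffice. -/
theorem exists_pureFamily {U : Matrix (B × E) A ℂ} (hU : IsDegradableIso U)
    {G : X → Y → Matrix A A ℂ} (hG : IsFamily G) :
    ∃ v : X → Y × A → A → ℂ, IsFamily (pureFamily v) ∧
      rateTriple U G ≤ rateTriple U (pureFamily v) := by
  choose T hT using fun x y => exists_eq_mul_conjTranspose (hG.posSemidef x y)
  -- The columns of `T` split each state into pure ones; the column index joins `Y`.
  set v : X → Y × A → A → ℂ := fun x q a => T x q.1 a q.2 with hv
  have hsum : ∀ x y, ∑ a, pureFamily v x (y, a) = G x y := by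
    intro x y
    rw [hT]
    ext i j
    simp [Matrix.sum_apply, pureFamily, vecMulVec_apply, Matrix.mul_apply, hv]
  have hp : ∀ x q, (pureFamily v x q).PosSemidef := fun x q => vecMulVec_star_posSemidef _
  refine ⟨v, ⟨hp, ?_⟩, ?_⟩
  · rw [← hG.trace_sum]
    simp only [Fintype.sum_prod_type, ← hsum, trace_sum]
  · have h1 : ∀ x, ∑ q, pureFamily v x q = ∑ y, G x y := by
      intro x
      simp only [Fintype.sum_prod_type, hsum]
    have h2 : ∀ x y, ∑ a, hB U (pureFamily v x (y, a)) ≤ hB U (G x y) := by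
      intro x y
      rw [← hsum]
      exact sum_hB_le U fun a => hp x _
    -- For a pure-state ensemble the subtracted terms at B and E agree, so the Holevo inequality
    -- becomes one between the output entropies. It measures the loss incurred by mixed states in
    -- the last two bounds.
    have h3 : ∀ x y, hE U (G x y) ≤ hB U (G x y) := by
      intro x y
      have := hU.holevo_le (M := fun a => pureFamily v x (y, a)) fun a => hp x _
      have h : ∀ a, hB U (pureFamily v x (y, a)) = hE U (pureFamily v x (y, a)) :=
        fun a => hB_vecMulVec U _
      simp only [hsum, h] at this
      linarith
    have h4 : ∑ x, ∑ q, hE U (pureFamily v x q) ≤ ∑ x, ∑ y, hB U (G x y) := by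
      simp only [Fintype.sum_prod_type]
      refine Finset.sum_le_sum fun x _ => Finset.sum_le_sum fun y _ => le_trans (le_of_eq ?_) (h2 x y)
      exact Finset.sum_congr rfl fun a _ => (hB_vecMulVec U _).symm
    have h5 : ∑ x, ∑ y, hE U (G x y) ≤ ∑ x, ∑ y, hB U (G x y) :=
      Finset.sum_le_sum fun x _ => Finset.sum_le_sum fun y _ => h3 x y
    rw [rateTriple_pureFamily]
    simp only [h1, rateTriple, holevoB, condB, condE, Prod.mk_le_mk]
    refine ⟨by linarith, by linarith, by linarith⟩

/-- Time sharing. -/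
theorem convex_rateRegion (U : Matrix (B × E) A ℂ) : Convex ℝ (rateRegion U) := by
  rintro r ⟨_, ⟨m₁, n₁, G, hG, rfl⟩, hr⟩ s ⟨_, ⟨m₂, n₂, H, hH, rfl⟩, hs⟩ a b ha hb hab
  -- The disjoint union of the alphabets records in X which ensemble is used. The conditional
  -- quantities average exactly, while the Holevo quantity gains by concavity.
  set F : Fin m₁ ⊕ Fin m₂ → Fin n₁ ⊕ Fin n₂ → Matrix A A ℂ :=
    Sum.elim (fun x => Sum.elim (fun y => (a : ℂ) • G x y) fun _ => 0)
      (fun x => Sum.elim (fun _ => 0) fun y => (b : ℂ) • H x y) with hF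
  have hsm : ∀ {c : ℝ} {M : Matrix A A ℂ}, 0 ≤ c → M.PosSemidef → ((c : ℂ) • M).PosSemidef :=
    fun hc hM => hM.smul (by exact_mod_cast hc)
  have hFam : IsFamily F := by
    constructor
    · rintro (x | x) (y | y)
      · exact hsm ha (hG.posSemidef x y)
      · exact PosSemidef.zero
      · exact PosSemidef.zero
      · exact hsm hb (hH.posSemidef x y)
    · simp only [hF, Fintype.sum_sum_type, Sum.elim_inl, Sum.elim_inr, trace_zero, trace_smul,
        Finset.sum_const_zero, add_zero, zero_add, ← Finset.smul_sum, hG.trace_sum, hH.trace_sum]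
      simp only [smul_eq_mul, mul_one]
      exact_mod_cast hab
  refine ⟨_, rateTriple_mem_rateSet U hFam, ?_⟩
  have hz : hB U 0 = 0 ∧ hE U 0 = 0 := by
    constructor <;> simp [hB, hE, outB_zero, outE_zero, homEntropy_zero]
  have hconc : a * hB U (∑ x, ∑ y, G x y) + b * hB U (∑ x, ∑ y, H x y) ≤
      hB U ((a : ℂ) • (∑ x, ∑ y, G x y) + (b : ℂ) • ∑ x, ∑ y, H x y) := by
    have := sum_hB_le U (M := ![(a : ℂ) • (∑ x, ∑ y, G x y), (b : ℂ) • ∑ x, ∑ y, H x y]) (by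
      intro i
      fin_cases i
      · exact hsm ha hG.sum_sum_posSemidef
      · exact hsm hb hH.sum_sum_posSemidef)
    simpa only [Fin.sum_univ_two, cons_val_zero, cons_val_one, hB_smul U _ hG.sum_sum_posSemidef,
      hB_smul U _ hH.sum_sum_posSemidef] using this
  have e : rateTriple U F = (hB U ((a : ℂ) • (∑ x, ∑ y, G x y) + (b : ℂ) • ∑ x, ∑ y, H x y) -
        (a * ∑ x, ∑ y, hB U (G x y) + b * ∑ x, ∑ y, hB U (H x y)),
      (a * condB U G + b * condB U H) - (a * condE U G + b * condE U H),
      hB U ((a : ℂ) • (∑ x, ∑ y, G x y) + (b : ℂ) • ∑ x, ∑ y, H x y) -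
        (a * ∑ x, ∑ y, hB U (G x y) + b * ∑ x, ∑ y, hB U (H x y)) -
          (a * condE U G + b * condE U H)) := by
    simp only [rateTriple, holevoB, condB, condE, hF, Fintype.sum_sum_type, Sum.elim_inl,
      Sum.elim_inr, Finset.sum_const_zero, add_zero, zero_add, ← Finset.smul_sum, hz.1, hz.2,
      hB_smul U _ (hG.posSemidef _ _), hB_smul U _ (hH.posSemidef _ _),
      hE_smul U _ (hG.posSemidef _ _), hE_smul U _ (hH.posSemidef _ _),
      hB_smul U _ (hG.sum_posSemidef _), hB_smul U _ (hH.sum_posSemidef _),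
      hE_smul U _ (hG.sum_posSemidef _), hE_smul U _ (hH.sum_posSemidef _), ← Finset.mul_sum,
      Prod.mk.injEq, true_and]
    constructor <;> ring
  have h1 : a • r + b • s ≤ a • rateTriple U G + b • rateTriple U H :=
    add_le_add (smul_le_smul_of_nonneg_left hr ha) (smul_le_smul_of_nonneg_left hs hb)
  refine h1.trans ?_
  rw [e]
  simp only [rateTriple, holevoB, Prod.smul_mk, Prod.mk_add_mk, Prod.mk_le_mk, smul_eq_mul]
  refine ⟨by linarith, by linarith, by linarith⟩

end Rate

/-! ### Super- and subadditivity of the rates under tensor products -/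

section TensorRate

variable {A₁ B₁ E₁ A₂ B₂ E₂ : Type*} [Fintype A₁] [DecidableEq A₁] [Fintype B₁] [DecidableEq B₁]
  [Fintype E₁] [DecidableEq E₁] [Fintype A₂] [DecidableEq A₂] [Fintype B₂] [DecidableEq B₂]
  [Fintype E₂] [DecidableEq E₂]

theorem hB_tensorIso_kronecker {U₁ : Matrix (B₁ × E₁) A₁ ℂ} {U₂ : Matrix (B₂ × E₂) A₂ ℂ}
    (h₁ : U₁ᴴ * U₁ = 1) (h₂ : U₂ᴴ * U₂ = 1) {M : Matrix A₁ A₁ ℂ} {N : Matrix A₂ A₂ ℂ}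
    (hM : M.PosSemidef) (hN : N.PosSemidef) :
    hB (tensorIso U₁ U₂) (M ⊗ₖ N) = N.trace.re * hB U₁ M + M.trace.re * hB U₂ N := by
  rw [hB, outB_tensorIso_kronecker, homEntropy_kronecker (outB_posSemidef _ hM).1
    (outB_posSemidef _ hN).1, trace_outB h₁, trace_outB h₂]
  rfl

theorem hE_tensorIso_kronecker {U₁ : Matrix (B₁ × E₁) A₁ ℂ} {U₂ : Matrix (B₂ × E₂) A₂ ℂ}
    (h₁ : U₁ᴴ * U₁ = 1) (h₂ : U₂ᴴ * U₂ = 1) {M : Matrix A₁ A₁ ℂ} {N : Matrix A₂ A₂ ℂ}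
    (hM : M.PosSemidef) (hN : N.PosSemidef) :
    hE (tensorIso U₁ U₂) (M ⊗ₖ N) = N.trace.re * hE U₁ M + M.trace.re * hE U₂ N := by
  simp only [hE_eq_hB_swapOut, swapOut_tensorIso,
    hB_tensorIso_kronecker (swapOut_isometry h₁) (swapOut_isometry h₂) hM hN]

theorem sum_kronecker_sum {ι κ : Type*} [Fintype ι] [Fintype κ] (M : ι → Matrix A₁ A₁ ℂ)
    (N : κ → Matrix A₂ A₂ ℂ) : ∑ i, ∑ j, M i ⊗ₖ N j = (∑ i, M i) ⊗ₖ ∑ j, N j := by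
  ext
  simp only [Matrix.sum_apply, kroneckerMap_apply, Finset.sum_mul_sum]

/-- The rates are superadditive: use product ensembles. -/
theorem add_mem_rateSet_tensorIso {U₁ : Matrix (B₁ × E₁) A₁ ℂ} {U₂ : Matrix (B₂ × E₂) A₂ ℂ}
    (h₁ : U₁ᴴ * U₁ = 1) (h₂ : U₂ᴴ * U₂ = 1) {r s : ℝ × ℝ × ℝ} (hr : r ∈ rateSet U₁)
    (hs : s ∈ rateSet U₂) : r + s ∈ rateSet (tensorIso U₁ U₂) := by
  obtain ⟨m₁, n₁, G, hG, rfl⟩ := hr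
  obtain ⟨m₂, n₂, H, hH, rfl⟩ := hs
  set F : Fin m₁ × Fin m₂ → Fin n₁ × Fin n₂ → Matrix (A₁ × A₂) (A₁ × A₂) ℂ :=
    fun x y => G x.1 y.1 ⊗ₖ H x.2 y.2 with hF
  have hx : ∀ x, ∑ y, F x y = (∑ y, G x.1 y) ⊗ₖ ∑ y, H x.2 y := by
    intro x
    rw [← sum_kronecker_sum, Fintype.sum_prod_type]
  have hxy : ∑ x, ∑ y, F x y = (∑ x, ∑ y, G x y) ⊗ₖ ∑ x, ∑ y, H x y := by
    simp only [hx]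
    rw [← sum_kronecker_sum, Fintype.sum_prod_type]
  have hFam : IsFamily F := by
    refine ⟨fun x y => (hG.posSemidef _ _).kronecker (hH.posSemidef _ _), ?_⟩
    simp only [← trace_sum, hxy]
    rw [trace_kronecker]
    simp only [trace_sum, hG.trace_sum, hH.trace_sum, mul_one]
  have hGt : ∑ x, (∑ y, (G x y).trace.re) = 1 := by
    simp only [← Complex.re_sum, hG.trace_sum, Complex.one_re]
  have hHt : ∑ x, (∑ y, (H x y).trace.re) = 1 := by
    simp only [← Complex.re_sum, hH.trace_sum, Complex.one_re]
  -- The entropy of a product of unnormalized states weights each entropy by the trace of the other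
  -- factor; these weights sum to one.
  have hprod : ∀ {ι κ : Type} [Fintype ι] [Fintype κ] (f f' : ι → ℝ) (g g' : κ → ℝ),
      ∑ p : ι × κ, (g p.2 * f' p.1 + f p.1 * g' p.2) =
        (∑ j, g j) * ∑ i, f' i + (∑ i, f i) * ∑ j, g' j := by
    intro ι κ _ _ f f' g g'
    rw [Finset.sum_add_distrib, Finset.sum_mul_sum, Finset.sum_mul_sum, Fintype.sum_prod_type,
      Fintype.sum_prod_type, Finset.sum_comm]
  have hBxy : ∑ x, ∑ y, hB (tensorIso U₁ U₂) (F x y) =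
      ∑ x, ∑ y, hB U₁ (G x y) + ∑ x, ∑ y, hB U₂ (H x y) := by
    simp only [hF, hB_tensorIso_kronecker h₁ h₂ (hG.posSemidef _ _) (hH.posSemidef _ _)]
    simp only [fun x : Fin m₁ × Fin m₂ => hprod (fun y => (G x.1 y).trace.re)
      (fun y => hB U₁ (G x.1 y)) (fun y => (H x.2 y).trace.re) fun y => hB U₂ (H x.2 y)]
    rw [hprod (fun x => ∑ y, (G x y).trace.re) (fun x => ∑ y, hB U₁ (G x y))
      (fun x => ∑ y, (H x y).trace.re) fun x => ∑ y, hB U₂ (H x y), hGt, hHt, one_mul, one_mul]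
  have hExy : ∑ x, ∑ y, hE (tensorIso U₁ U₂) (F x y) =
      ∑ x, ∑ y, hE U₁ (G x y) + ∑ x, ∑ y, hE U₂ (H x y) := by
    simp only [hF, hE_tensorIso_kronecker h₁ h₂ (hG.posSemidef _ _) (hH.posSemidef _ _)]
    simp only [fun x : Fin m₁ × Fin m₂ => hprod (fun y => (G x.1 y).trace.re)
      (fun y => hE U₁ (G x.1 y)) (fun y => (H x.2 y).trace.re) fun y => hE U₂ (H x.2 y)]
    rw [hprod (fun x => ∑ y, (G x y).trace.re) (fun x => ∑ y, hE U₁ (G x y))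
      (fun x => ∑ y, (H x y).trace.re) fun x => ∑ y, hE U₂ (H x y), hGt, hHt, one_mul, one_mul]
  have hBx : ∑ x, hB (tensorIso U₁ U₂) (∑ y, F x y) =
      ∑ x, hB U₁ (∑ y, G x y) + ∑ x, hB U₂ (∑ y, H x y) := by
    simp only [hx, hB_tensorIso_kronecker h₁ h₂ (hG.sum_posSemidef _) (hH.sum_posSemidef _)]
    rw [hprod (fun x => (∑ y, G x y).trace.re) (fun x => hB U₁ (∑ y, G x y))
      (fun x => (∑ y, H x y).trace.re) fun x => hB U₂ (∑ y, H x y)]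
    simp only [trace_sum, Complex.re_sum, hGt, hHt, one_mul]
  have hEx : ∑ x, hE (tensorIso U₁ U₂) (∑ y, F x y) =
      ∑ x, hE U₁ (∑ y, G x y) + ∑ x, hE U₂ (∑ y, H x y) := by
    simp only [hx, hE_tensorIso_kronecker h₁ h₂ (hG.sum_posSemidef _) (hH.sum_posSemidef _)]
    rw [hprod (fun x => (∑ y, G x y).trace.re) (fun x => hE U₁ (∑ y, G x y))
      (fun x => (∑ y, H x y).trace.re) fun x => hE U₂ (∑ y, H x y)]
    simp only [trace_sum, Complex.re_sum, hGt, hHt, one_mul]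
  have hBt : hB (tensorIso U₁ U₂) (∑ x, ∑ y, F x y) =
      hB U₁ (∑ x, ∑ y, G x y) + hB U₂ (∑ x, ∑ y, H x y) := by
    rw [hxy, hB_tensorIso_kronecker h₁ h₂ hG.sum_sum_posSemidef hH.sum_sum_posSemidef]
    simp only [trace_sum, Complex.re_sum, hGt, hHt, one_mul]
  have := rateTriple_mem_rateSet (tensorIso U₁ U₂) hFam
  convert this using 1
  simp only [rateTriple, holevoB, condB, condE, hBxy, hExy, hBx, hEx, hBt, Prod.mk_add_mk,
    Prod.mk.injEq]
  refine ⟨by ring, by ring, by ring⟩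

variable {Z : Type*} [Fintype Z] [DecidableEq Z] {ψ : Z → A₁ → ℂ} {φ : Z → E₁ → ℂ}

/-- Two ensembles are extracted from the given one, so that every entropy of the product is bounded
in the required direction by those of the factors. The outcome z is treated as part of X for the
second channel, which makes the same conditional entropies appear at B₂ and at E₂. -/
theorem exists_le_add_of_hadamardIso (hiso : (hadamardIso ψ φ)ᴴ * hadamardIso ψ φ = 1)
    (hφ : ∀ z, star (φ z) ⬝ᵥ φ z = 1) {U₂ : Matrix (B₂ × E₂) A₂ ℂ} (h₂ : U₂ᴴ * U₂ = 1)
    {X Y : Type*} [Fintype X] [Fintype Y] {v : X → Y → A₁ × A₂ → ℂ}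
    (hv : IsFamily (pureFamily v)) :
    ∃ r ∈ rateSet (hadamardIso ψ φ), ∃ s ∈ rateSet U₂,
      rateTriple (tensorIso (hadamardIso ψ φ) U₂) (pureFamily v) ≤ r + s := by
  set H := hadamardIso ψ φ
  -- The marginal on `A₁` is mixed; the basis of `A₂` decomposes it into pure states.
  set v₁ : X → Y × A₂ → A₁ → ℂ := fun x q a => v x q.1 (a, q.2) with hv₁
  -- Given z, the second input is still pure.
  set v₂ : X × Z → Y → A₂ → ℂ := fun q y => sliceOp A₂ (ψ q.2) *ᵥ v q.1 y with hv₂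
  have hs₁ : ∀ x y, ∑ a, pureFamily v₁ x (y, a) = traceSnd (pureFamily v x y) := by
    intro x y
    ext
    simp [pureFamily, traceSnd, Matrix.sum_apply, vecMulVec_apply, hv₁]
  have hs₂ : ∀ x z y, pureFamily v₂ (x, z) y = slice (ψ z) (pureFamily v x y) := fun x z y =>
    (slice_vecMulVec _ _).symm
  have hx₁ : ∀ x, ∑ q, pureFamily v₁ x q = traceSnd (∑ y, pureFamily v x y) := by
    intro x
    simp only [Fintype.sum_prod_type, hs₁, traceSnd_sum]
  have hx₂ : ∀ x z, ∑ y, pureFamily v₂ (x, z) y = slice (ψ z) (∑ y, pureFamily v x y) := by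
    intro x z
    simp only [hs₂, slice_sum]
  have ht₁ : ∑ x, ∑ q, pureFamily v₁ x q = traceSnd (∑ x, ∑ y, pureFamily v x y) := by
    simp only [hx₁, traceSnd_sum]
  have ht₂ : ∑ x, ∑ y, pureFamily v₂ x y = traceFst (∑ x, ∑ y, pureFamily v x y) := by
    rw [← sum_slice hiso hφ, Fintype.sum_prod_type, Finset.sum_comm]
    simp only [hx₂, slice_sum]
  have hp : ∀ x y, (pureFamily v x y).PosSemidef := hv.posSemidef
  have hF₁ : IsFamily (pureFamily v₁) := by
    refine ⟨fun x q => vecMulVec_star_posSemidef _, ?_⟩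
    simp only [← trace_sum, ht₁, trace_traceSnd]
    simp only [trace_sum, hv.trace_sum]
  have hF₂ : IsFamily (pureFamily v₂) := by
    refine ⟨fun x q => vecMulVec_star_posSemidef _, ?_⟩
    simp only [← trace_sum, ht₂]
    have : ∀ M : Matrix (A₁ × A₂) (A₁ × A₂) ℂ, (traceFst M).trace = M.trace := by
      intro M
      simp only [traceFst, trace, diag_apply, of_apply]
      rw [Fintype.sum_prod_type_right]
    rw [this]
    simp only [trace_sum, hv.trace_sum]
  refine ⟨_, rateTriple_mem_rateSet H hF₁, _, rateTriple_mem_rateSet U₂ hF₂, ?_⟩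
  have hX := hv.sum_posSemidef
  have hT := hv.sum_sum_posSemidef
  have i1 := hB_tensorIso_le_add hiso hφ h₂ hT
  have i2 : ∑ x, hB (tensorIso H U₂) (∑ y, pureFamily v x y) ≤
      ∑ x, hB H (∑ q, pureFamily v₁ x q) + ∑ x, hB U₂ (∑ y, pureFamily v₂ x y) := by
    rw [Fintype.sum_prod_type (f := fun x => hB U₂ (∑ y, pureFamily v₂ x y)),
      ← Finset.sum_add_distrib]
    refine Finset.sum_le_sum fun x _ => ?_
    simp only [hx₁, hx₂]
    exact hB_tensorIso_le hφ h₂ (hX x)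
  have i3 : ∑ x, hE H (∑ q, pureFamily v₁ x q) + ∑ x, hE U₂ (∑ y, pureFamily v₂ x y) ≤
      ∑ x, hE (tensorIso H U₂) (∑ y, pureFamily v x y) := by
    rw [Fintype.sum_prod_type (f := fun x => hE U₂ (∑ y, pureFamily v₂ x y)),
      ← Finset.sum_add_distrib]
    refine Finset.sum_le_sum fun x _ => ?_
    simp only [hx₁, hx₂]
    exact hE_tensorIso_ge hφ h₂ (hX x)
  have i4 : ∑ x, ∑ q, hE H (pureFamily v₁ x q) + ∑ x, ∑ y, hE U₂ (pureFamily v₂ x y) ≤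
      ∑ x, ∑ y, hE (tensorIso H U₂) (pureFamily v x y) := by
    rw [Fintype.sum_prod_type (f := fun x => ∑ y, hE U₂ (pureFamily v₂ x y)),
      ← Finset.sum_add_distrib]
    refine Finset.sum_le_sum fun x _ => ?_
    rw [Finset.sum_comm, Fintype.sum_prod_type, ← Finset.sum_add_distrib]
    refine Finset.sum_le_sum fun y _ => ?_
    refine le_trans (add_le_add ?_ (le_of_eq ?_)) (hE_tensorIso_ge (ψ := ψ) hφ h₂ (hp x y))
    -- Concavity passes from the mixed marginal on `A₁` to its pure components.
    · rw [← hs₁]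
      exact sum_hE_le H fun a => vecMulVec_star_posSemidef _
    · simp only [hs₂]
  rw [rateTriple_pureFamily, rateTriple_pureFamily, rateTriple_pureFamily, ht₁, ht₂]
  simp only [Prod.mk_add_mk, Prod.mk_le_mk]
  refine ⟨by linarith, by linarith, by linarith⟩

/-- The rates of a Hadamard channel together with a degradable channel are subadditive. -/
theorem exists_le_add_of_mem_rateSet_tensorIso {U₁ : Matrix (B₁ × E₁) A₁ ℂ}
    {U₂ : Matrix (B₂ × E₂) A₂ ℂ} (hU₁ : IsHadamardIso U₁) (hU₂ : IsDegradableIso U₂)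
    (h₂ : U₂ᴴ * U₂ = 1) {t : ℝ × ℝ × ℝ} (ht : t ∈ rateSet (tensorIso U₁ U₂)) :
    ∃ r ∈ rateSet U₁, ∃ s ∈ rateSet U₂, t ≤ r + s := by
  have hdeg := hU₁.isDegradableIso.tensorIso hU₂
  obtain ⟨m, n, G, hG, rfl⟩ := ht
  obtain ⟨v, hv, hle⟩ := exists_pureFamily hdeg hG
  obtain ⟨Z, _, _, ψ, φ, hiso, hφ, hU⟩ := hU₁
  obtain ⟨r, hr, s, hs, hrs⟩ := exists_le_add_of_hadamardIso hiso hφ h₂ hv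
  -- The replacement of the first factor by its Hadamard form preserves the environment of the
  -- product, and with it all rates.
  have hc : ∀ M, outE (tensorIso U₁ U₂) M = outE (tensorIso (hadamardIso ψ φ) U₂) M :=
    fun M => (outE_tensorIso_congr hU (fun _ => rfl) M).symm
  refine ⟨r, by rwa [← rateSet_eq_of_outE_eq hU], s, hs, hle.trans (le_trans (le_of_eq ?_) hrs)⟩
  exact rateTriple_congr (fun _ hM => hB_eq_of_outE_eq hc hM) (fun M _ => by rw [hE, hE, hc]) hv

end TensorRate

/-! ## Compactness of the set of rates -/

section Compactness

/-- The convex hull of a compact set in finite dimension is compact. -/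
theorem isCompact_convexHull_of_finiteDimensional {V : Type*} [AddCommGroup V] [Module ℝ V]
    [TopologicalSpace V] [ContinuousAdd V] [ContinuousSMul ℝ V] [FiniteDimensional ℝ V]
    {s : Set V} (hs : IsCompact s) : IsCompact (convexHull ℝ s) := by
  rcases s.eq_empty_or_nonempty with rfl | ⟨x₀, hx₀⟩
  · simp
  -- Carathéodory: `finrank + 1` points always suffice. Shorter combinations are padded with zero
  -- weights at `x₀`.
  set d := Module.finrank ℝ V + 1
  set f : (Fin d → ℝ) × (Fin d → V) → V := fun q => ∑ i, q.1 i • q.2 i with hf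
  have hfc : Continuous f := by fun_prop
  have himg : convexHull ℝ s = f '' (stdSimplex ℝ (Fin d) ×ˢ Set.univ.pi fun _ => s) := by
    ext x
    constructor
    · intro hx
      obtain ⟨ι, _, z, w, hz, hind, hw, hw1, rfl⟩ := eq_pos_convex_span_of_mem_convexHull hx
      have hcard : Fintype.card ι ≤ d := hind.card_le_finrank_succ.trans
        (Nat.succ_le_succ (Submodule.finrank_le _))
      classical
      obtain ⟨e⟩ := Function.Embedding.nonempty_of_card_le (β := Fin d) (by simpa using hcard)
      set w' : Fin d → ℝ := fun j => if h : ∃ i, e i = j then w h.choose else 0 with hw'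
      set z' : Fin d → V := fun j => if h : ∃ i, e i = j then z h.choose else x₀ with hz'
      have hc : ∀ i (h : ∃ k, e k = e i), h.choose = i := fun i h => e.injective h.choose_spec
      have hwe : ∀ i, w' (e i) = w i := by
        intro i
        have h : ∃ k, e k = e i := ⟨i, rfl⟩
        simp only [hw', dif_pos h, hc i h]
      have hze : ∀ i, z' (e i) = z i := by
        intro i
        have h : ∃ k, e k = e i := ⟨i, rfl⟩
        simp only [hz', dif_pos h, hc i h]
      have hw0 : ∀ j, j ∉ Set.range e → w' j = 0 := by
        intro j hj
        exact dif_neg hj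
      have hsum : ∀ {W : Type _} [AddCommMonoid W] (g : Fin d → W),
          (∀ j, j ∉ Set.range e → g j = 0) → ∑ j, g j = ∑ i, g (e i) := by
        intro W _ g hg
        rw [← Finset.sum_map Finset.univ e g]
        symm
        refine Finset.sum_subset (Finset.subset_univ _) fun j _ hj => hg j ?_
        simpa using hj
      refine ⟨(w', z'), ⟨⟨fun j => ?_, ?_⟩, fun j _ => ?_⟩, ?_⟩
      · by_cases h : ∃ i, e i = j
        · obtain ⟨i, rfl⟩ := h
          exact (hw i).le.trans_eq (hwe i).symm
        · exact (hw0 j h).ge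
      · rw [← Finset.sum_subset (Finset.subset_univ (Finset.univ.map e)) fun j _ hj =>
          hw0 j (by simpa using hj), Finset.sum_map]
        simpa only [hwe] using hw1
      · by_cases h : ∃ i, e i = j
        · obtain ⟨i, rfl⟩ := h
          simp only [hze]; exact hz ⟨i, rfl⟩
        · simp only [hz', dif_neg h]; exact hx₀
      · simp only [hf]
        rw [hsum _ fun j hj => by rw [hw0 j hj, zero_smul]]
        simp only [hwe, hze]
    · rintro ⟨⟨w, z⟩, ⟨hw, hz⟩, rfl⟩
      exact mem_convexHull_of_exists_fintype w z hw.1 hw.2 (fun i => hz i (Set.mem_univ _)) rfl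
  rw [himg]
  exact ((isCompact_stdSimplex ℝ (Fin d)).prod (isCompact_univ_pi fun _ => hs)).image hfc

variable {A B E : Type*} [Fintype A] [DecidableEq A] [Fintype B] [DecidableEq B]
  [Fintype E] [DecidableEq E]

/-- The condition `(T * Tᴴ).trace = 1` bounds the entries of `T` by one, so the density operators
are a continuous image of a compact set. -/
theorem isCompact_setOf_isDensity : IsCompact {ρ : Matrix A A ℂ | IsDensity ρ} := by
  have himg : {ρ : Matrix A A ℂ | IsDensity ρ} =
      (fun T : Matrix A A ℂ => T * Tᴴ) '' {T | (T * Tᴴ).trace = 1} := by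
    ext ρ
    constructor
    · rintro ⟨h1, h2⟩
      obtain ⟨T, rfl⟩ := exists_eq_mul_conjTranspose h1
      exact ⟨T, h2, rfl⟩
    · rintro ⟨T, hT, rfl⟩
      exact ⟨posSemidef_self_mul_conjTranspose T, hT⟩
  rw [himg]
  refine IsCompact.image ?_ (by fun_prop)
  refine IsCompact.of_isClosed_subset (s := Set.univ.pi fun _ => Set.univ.pi fun _ =>
    Metric.closedBall (0 : ℂ) 1) ?_ ?_ ?_
  · exact isCompact_univ_pi fun _ => isCompact_univ_pi fun _ => isCompact_closedBall _ _
  · exact isClosed_eq (by fun_prop) continuous_const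
  · intro T' hT i _ j _
    set T : Matrix A A ℂ := T' with hTdef
    have h1 : ((∑ i, ∑ j, Complex.normSq (T i j) : ℝ) : ℂ) = 1 := by
      rw [← show (T * Tᴴ).trace = 1 from hT]
      simp only [trace, diag_apply, Matrix.mul_apply, conjTranspose_apply, Complex.ofReal_sum,
        ← Complex.mul_conj]
      rfl
    have h2 : ∑ i, ∑ j, Complex.normSq (T i j) = 1 := by exact_mod_cast h1
    have h3 : Complex.normSq (T i j) ≤ 1 := by
      rw [← h2]
      refine le_trans ?_ (Finset.single_le_sum (fun i _ => Finset.sum_nonneg fun j _ =>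
        Complex.normSq_nonneg (T i j)) (Finset.mem_univ i))
      exact Finset.single_le_sum (fun j _ => Complex.normSq_nonneg (T i j)) (Finset.mem_univ j)
    rw [mem_closedBall_zero_iff]
    rw [Complex.normSq_eq_norm_sq] at h3
    exact (sq_le_one_iff₀ (norm_nonneg _)).1 h3

theorem trace_pow_conj_diagonal {V : Matrix A A ℂ} (hV : Vᴴ * V = 1) (hV' : V * Vᴴ = 1) (d : A → ℝ)
    (k : ℕ) :
    ((V * diagonal (fun i => (d i : ℂ)) * Vᴴ) ^ k).trace.re = ∑ i, d i ^ k := by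
  have : (V * diagonal (fun i => (d i : ℂ)) * Vᴴ) ^ k =
      V * diagonal (fun i => ((d i ^ k : ℝ) : ℂ)) * Vᴴ := by
    induction k with
    | zero => simp [hV']
    | succ k ih =>
      rw [pow_succ, ih]
      calc _ = V * diagonal (fun i => ((d i ^ k : ℝ) : ℂ)) * (Vᴴ * V) *
            diagonal (fun i => (d i : ℂ)) * Vᴴ := by simp only [Matrix.mul_assoc]
        _ = _ := by
          rw [hV, Matrix.mul_one, Matrix.mul_assoc V, diagonal_mul_diagonal]
          simp only [← Complex.ofReal_mul, pow_succ]
  rw [this, trace_conj_diagonal hV, Complex.ofReal_re]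

/-- The von Neumann entropy is continuous on the density operators. -/
theorem continuousOn_entropy : ContinuousOn (entropy (A := A)) {ρ | IsDensity ρ} := by
  refine continuousOn_of_uniform_approx_of_continuousOn fun u hu => ?_
  obtain ⟨ε, hε, hεu⟩ := Metric.mem_uniformity_dist.1 hu
  have hc : (0 : ℝ) < Fintype.card A + 1 := by positivity
  -- By Weierstrass, `nml` is replaced on [0,1] by a polynomial, whose spectral sum is a combination
  -- of the continuous functions Tr ρ^k. The error is at most `card A` times the scalar one, and the
  -- `+ 1` keeps it strictly below `ε`.
  obtain ⟨p, hp⟩ := exists_polynomial_near_of_continuousOn 0 1 nml continuous_nml.continuousOn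
    (ε / (Fintype.card A + 1)) (div_pos hε hc)
  refine ⟨fun M => ∑ k ∈ Finset.range (p.natDegree + 1), p.coeff k * (M ^ k).trace.re, ?_, ?_⟩
  · have : Continuous fun M : Matrix A A ℂ =>
        ∑ k ∈ Finset.range (p.natDegree + 1), p.coeff k * (M ^ k).trace.re := by
      refine continuous_finsetSum _ fun k _ => continuous_const.mul (Complex.continuous_re.comp ?_)
      exact (continuous_pow k).matrix_trace
    exact this.continuousOn
  · rintro ρ ⟨h1, h2⟩
    obtain ⟨V, d, hV, hV', hM, hd⟩ := exists_diagonalization h1.1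
    have hd0 := hd h1
    have hd1 : ∑ i, d i = 1 := by
      have := trace_conj_diagonal hV d
      rw [← hM, h2] at this
      exact_mod_cast this.symm
    have hle : ∀ i, d i ≤ 1 := fun i => by
      rw [← hd1]; exact Finset.single_le_sum (fun i _ => hd0 i) (Finset.mem_univ i)
    have e1 : ∑ k ∈ Finset.range (p.natDegree + 1), p.coeff k * (ρ ^ k).trace.re =
        ∑ i, p.eval (d i) := by
      simp only [Polynomial.eval_eq_sum_range, hM, trace_pow_conj_diagonal hV hV', Finset.mul_sum]
      exact Finset.sum_comm
    refine hεu ?_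
    change dist (entropy ρ) (∑ k ∈ Finset.range (p.natDegree + 1), p.coeff k * (ρ ^ k).trace.re) < ε
    rw [e1, hM, entropy_conj_diagonal hV, Real.dist_eq, ← Finset.sum_sub_distrib]
    calc |∑ i, (nml (d i) - p.eval (d i))| ≤ ∑ i, |nml (d i) - p.eval (d i)| :=
          Finset.abs_sum_le_sum_abs _ _
      _ ≤ ∑ _i : A, ε / (Fintype.card A + 1) := by
          refine Finset.sum_le_sum fun i _ => ?_
          rw [abs_sub_comm]
          exact (hp (d i) ⟨hd0 i, hle i⟩).le
      _ = Fintype.card A * ε / (Fintype.card A + 1) := by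
          rw [Finset.sum_const, Finset.card_univ, nsmul_eq_mul, mul_div_assoc]
      _ < ε := by
          rw [div_lt_iff₀ hc]
          nlinarith

theorem IsDensity.outB {U : Matrix (B × E) A ℂ} (hU : Uᴴ * U = 1) {ρ : Matrix A A ℂ}
    (hρ : IsDensity ρ) : IsDensity (outB U ρ) :=
  ⟨outB_posSemidef U hρ.1, by rw [trace_outB hU, hρ.2]⟩

theorem continuousOn_hB {U : Matrix (B × E) A ℂ} (hU : Uᴴ * U = 1) :
    ContinuousOn (hB U) {ρ | IsDensity ρ} := by
  have h1 : ContinuousOn (fun ρ => entropy (outB U ρ)) {ρ | IsDensity ρ} := by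
    refine continuousOn_entropy.comp ?_ fun ρ hρ => IsDensity.outB hU hρ
    have : Continuous (outB U) := by
      refine continuous_matrix fun b b' => ?_
      simp only [outB_apply]
      fun_prop
    exact this.continuousOn
  refine h1.congr fun ρ hρ => ?_
  rw [hB, homEntropy, (IsDensity.outB hU hρ).2]
  simp

theorem continuousOn_hE {U : Matrix (B × E) A ℂ} (hU : Uᴴ * U = 1) :
    ContinuousOn (hE U) {ρ | IsDensity ρ} :=
  (continuousOn_hB (swapOut_isometry hU)).congr fun ρ _ => hE_eq_hB_swapOut U ρ

theorem convex_setOf_isDensity : Convex ℝ {ρ : Matrix A A ℂ | IsDensity ρ} := by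
  rintro ρ ⟨hρ, hρ1⟩ σ ⟨hσ, hσ1⟩ a b ha hb hab
  have e : ∀ (c : ℝ) (M : Matrix A A ℂ), c • M = (c : ℂ) • M := fun c M => by ext; simp
  refine ⟨?_, ?_⟩
  · rw [e, e]
    exact (hρ.smul (by exact_mod_cast ha)).add (hσ.smul (by exact_mod_cast hb))
  · rw [trace_add, trace_smul, trace_smul, hρ1, hσ1, ← add_smul, hab, one_smul]

theorem exists_isDensity [Nonempty A] : ∃ ρ : Matrix A A ℂ, IsDensity ρ := by
  obtain ⟨a⟩ := ‹Nonempty A›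
  refine ⟨vecMulVec (Pi.single a 1) (star (Pi.single a 1)), vecMulVec_star_posSemidef _, ?_⟩
  exact trace_vecMulVec_of_normalized (by simp)

theorem exists_isDensity_smul [Nonempty A] {M : Matrix A A ℂ} (hM : M.PosSemidef) :
    ∃ ρ, IsDensity ρ ∧ M = (M.trace.re : ℂ) • ρ := by
  have ht : M.trace = (M.trace.re : ℂ) := Complex.ext (by simp)
    (by simpa using ((Complex.le_def.1 hM.trace_nonneg).2).symm)
  have h0 : 0 ≤ M.trace.re := (Complex.le_def.1 hM.trace_nonneg).1
  rcases h0.eq_or_lt with h | h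
  -- Trace zero forces `M = 0`, and any density operator serves.
  · obtain ⟨ρ, hρ⟩ := exists_isDensity (A := A)
    refine ⟨ρ, hρ, ?_⟩
    rw [← h, Complex.ofReal_zero, zero_smul, ← hM.trace_eq_zero_iff, ht, ← h, Complex.ofReal_zero]
  · have hne : (M.trace.re : ℂ) ≠ 0 := by exact_mod_cast h.ne'
    refine ⟨((M.trace.re)⁻¹ : ℝ) • M, ⟨?_, ?_⟩, ?_⟩
    · have : ((M.trace.re)⁻¹ : ℝ) • M = (((M.trace.re)⁻¹ : ℝ) : ℂ) • M := by ext; simp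
      rw [this]
      exact hM.smul (by exact_mod_cast (inv_pos.2 h).le)
    · rw [trace_smul, Complex.real_smul, Complex.ofReal_inv]
      conv_lhs => rw [ht]
      rw [Complex.ofReal_re, inv_mul_cancel₀ hne]
    · ext i j
      simp only [Matrix.smul_apply, Complex.real_smul, Complex.ofReal_inv, smul_eq_mul]
      rw [mul_inv_cancel_left₀ hne]

/-- Conditioning on x: the average over y carries the weight p(x). When that weight is zero, every
point of the set will do. -/
theorem exists_sum_smul_eq {V : Type*} [AddCommGroup V] [Module ℝ V] {s : Set V}
    (hs : Convex ℝ s) (hne : s.Nonempty) {ι : Type*} [Fintype ι] {w : ι → ℝ} (hw : ∀ i, 0 ≤ w i)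
    {z : ι → V} (hz : ∀ i, z i ∈ s) : ∃ k ∈ s, ∑ i, w i • z i = (∑ i, w i) • k := by
  have h0 : 0 ≤ ∑ i, w i := Finset.sum_nonneg fun i _ => hw i
  rcases h0.eq_or_lt with h | h
  · obtain ⟨k, hk⟩ := hne
    refine ⟨k, hk, ?_⟩
    rw [← h, zero_smul]
    refine Finset.sum_eq_zero fun i _ => ?_
    rw [(Finset.sum_eq_zero_iff_of_nonneg fun i _ => hw i).1 h.symm i (Finset.mem_univ i), zero_smul]
  · refine ⟨_, hs.centerMass_mem (t := Finset.univ) (fun i _ => hw i) h fun i _ => hz i, ?_⟩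
    rw [Finset.centerMass, smul_inv_smul₀ h.ne']

/-- States together with average entropies of ensembles for them. -/
def entropyHull (U : Matrix (B × E) A ℂ) : Set (Matrix A A ℂ × ℝ × ℝ) :=
  convexHull ℝ ((fun ρ => (ρ, hB U ρ, hE U ρ)) '' {ρ | IsDensity ρ})

/-- States together with average entropies of two-step ensembles for them. -/
def entropyHullTwo (U : Matrix (B × E) A ℂ) : Set (Matrix A A ℂ × (ℝ × ℝ) × (ℝ × ℝ)) :=
  convexHull ℝ ((fun k : Matrix A A ℂ × ℝ × ℝ => (k.1, (hB U k.1, hE U k.1), k.2)) '' entropyHull U)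

theorem isDensity_of_mem_entropyHull {U : Matrix (B × E) A ℂ} {k} (hk : k ∈ entropyHull U) :
    IsDensity k.1 := by
  have : entropyHull U ⊆ (LinearMap.fst ℝ (Matrix A A ℂ) (ℝ × ℝ)) ⁻¹' {ρ | IsDensity ρ} := by
    refine convexHull_min ?_ (convex_setOf_isDensity.linear_preimage _)
    rintro _ ⟨ρ, hρ, rfl⟩
    exact hρ
  exact this hk

theorem isDensity_of_mem_entropyHullTwo {U : Matrix (B × E) A ℂ} {k} (hk : k ∈ entropyHullTwo U) :
    IsDensity k.1 := by
  have : entropyHullTwo U ⊆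
      (LinearMap.fst ℝ (Matrix A A ℂ) ((ℝ × ℝ) × (ℝ × ℝ))) ⁻¹' {ρ | IsDensity ρ} := by
    refine convexHull_min ?_ (convex_setOf_isDensity.linear_preimage _)
    rintro _ ⟨k, hk, rfl⟩
    exact isDensity_of_mem_entropyHull hk
  exact this hk

theorem isCompact_entropyHull {U : Matrix (B × E) A ℂ} (hU : Uᴴ * U = 1) :
    IsCompact (entropyHull U) :=
  isCompact_convexHull_of_finiteDimensional (isCompact_setOf_isDensity.image_of_continuousOn
    (continuousOn_id.prodMk ((continuousOn_hB hU).prodMk (continuousOn_hE hU))))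

theorem isCompact_entropyHullTwo {U : Matrix (B × E) A ℂ} (hU : Uᴴ * U = 1) :
    IsCompact (entropyHullTwo U) := by
  refine isCompact_convexHull_of_finiteDimensional
    ((isCompact_entropyHull hU).image_of_continuousOn ?_)
  have hm : Set.MapsTo (Prod.fst : Matrix A A ℂ × ℝ × ℝ → _) (entropyHull U) {ρ | IsDensity ρ} :=
    fun k hk => isDensity_of_mem_entropyHull hk
  exact continuousOn_fst.prodMk ((((continuousOn_hB hU).comp continuousOn_fst hm).prodMk
    ((continuousOn_hE hU).comp continuousOn_fst hm)).prodMk continuousOn_snd)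

/-- The rates as a function of entropies. -/
def hullRate (U : Matrix (B × E) A ℂ) (k : Matrix A A ℂ × (ℝ × ℝ) × (ℝ × ℝ)) : ℝ × ℝ × ℝ :=
  (hB U k.1 - k.2.2.1, (k.2.1.1 - k.2.2.1) - (k.2.1.2 - k.2.2.2),
    hB U k.1 - k.2.2.1 - (k.2.1.2 - k.2.2.2))

/-- The inner hull averages over y given x; adjoining the entropies of the averaged state and taking
the hull again averages over x. The resulting point determines the triple, and no bound on the
alphabets is needed. -/
theorem rateSet_eq_image [Nonempty A] (U : Matrix (B × E) A ℂ) :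
    rateSet U = hullRate U '' entropyHullTwo U := by
  have hsc : ∀ (c : ℝ) (M : Matrix A A ℂ), (c : ℂ) • M = c • M := fun c M => by ext; simp
  have hne : (entropyHull U).Nonempty := by
    obtain ⟨ρ, hρ⟩ := exists_isDensity (A := A)
    exact ⟨_, subset_convexHull ℝ _ ⟨ρ, hρ, rfl⟩⟩
  ext v
  constructor
  · rintro ⟨m, n, G, hG, rfl⟩
    choose ρ hρ hGρ using fun x y => exists_isDensity_smul (hG.posSemidef x y)
    set t : Fin m → Fin n → ℝ := fun x y => (G x y).trace.re with ht
    have ht0 : ∀ x y, 0 ≤ t x y := fun x y =>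
      (Complex.le_def.1 (hG.posSemidef x y).trace_nonneg).1
    have hGt : ∀ x y, G x y = (t x y : ℂ) • ρ x y := hGρ
    have hBG : ∀ x y, hB U (G x y) = t x y * hB U (ρ x y) := fun x y => by
      rw [hGt, hB_smul U _ (hρ x y).1]
    have hEG : ∀ x y, hE U (G x y) = t x y * hE U (ρ x y) := fun x y => by
      rw [hGt, hE_smul U _ (hρ x y).1]
    choose k hk hkeq using fun x => exists_sum_smul_eq (convex_convexHull ℝ _) hne
      (fun y => ht0 x y) (z := fun y => (ρ x y, hB U (ρ x y), hE U (ρ x y)))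
      fun y => subset_convexHull ℝ _ ⟨ρ x y, hρ x y, rfl⟩
    have ht1 : ∑ x, ∑ y, t x y = 1 := by
      simp only [ht, ← Complex.re_sum, hG.trace_sum, Complex.one_re]
    have hk1 : ∀ x, ∑ y, G x y = ((∑ y, t x y : ℝ) : ℂ) • (k x).1 := by
      intro x
      have := congrArg Prod.fst (hkeq x)
      rw [Prod.fst_sum] at this
      simp only [hGt, hsc]
      exact this
    have hk2 : ∀ x, ∑ y, hB U (G x y) = (∑ y, t x y) * (k x).2.1 := by
      intro x
      have := congrArg Prod.snd (hkeq x)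
      rw [Prod.snd_sum] at this
      have := congrArg Prod.fst this
      rw [Prod.fst_sum] at this
      simp only [hBG]
      exact this
    have hk3 : ∀ x, ∑ y, hE U (G x y) = (∑ y, t x y) * (k x).2.2 := by
      intro x
      have := congrArg Prod.snd (hkeq x)
      rw [Prod.snd_sum] at this
      have := congrArg Prod.snd this
      rw [Prod.snd_sum] at this
      simp only [hEG]
      exact this
    have hd : ∀ x, (k x).1.PosSemidef := fun x => (isDensity_of_mem_entropyHull (hk x)).1
    refine ⟨∑ x, (∑ y, t x y) • ((k x).1, (hB U (k x).1, hE U (k x).1), (k x).2), ?_, ?_⟩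
    · exact (convex_convexHull ℝ _).sum_mem (fun x _ => Finset.sum_nonneg fun y _ => ht0 x y) ht1
        fun x _ => subset_convexHull ℝ _ ⟨k x, hk x, rfl⟩
    · have e1 : ∑ x, (∑ y, t x y) • (k x).1 = ∑ x, ∑ y, G x y := by
        simp only [hk1, hsc]
      simp only [hullRate, rateTriple, holevoB, condB, condE, Prod.fst_sum, Prod.snd_sum,
        Prod.smul_fst, Prod.smul_snd, e1, hk2, hk3, smul_eq_mul]
      simp only [hk1, hB_smul U _ (hd _), hE_smul U _ (hd _)]
  · rintro ⟨q, hq, rfl⟩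
    obtain ⟨ι, _, w, z, hw0, hw1, hz, rfl⟩ := mem_convexHull_iff_exists_fintype.1 hq
    choose k hk hkz using hz
    choose κ hκ w' z' hw'0 hw'1 hz' hk' using fun i => mem_convexHull_iff_exists_fintype.1 (hk i)
    choose ρ hρ hρz using hz'
    classical
    set g : ∀ i, κ i → Matrix A A ℂ := fun i j => ((w i * w' i j : ℝ) : ℂ) • ρ i j with hg
    -- The inner index set depends on `i`, while an ensemble has a single alphabet Y: take the
    -- disjoint union, with zero states where the indices do not match.
    set G : ι → (Σ i, κ i) → Matrix A A ℂ := fun i q => if q.1 = i then g q.1 q.2 else 0 with hGdef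
    have hgp : ∀ i j, (g i j).PosSemidef := fun i j => (hρ i j).1.smul (by
      exact_mod_cast mul_nonneg (hw0 i) (hw'0 i j))
    have hz0 : hB U 0 = 0 ∧ hE U 0 = 0 := by
      constructor <;> simp [hB, hE, outB_zero, outE_zero, homEntropy_zero]
    have hGsum : ∀ i, ∑ q, G i q = ∑ j, g i j := by
      intro i
      rw [Fintype.sum_sigma, Finset.sum_eq_single i (fun i' _ h => by simp [hGdef, h]) (by simp)]
      simp [hGdef]
    have hGf : ∀ (f : Matrix A A ℂ → ℝ), f 0 = 0 → ∀ i, ∑ q, f (G i q) = ∑ j, f (g i j) := by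
      intro f hf i
      rw [Fintype.sum_sigma, Finset.sum_eq_single i (fun i' _ h => by simp [hGdef, h, hf]) (by simp)]
      simp [hGdef]
    have hk1 : ∀ i, (k i).1 = ∑ j, w' i j • ρ i j := by
      intro i
      rw [← hk' i]
      simp only [← hρz, Prod.fst_sum, Prod.smul_fst]
    have hk2 : ∀ i, (k i).2.1 = ∑ j, w' i j * hB U (ρ i j) := by
      intro i
      rw [← hk' i]
      simp only [← hρz, Prod.snd_sum, Prod.fst_sum, Prod.smul_fst, Prod.smul_snd, smul_eq_mul]
    have hk3 : ∀ i, (k i).2.2 = ∑ j, w' i j * hE U (ρ i j) := by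
      intro i
      rw [← hk' i]
      simp only [← hρz, Prod.snd_sum, Prod.smul_snd, smul_eq_mul]
    have hgk : ∀ i, ∑ j, g i j = (w i : ℂ) • (k i).1 := by
      intro i
      simp only [hk1, hg, hsc, Finset.smul_sum, mul_smul]
    have hFam : IsFamily G := by
      constructor
      · intro i q
        simp only [hGdef]
        split_ifs
        · exact hgp _ _
        · exact PosSemidef.zero
      · simp only [← trace_sum, hGsum, hgk, trace_smul,
          (isDensity_of_mem_entropyHull (hk _)).2, smul_eq_mul, mul_one]
        exact_mod_cast hw1
    have := rateTriple_mem_rateSet U hFam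
    convert this using 1
    have hd : ∀ i, (k i).1.PosSemidef := fun i => (isDensity_of_mem_entropyHull (hk i)).1
    have e2 : ∑ i, ∑ q, hB U (G i q) = ∑ i, w i * (k i).2.1 := by
      simp only [hGf _ hz0.1, hk2, hg, hB_smul U _ (hρ _ _).1, Finset.mul_sum, mul_assoc]
    have e3 : ∑ i, ∑ q, hE U (G i q) = ∑ i, w i * (k i).2.2 := by
      simp only [hGf _ hz0.2, hk3, hg, hE_smul U _ (hρ _ _).1, Finset.mul_sum, mul_assoc]
    simp only [hullRate, rateTriple, holevoB, condB, condE, ← hkz, e2, e3, Prod.fst_sum,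
      Prod.snd_sum, Prod.smul_fst, Prod.smul_snd, smul_eq_mul, hGsum, hgk, hB_smul U _ (hd _),
      hE_smul U _ (hd _)]
    simp only [hsc]

theorem isCompact_rateSet [Nonempty A] {U : Matrix (B × E) A ℂ} (hU : Uᴴ * U = 1) :
    IsCompact (rateSet U) := by
  rw [rateSet_eq_image]
  refine (isCompact_entropyHullTwo hU).image_of_continuousOn ?_
  have h1 : ContinuousOn (fun k : Matrix A A ℂ × (ℝ × ℝ) × (ℝ × ℝ) => hB U k.1)
      (entropyHullTwo U) :=
    (continuousOn_hB hU).comp continuousOn_fst fun k hk => isDensity_of_mem_entropyHullTwo hk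
  unfold hullRate
  fun_prop

theorem rateSet_nonempty [Nonempty A] (U : Matrix (B × E) A ℂ) : (rateSet U).Nonempty := by
  obtain ⟨ρ, hρ⟩ := exists_isDensity (A := A)
  exact ⟨_, rateTriple_mem_rateSet U (X := Unit) (Y := Unit) (G := fun _ _ => ρ)
    ⟨fun _ _ => hρ.1, by simp [hρ.2]⟩⟩

/-- The region is the sum of a compact set and the closed negative orthant. -/
theorem isClosed_rateRegion [Nonempty A] {U : Matrix (B × E) A ℂ} (hU : Uᴴ * U = 1) :
    IsClosed (rateRegion U) := by
  have : rateRegion U = rateSet U + Set.Iic 0 := by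
    ext r
    constructor
    · rintro ⟨v, hv, hr⟩
      exact ⟨v, hv, r - v, sub_nonpos.2 hr, by simp⟩
    · rintro ⟨v, hv, w, hw, rfl⟩
      exact ⟨v, hv, by simpa using hw⟩
  rw [this]
  exact isClosed_Iic.add_left_of_isCompact (isCompact_rateSet hU)

end Compactness

/-! ## Hadamard and degradable channels -/

section Channels

variable {A B E : Type*} [Fintype A] [DecidableEq A] [Fintype B] [DecidableEq B]
  [Fintype E] [DecidableEq E]

/-- A linear map on matrices is determined by its values on the density operators. -/
theorem linearMap_ext_isDensity {V : Type*} [AddCommGroup V] [Module ℂ V]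
    {f g : Matrix A A ℂ →ₗ[ℂ] V} (h : ∀ ρ, IsDensity ρ → f ρ = g ρ) : f = g := by
  rcases isEmpty_or_nonempty A with hA | hA
  · refine LinearMap.ext fun M => ?_
    rw [Subsingleton.elim M 0, map_zero, map_zero]
  have hp : ∀ M : Matrix A A ℂ, M.PosSemidef → (f - g) M = 0 := by
    intro M hM
    obtain ⟨ρ, hρ, hMρ⟩ := exists_isDensity_smul hM
    rw [hMρ, map_smul, LinearMap.sub_apply, h ρ hρ, sub_self, smul_zero]
  have hv : ∀ u w : A → ℂ, (f - g) (vecMulVec u (star w)) = 0 := by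
    intro u w
    have h1 := hp _ (vecMulVec_star_posSemidef (u + w))
    -- Polarization: together with `u + w` this isolates the off-diagonal operator |u⟩⟨w|.
    have h2 := hp _ (vecMulVec_star_posSemidef (u + Complex.I • w))
    simp only [star_add, star_smul, add_vecMulVec, vecMulVec_add, smul_vecMulVec, vecMulVec_smul,
      map_add, map_smul, hp _ (vecMulVec_star_posSemidef _), zero_add, add_zero, smul_zero,
      RCLike.star_def, Complex.conj_I] at h1 h2
    have h3 := congrArg (fun v => Complex.I • v) h2
    simp only [smul_add, smul_smul, smul_zero, Complex.I_mul_I, one_smul,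
      neg_smul, smul_neg, neg_neg] at h3
    have h4 : (2 : ℂ) • (f - g) (vecMulVec u (star w)) = 0 := by
      have h5 := congrArg₂ (· + ·) h1 h3
      simp only [add_zero] at h5
      rw [← h5]
      module
    exact (smul_eq_zero.1 h4).resolve_left two_ne_zero
  rw [← sub_eq_zero]
  refine LinearMap.ext fun M => ?_
  rw [matrix_eq_sum_single M]
  simp only [map_sum, LinearMap.zero_apply, Finset.sum_const_zero]
  refine Finset.sum_eq_zero fun i _ => Finset.sum_eq_zero fun j _ => ?_
  have : single i j (M i j) = M i j • vecMulVec (Pi.single i 1) (star (Pi.single j 1)) := by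
    ext a b
    by_cases ha : i = a <;> by_cases hb : j = b <;>
      simp [vecMulVec_apply, ha, hb]
  rw [this, map_smul, hv, smul_zero]

theorem outB_submatrix {A' B' E' : Type*} [Fintype A'] [Fintype B'] [Fintype E']
    [DecidableEq A'] [DecidableEq B'] [DecidableEq E'] (U : Matrix (B × E) A ℂ)
    (f : B' ≃ B) (g : E' ≃ E) (h : A' ≃ A) (M : Matrix A' A' ℂ) :
    outB (U.submatrix (Prod.map f g) h) M =
      (outB U (M.submatrix h.symm h.symm)).submatrix f f := by
  ext b b'
  simp only [outB_apply, submatrix_apply, Prod.map]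
  rw [← Equiv.sum_comp g]
  refine Finset.sum_congr rfl fun e _ => ?_
  rw [← Equiv.sum_comp h]
  refine Finset.sum_congr rfl fun a _ => ?_
  rw [← Equiv.sum_comp h]
  simp

theorem outE_submatrix {A' B' E' : Type*} [Fintype A'] [Fintype B'] [Fintype E']
    [DecidableEq A'] [DecidableEq B'] [DecidableEq E'] (U : Matrix (B × E) A ℂ)
    (f : B' ≃ B) (g : E' ≃ E) (h : A' ≃ A) (M : Matrix A' A' ℂ) :
    outE (U.submatrix (Prod.map f g) h) M =
      (outE U (M.submatrix h.symm h.symm)).submatrix g g := by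
  ext e e'
  simp only [outE_apply, submatrix_apply, Prod.map]
  rw [← Equiv.sum_comp f]
  refine Finset.sum_congr rfl fun b _ => ?_
  rw [← Equiv.sum_comp h]
  refine Finset.sum_congr rfl fun a _ => ?_
  rw [← Equiv.sum_comp h]
  simp

theorem submatrix_isometry {A' B' E' : Type*} [Fintype A'] [Fintype B'] [Fintype E']
    [DecidableEq A'] [DecidableEq B'] [DecidableEq E'] {U : Matrix (B × E) A ℂ} (hU : Uᴴ * U = 1)
    (f : B' ≃ B) (g : E' ≃ E) (h : A' ≃ A) :
    (U.submatrix (Prod.map f g) h)ᴴ * U.submatrix (Prod.map f g) h = 1 := by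
  have : (U.submatrix (Prod.map f g) h) = U.submatrix (f.prodCongr g) h := rfl
  rw [this, conjTranspose_submatrix, submatrix_mul_equiv, hU, submatrix_one_equiv]

theorem IsDegradableIso.submatrix {A' B' : Type*} [Fintype A'] [Fintype B']
    [DecidableEq A'] [DecidableEq B'] {U : Matrix (B × E) A ℂ} (hU : IsDegradableIso U)
    (f : B' ≃ B) (h : A' ≃ A) :
    IsDegradableIso (U.submatrix (Prod.map f (Equiv.refl E)) h) := by
  obtain ⟨Z, _, _, V, κ, _, K, hV, hVU, hK, hKV⟩ := hU
  refine ⟨Z, inferInstance, inferInstance, V.submatrix (Prod.map (Equiv.refl Z) (Equiv.refl E)) h,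
    κ, inferInstance, K, submatrix_isometry hV _ _ _, fun M => ?_, hK, fun M => ?_⟩
  · rw [outE_submatrix, outE_submatrix, hVU]
  · rw [outB_submatrix, outE_submatrix]
    exact hKV _

/-- A channel that is degradable has a degradable isometric extension. -/
theorem IsDegradable.exists_isDegradableIso {N : Matrix A A ℂ →ₗ[ℂ] Matrix B B ℂ}
    (hN : IsDegradable N) :
    ∃ (e : ℕ) (U : Matrix (B × Fin e) A ℂ), IsIsometricExtension U N ∧ IsDegradableIso U := by
  obtain ⟨-, e, U, D, hU, ⟨n, K, hK, hK1⟩, hD⟩ := hN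
  refine ⟨e, U, hU, ?_⟩
  have hDN : ∀ M, krausMap K (outB U M) = outE U M := by
    have := linearMap_ext_isDensity (f := D ∘ₗ N) (g := complementary U) hD
    intro M
    have h1 := LinearMap.congr_fun this M
    rw [LinearMap.comp_apply, hU.2, hK] at h1
    exact h1
  -- `IsDegradableIso` asks for an output index in `Type`, so `B` is replaced by `Fin (card B)`.
  set f := (Fintype.equivFin B).symm
  refine ⟨Fin (Fintype.card B), inferInstance, inferInstance,
    U.submatrix (Prod.map f (Equiv.refl (Fin e))) (Equiv.refl A), Fin n, inferInstance,
    fun k => (K k).submatrix (Equiv.refl (Fin e)) f,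
    submatrix_isometry hU.1 _ _ _, fun M => by rw [outE_submatrix]; rfl, ?_, fun M => ?_⟩
  · simp only [conjTranspose_submatrix, submatrix_mul_equiv]
    have : ∑ x, ((K x)ᴴ * K x).submatrix f f = (∑ x, (K x)ᴴ * K x).submatrix f f := by
      ext; simp [Matrix.sum_apply]
    rw [this, hK1, submatrix_one_equiv]
  · rw [outB_submatrix, outE_submatrix]
    simp only [krausMap, conjTranspose_submatrix, submatrix_mul_equiv] at hDN ⊢
    exact hDN M

theorem channelTensor_id_maxEntangled (N : Matrix A A ℂ →ₗ[ℂ] Matrix B B ℂ) (a a' : A) (b b' : B) :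
    channelTensor LinearMap.id N (maxEntangled A) (a, b) (a', b') =
      (Fintype.card A : ℂ)⁻¹ * N (single a a' 1) b b' := by
  simp only [channelTensor, maxEntangled, LinearMap.coe_mk, AddHom.coe_mk, Matrix.sum_apply,
    Matrix.smul_apply, of_apply, kroneckerMap_apply, LinearMap.id_apply, smul_eq_mul]
  rw [Finset.sum_eq_single (a, a), Finset.sum_eq_single (a', a')]
  · simp
  · rintro ⟨t, t'⟩ - ht
    by_cases h1 : t = t'
    · subst h1
      have : t ≠ a' := fun h => ht (by rw [h])
      simp [this]
    · simp [h1]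
  · simp
  · rintro ⟨s, s'⟩ - hs
    refine Finset.sum_eq_zero fun t _ => ?_
    by_cases h1 : s = s'
    · subst h1
      have : s ≠ a := fun h => hs (by rw [h])
      simp [this]
    · simp [h1]
  · simp

/-- A channel with entanglement-breaking complementary channel has the form of a Hadamard
isometry. -/
theorem isHadamardIso_of_isEntanglementBreaking [Nonempty A] {e : ℕ} {U : Matrix (B × Fin e) A ℂ}
    (hU : Uᴴ * U = 1) (h : IsEntanglementBreaking (complementary U)) : IsHadamardIso U := by
  obtain ⟨-, n, p, σ, θ, hp, -, hσ, hθ, hsum⟩ := h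
  choose T hT using fun x => exists_eq_mul_conjTranspose (hσ x).1
  choose V d hV hV' hθV hd using fun x => exists_diagonalization (hθ x).1.1
  set f := (Fintype.equivFin A).symm
  -- The index z consists of a term x of the separable decomposition, a column of a square root of
  -- σ_x and an eigenvector of θ_x. All weights go into ψ, so that φ is normalized; the factor `card
  -- A` undoes the normalization of the maximally entangled state, and the conjugation stems from
  -- the Choi correspondence.
  set ψ : Fin n × Fin (Fintype.card A) × Fin e → A → ℂ := fun z a =>
    (Real.sqrt (Fintype.card A * p z.1 * d z.1 z.2.2) : ℂ) * star (T z.1 a (f z.2.1)) with hψ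
  set φ : Fin n × Fin (Fintype.card A) × Fin e → Fin e → ℂ := fun z i => V z.1 i z.2.2 with hφdef
  have hφ : ∀ z, star (φ z) ⬝ᵥ φ z = 1 := by
    intro z
    have := congrFun (congrFun (hV z.1) z.2.2) z.2.2
    rw [Matrix.mul_apply, one_apply_eq] at this
    simpa [dotProduct] using this
  have hsingle : ∀ a a' i j, outE U (single a a' 1) i j =
      ∑ z, star (ψ z a) * ψ z a' * (φ z i * star (φ z j)) := by
    intro a a' i j
    have h1 := channelTensor_id_maxEntangled (complementary U) a a' i j
    rw [hsum] at h1
    have hc : (Fintype.card A : ℂ) ≠ 0 := by exact_mod_cast Fintype.card_ne_zero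
    have h2 : outE U (single a a' 1) i j =
        Fintype.card A * (∑ x, (p x : ℂ) • (σ x ⊗ₖ θ x)) (a, i) (a', j) := by
      change complementary U (single a a' 1) i j = _
      rw [eq_comm, ← mul_right_inj' (inv_ne_zero hc), ← h1, inv_mul_cancel_left₀ hc]
    rw [h2, Matrix.sum_apply, Fintype.sum_prod_type, Finset.mul_sum]
    refine Finset.sum_congr rfl fun x _ => ?_
    have h3 : σ x a a' = ∑ k, T x a (f k) * star (T x a' (f k)) := by
      rw [hT, Matrix.mul_apply, ← Equiv.sum_comp f]; rfl
    have h4 : θ x i j = ∑ l, (d x l : ℂ) * (V x i l * star (V x j l)) := by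
      rw [hθV]
      rw [Matrix.mul_apply]
      simp only [mul_diagonal, conjTranspose_apply]
      exact Finset.sum_congr rfl fun l _ => by ring
    rw [Matrix.smul_apply, kroneckerMap_apply, h3, h4, Finset.sum_mul_sum, Fintype.sum_prod_type,
      Finset.smul_sum, Finset.mul_sum]
    refine Finset.sum_congr rfl fun k _ => ?_
    rw [Finset.smul_sum, Finset.mul_sum]
    refine Finset.sum_congr rfl fun l _ => ?_
    have h5 : (Real.sqrt (Fintype.card A * p x * d x l) : ℂ) *
        Real.sqrt (Fintype.card A * p x * d x l) = Fintype.card A * p x * d x l := by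
      rw [← Complex.ofReal_mul, Real.mul_self_sqrt (mul_nonneg (mul_nonneg (Nat.cast_nonneg _)
        (hp x)) (hd x (hθ x).1 l))]
      push_cast; rfl
    simp only [hψ, hφdef, star_mul', RCLike.star_def, Complex.conj_ofReal, Complex.conj_conj,
      smul_eq_mul]
    linear_combination (-(T x a (f k) * (starRingEnd ℂ) (T x a' (f k)) *
      (V x i l * (starRingEnd ℂ) (V x j l)))) * h5
  have hout : ∀ M, outE (hadamardIso ψ φ) M = outE U M := by
    intro M
    ext i j
    have h1 : ∀ M : Matrix A A ℂ, outE U M i j = ∑ a, ∑ a', M a a' * outE U (single a a' 1) i j := by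
      intro M
      change complementary U M i j = ∑ a, ∑ a', M a a' * complementary U (single a a' 1) i j
      conv_lhs => rw [matrix_eq_sum_single M]
      simp only [map_sum, Matrix.sum_apply]
      refine Finset.sum_congr rfl fun a _ => Finset.sum_congr rfl fun a' _ => ?_
      rw [← mul_one (M a a'), ← smul_eq_mul, ← smul_single, map_smul, Matrix.smul_apply]
      simp
    rw [outE_hadamardIso, h1]
    simp only [hsingle, Matrix.sum_apply, Matrix.smul_apply, vecMulVec_apply, dotProduct, mulVec,
      Finset.mul_sum, Finset.sum_mul, smul_eq_mul, Pi.star_apply]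
    rw [Finset.sum_comm]
    refine Finset.sum_congr rfl fun a _ => ?_
    rw [Finset.sum_comm]
    exact Finset.sum_congr rfl fun a' _ => Finset.sum_congr rfl fun z _ => by ring
  refine ⟨_, inferInstance, inferInstance, ψ, φ, ?_, hφ, hout⟩
  ext a a'
  -- Preservation of the trace of matrix units is the isometry condition, read entry by entry.
  have h1 := trace_outE hU (single a' a 1)
  rw [← hout, outE_hadamardIso, trace_sum] at h1
  have h2 : ∀ z, (star (ψ z) ⬝ᵥ ((single a' a 1 : Matrix A A ℂ) *ᵥ ψ z)) = star (ψ z a') * ψ z a := by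
    intro z
    simp [dotProduct, single_mulVec, Function.update_apply]
  simp only [trace_smul, trace_vecMulVec_of_normalized (hφ _), h2, smul_eq_mul, mul_one] at h1
  have h3 : (single a' a (1 : ℂ)).trace = (1 : Matrix A A ℂ) a a' := by
    by_cases h : a = a'
    · subst h; simp
    · rw [one_apply_ne h, trace_single_eq_of_ne _ _ _ (Ne.symm h)]
  rw [← h3, ← h1, Matrix.mul_apply, Fintype.sum_prod_type]
  refine Finset.sum_congr rfl fun z _ => ?_
  have h4 := hφ z
  simp only [dotProduct, Pi.star_apply] at h4
  simp only [hadamardIso, conjTranspose_apply, of_apply, star_mul', star_star]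
  calc _ = (∑ i, star (φ z i) * φ z i) * (star (ψ z a') * ψ z a) := by
        rw [Finset.sum_mul]
        exact Finset.sum_congr rfl fun i _ => by ring
    _ = _ := by rw [h4, one_mul]

end Channels

/-! ## Information quantities of classical-quantum states -/

section ClassicalQuantum

variable {X Y A B E : Type*} [Fintype X] [DecidableEq X] [Fintype Y] [DecidableEq Y]
  [Fintype A] [DecidableEq A] [Fintype B] [DecidableEq B] [Fintype E] [DecidableEq E]

/-- The state `∑_{x,y} |x⟩⟨x| ⊗ |y⟩⟨y| ⊗ F_{x,y}`. -/
def blockState (F : X → Y → Matrix B B ℂ) : Matrix ((X × Y) × B) ((X × Y) × B) ℂ :=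
  of fun u v => if u.1 = v.1 then F u.1.1 u.1.2 u.2 v.2 else 0

theorem trace_eq_ofReal_re {M : Matrix B B ℂ} (h : M.IsHermitian) : M.trace = (M.trace.re : ℂ) := by
  have h1 : star M.trace = M.trace := by rw [← trace_conjTranspose, h.eq]
  exact (Complex.conj_eq_iff_re.1 h1).symm

theorem entropy_blockState {F : X → Y → Matrix B B ℂ} (hF : ∀ x y, (F x y).IsHermitian) :
    entropy (blockState F) = ∑ x, ∑ y, entropy (F x y) := by
  have h1 : blockState F = (blockDiagonal fun w : X × Y => F w.1 w.2).submatrix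
      (Equiv.prodComm _ _) (Equiv.prodComm _ _) := by
    ext u v
    simp only [blockState, of_apply, submatrix_apply, blockDiagonal_apply, Equiv.prodComm_apply,
      Prod.snd_swap, Prod.fst_swap]
  have h2 : (blockDiagonal fun w : X × Y => F w.1 w.2).IsHermitian := by
    rw [IsHermitian, blockDiagonal_conjTranspose]
    exact congrArg _ (funext fun w => hF _ _)
  rw [h1, entropy_submatrix h2, entropy_blockDiagonal fun w => hF _ _, Fintype.sum_prod_type]

theorem entropy_traceSnd_blockState {F : X → Y → Matrix B B ℂ} (hF : ∀ x y, (F x y).IsHermitian) :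
    entropy (traceSnd (blockState F)) = ∑ x, ∑ y, nml (F x y).trace.re := by
  have : traceSnd (blockState F) = diagonal fun w : X × Y => (((F w.1 w.2).trace.re : ℝ) : ℂ) := by
    ext w w'
    by_cases h : w = w'
    · subst h
      rw [diagonal_apply_eq, ← trace_eq_ofReal_re (hF _ _)]
      simp [traceSnd, blockState, trace]
    · simp [traceSnd, blockState, h]
  rw [this, entropy_diagonal, Fintype.sum_prod_type]

theorem traceFst_blockState (F : X → Y → Matrix B B ℂ) :
    traceFst (blockState F) = ∑ x, ∑ y, F x y := by
  ext b b'
  simp [traceFst, blockState, Fintype.sum_prod_type, Matrix.sum_apply]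

theorem entropy_traceMid_blockState {F : X → Y → Matrix B B ℂ} (hF : ∀ x y, (F x y).IsHermitian) :
    entropy (traceMid (blockState F)) = ∑ x, entropy (∑ y, F x y) := by
  have h1 : traceMid (blockState F) = (blockDiagonal fun x : X => ∑ y, F x y).submatrix
      (Equiv.prodComm _ _) (Equiv.prodComm _ _) := by
    ext u v
    simp only [blockState, traceMid, of_apply, submatrix_apply, blockDiagonal_apply,
      Equiv.prodComm_apply, Prod.snd_swap, Prod.fst_swap, Prod.mk.injEq, and_true, Matrix.sum_apply]
    split_ifs <;> simp
  have h3 : ∀ x, (∑ y, F x y).IsHermitian := fun x => by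
    rw [IsHermitian, conjTranspose_sum]
    exact Finset.sum_congr rfl fun y _ => hF x y
  have h2 : (blockDiagonal fun x : X => ∑ y, F x y).IsHermitian := by
    rw [IsHermitian, blockDiagonal_conjTranspose]
    exact congrArg _ (funext fun w => h3 _)
  rw [h1, entropy_submatrix h2, entropy_blockDiagonal h3]

theorem entropy_traceSnd_traceSnd_blockState {F : X → Y → Matrix B B ℂ}
    (hF : ∀ x y, (F x y).IsHermitian) :
    entropy (traceSnd (traceSnd (blockState F))) = ∑ x, nml (∑ y, F x y).trace.re := by
  have : traceSnd (traceSnd (blockState F)) =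
      diagonal fun x : X => (((∑ y, F x y).trace.re : ℝ) : ℂ) := by
    ext x x'
    by_cases h : x = x'
    · subst h
      rw [diagonal_apply_eq, trace_sum, Complex.re_sum, Complex.ofReal_sum,
        Finset.sum_congr rfl fun y _ => (trace_eq_ofReal_re (hF x y)).symm]
      simp [traceSnd, blockState, trace]
    · simp [traceSnd, blockState, h]
  rw [this, entropy_diagonal]

/-- The entropy of the classical register is the sum of the terms `nml` of the traces, exactly what
turns the entropies of the blocks into homogeneous ones. -/
theorem mutualInfo_blockState {F : X → Y → Matrix B B ℂ} (hF : ∀ x y, (F x y).IsHermitian)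
    (h1 : (∑ x, ∑ y, F x y).trace = 1) :
    mutualInfo (blockState F) =
      homEntropy (∑ x, ∑ y, F x y) - ∑ x, ∑ y, homEntropy (F x y) := by
  simp only [mutualInfo, entropy_traceSnd_blockState hF, traceFst_blockState, entropy_blockState hF,
    homEntropy, h1, Finset.sum_sub_distrib, Complex.one_re, nml_one]
  ring

theorem condMutualInfo_blockState {F : X → Y → Matrix B B ℂ} (hF : ∀ x y, (F x y).IsHermitian) :
    condMutualInfo (blockState F) =
      ∑ x, homEntropy (∑ y, F x y) - ∑ x, ∑ y, homEntropy (F x y) := by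
  simp only [condMutualInfo, entropy_traceSnd_blockState hF, entropy_traceMid_blockState hF,
    entropy_traceSnd_traceSnd_blockState hF, entropy_blockState hF, homEntropy,
    Finset.sum_sub_distrib]
  ring

/-- The unnormalized states of an ensemble. -/
def Ensemble.family {m n : ℕ} (S : Ensemble m n A) (x : Fin m) (y : Fin n) : Matrix A A ℂ :=
  (S.p x y : ℂ) • S.ρ x y

theorem Ensemble.isFamily {m n : ℕ} (S : Ensemble m n A) : IsFamily S.family where
  posSemidef x y := (S.density x y).1.smul (by exact_mod_cast S.p_nonneg x y)
  trace_sum := by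
    simp only [Ensemble.family, trace_smul, (S.density _ _).2, smul_eq_mul, mul_one]
    exact_mod_cast S.p_sum

theorem IsFamily.exists_ensemble [Nonempty A] {m n : ℕ} {G : Fin m → Fin n → Matrix A A ℂ}
    (hG : IsFamily G) : ∃ S : Ensemble m n A, S.family = G := by
  choose ρ hρ hGρ using fun x y => exists_isDensity_smul (hG.posSemidef x y)
  refine ⟨⟨fun x y => (G x y).trace.re, ρ,
    fun x y => (Complex.le_def.1 (hG.posSemidef x y).trace_nonneg).1, ?_, hρ⟩, ?_⟩
  · rw [← Complex.one_re, ← hG.trace_sum]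
    simp only [Complex.re_sum]
  · funext x y
    exact (hGρ x y).symm

theorem cqState_apply {m n : ℕ} (U : Matrix (B × E) A ℂ) (S : Ensemble m n A) (w w' : Fin m × Fin n)
    (o o' : B × E) :
    cqState U S (w, o) (w', o') =
      if w = w' then (U * S.family w.1 w.2 * Uᴴ) o o' else 0 := by
  obtain ⟨x, y⟩ := w
  obtain ⟨x', y'⟩ := w'
  simp only [cqState, Matrix.sum_apply, Matrix.smul_apply, kroneckerMap_apply, smul_eq_mul,
    Ensemble.family, Matrix.mul_smul, Matrix.smul_mul, Prod.mk.injEq]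
  rw [Finset.sum_eq_single x, Finset.sum_eq_single y]
  · by_cases hx : x = x' <;> by_cases hy : y = y' <;> simp [hx, hy]
  · intro y₁ _ h
    simp [h]
  · simp
  · intro x₁ _ h
    exact Finset.sum_eq_zero fun y₁ _ => by simp [h]
  · simp

theorem reduceB_cqState {m n : ℕ} (U : Matrix (B × E) A ℂ) (S : Ensemble m n A) :
    reduceB (cqState U S) = blockState fun x y => outB U (S.family x y) := by
  ext u v
  simp only [reduceB, blockState, of_apply, cqState_apply]
  split_ifs
  · rfl
  · simp

theorem reduceE_cqState {m n : ℕ} (U : Matrix (B × E) A ℂ) (S : Ensemble m n A) :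
    reduceE (cqState U S) = blockState fun x y => outE U (S.family x y) := by
  ext u v
  simp only [reduceE, blockState, of_apply, cqState_apply]
  split_ifs
  · rfl
  · simp

theorem infoYXB_cqState {m n : ℕ} {U : Matrix (B × E) A ℂ} (hU : Uᴴ * U = 1) (S : Ensemble m n A) :
    infoYXB (cqState U S) = holevoB U S.family := by
  rw [infoYXB, reduceB_cqState, mutualInfo_blockState
    fun x y => (outB_posSemidef U (S.isFamily.posSemidef x y)).1]
  · simp only [holevoB, hB, outB_sum]
  · simp only [← outB_sum]
    rw [trace_outB hU]
    simp only [trace_sum, S.isFamily.trace_sum]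

theorem infoYBgivenX_cqState {m n : ℕ} (U : Matrix (B × E) A ℂ) (S : Ensemble m n A) :
    infoYBgivenX (cqState U S) = condB U S.family := by
  rw [infoYBgivenX, reduceB_cqState, condMutualInfo_blockState
    fun x y => (outB_posSemidef U (S.isFamily.posSemidef x y)).1]
  simp only [condB, hB, outB_sum]

theorem infoYEgivenX_cqState {m n : ℕ} (U : Matrix (B × E) A ℂ) (S : Ensemble m n A) :
    infoYEgivenX (cqState U S) = condE U S.family := by
  rw [infoYEgivenX, reduceE_cqState, condMutualInfo_blockState
    fun x y => (outE_posSemidef U (S.isFamily.posSemidef x y)).1]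
  simp only [condE, hE, outE_sum]

end ClassicalQuantum

/-! ## The capacity formula and the region in terms of rates -/

section Translation

variable {A B E : Type*} [Fintype A] [DecidableEq A] [Fintype B] [DecidableEq B]
  [Fintype E] [DecidableEq E]

theorem rateSet_submatrix_subset {A' B' E' : Type*} [Fintype A'] [Fintype B'] [Fintype E']
    [DecidableEq A'] [DecidableEq B'] [DecidableEq E'] (U : Matrix (B × E) A ℂ)
    (f : B' ≃ B) (g : E' ≃ E) (h : A' ≃ A) :
    rateSet (U.submatrix (Prod.map f g) h) ⊆ rateSet U := by
  rintro _ ⟨m, n, G, hG, rfl⟩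
  have hp : ∀ {M : Matrix A' A' ℂ}, M.PosSemidef → (M.submatrix h.symm h.symm).PosSemidef :=
    fun hM => hM.submatrix _
  have hBU : ∀ {M : Matrix A' A' ℂ}, M.PosSemidef →
      hB (U.submatrix (Prod.map f g) h) M = hB U (M.submatrix h.symm h.symm) := fun hM => by
    rw [hB, outB_submatrix, homEntropy_submatrix (outB_posSemidef U (hp hM)).1, hB]
  have hEU : ∀ {M : Matrix A' A' ℂ}, M.PosSemidef →
      hE (U.submatrix (Prod.map f g) h) M = hE U (M.submatrix h.symm h.symm) := fun hM => by
    rw [hE, outE_submatrix, homEntropy_submatrix (outE_posSemidef U (hp hM)).1, hE]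
  have hs : ∀ {ι : Type} [Fintype ι] (M : ι → Matrix A' A' ℂ),
      (∑ i, M i).submatrix h.symm h.symm = ∑ i, (M i).submatrix h.symm h.symm := fun M => by
    ext; simp [Matrix.sum_apply]
  refine ⟨m, n, fun x y => (G x y).submatrix h.symm h.symm,
    ⟨fun x y => hp (hG.posSemidef x y), ?_⟩, ?_⟩
  · rw [← hG.trace_sum]
    refine Finset.sum_congr rfl fun x _ => Finset.sum_congr rfl fun y _ => ?_
    exact Equiv.sum_comp h.symm fun a => G x y a a
  · have h1 : ∀ x, (∑ y, G x y).PosSemidef := fun x =>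
      posSemidef_sum _ fun y _ => hG.posSemidef x y
    simp only [rateTriple, holevoB, condB, condE, hBU (hG.posSemidef _ _),
      hEU (hG.posSemidef _ _), hBU (h1 _), hEU (h1 _), hBU (posSemidef_sum _ fun x _ => h1 x), hs]

theorem rateSet_submatrix {A' B' E' : Type*} [Fintype A'] [Fintype B'] [Fintype E']
    [DecidableEq A'] [DecidableEq B'] [DecidableEq E'] (U : Matrix (B × E) A ℂ)
    (f : B' ≃ B) (g : E' ≃ E) (h : A' ≃ A) :
    rateSet (U.submatrix (Prod.map f g) h) = rateSet U := by
  refine (rateSet_submatrix_subset U f g h).antisymm ?_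
  have := rateSet_submatrix_subset (U.submatrix (Prod.map f g) h) f.symm g.symm h.symm
  have h1 : (U.submatrix (Prod.map f g) h).submatrix (Prod.map f.symm g.symm) h.symm = U := by
    ext ⟨b, e⟩ a
    simp [Prod.map]
  rwa [h1] at this

/-- Two extensions share the output B, and the environment entropies are determined by it. -/
theorem IsIsometricExtension.rateSet_eq {E' : Type*} [Fintype E'] [DecidableEq E']
    {N : Matrix A A ℂ →ₗ[ℂ] Matrix B B ℂ} {U : Matrix (B × E) A ℂ} {U' : Matrix (B × E') A ℂ}
    (hU : IsIsometricExtension U N) (hU' : IsIsometricExtension U' N) : rateSet U = rateSet U' :=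
  rateSet_eq_of_outB_eq fun M => (hU.2 M).symm.trans (hU'.2 M)

theorem IsIsometricExtension.exists_fin {N : Matrix A A ℂ →ₗ[ℂ] Matrix B B ℂ}
    {U : Matrix (B × E) A ℂ} (hU : IsIsometricExtension U N) :
    ∃ (e : ℕ) (U' : Matrix (B × Fin e) A ℂ), IsIsometricExtension U' N := by
  refine ⟨_, U.submatrix (Prod.map (Equiv.refl B) (Fintype.equivFin E).symm) (Equiv.refl A),
    submatrix_isometry hU.1 _ _ _, fun ρ => ?_⟩
  change _ = outB _ ρ
  rw [hU.2, outB_submatrix]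
  ext
  simp [outB]

/-- The objective as a function of the bounds on the rates. -/
def rateValue (lam mu : ℝ) (t : ℝ × ℝ × ℝ) : ℝ := t.1 + lam * t.2.1 + mu * t.2.2

theorem objective_cqState {m n : ℕ} {U : Matrix (B × E) A ℂ} (hU : Uᴴ * U = 1)
    (S : Ensemble m n A) (lam mu : ℝ) :
    objective lam mu (cqState U S) = rateValue lam mu (rateTriple U S.family) := by
  simp only [objective, infoYXB_cqState hU, infoYBgivenX_cqState, infoYEgivenX_cqState, rateValue,
    rateTriple]

/-- One extension, with an environment of any finite type, accounts for all those quantified over in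
the formula. -/
theorem objectiveValues_eq [Nonempty A] {N : Matrix A A ℂ →ₗ[ℂ] Matrix B B ℂ}
    {U : Matrix (B × E) A ℂ} (hU : IsIsometricExtension U N) (lam mu : ℝ) :
    objectiveValues N lam mu = rateValue lam mu '' rateSet U := by
  ext v
  constructor
  · rintro ⟨e, m, n, U', S, hU', rfl⟩
    refine ⟨rateTriple U' S.family, ?_, (objective_cqState hU'.1 S lam mu).symm⟩
    rw [hU.rateSet_eq hU']
    exact ⟨m, n, _, S.isFamily, rfl⟩
  · rintro ⟨t, ht, rfl⟩
    obtain ⟨e, U', hU'⟩ := hU.exists_fin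
    rw [hU.rateSet_eq hU'] at ht
    obtain ⟨m, n, G, hG, rfl⟩ := ht
    obtain ⟨S, rfl⟩ := hG.exists_ensemble
    exact ⟨e, m, n, U', S, hU', (objective_cqState hU'.1 S lam mu).symm⟩

/-- The bounded combinations of the rates. -/
def rateBounds (r : ℝ × ℝ × ℝ) : ℝ × ℝ × ℝ := (r.1 + r.2.1, r.2.1 + r.2.2, r.1 + r.2.1 + r.2.2)

theorem oneShotRegion_eq [Nonempty A] {N : Matrix A A ℂ →ₗ[ℂ] Matrix B B ℂ}
    {U : Matrix (B × E) A ℂ} (hU : IsIsometricExtension U N) :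
    oneShotRegion N = rateBounds ⁻¹' rateRegion U := by
  ext r
  constructor
  · rintro ⟨e, m, n, U', S, hU', h1, h2, h3⟩
    refine ⟨rateTriple U' S.family, ?_, ?_⟩
    · rw [hU.rateSet_eq hU']
      exact ⟨m, n, _, S.isFamily, rfl⟩
    · rw [infoYXB_cqState hU'.1] at h1 h3
      rw [infoYEgivenX_cqState] at h2 h3
      rw [infoYBgivenX_cqState] at h2
      exact ⟨h1, h2, h3⟩
  · rintro ⟨t, ht, hr⟩
    obtain ⟨e, U', hU'⟩ := hU.exists_fin
    rw [hU.rateSet_eq hU'] at ht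
    obtain ⟨m, n, G, hG, rfl⟩ := ht
    obtain ⟨S, rfl⟩ := hG.exists_ensemble
    refine ⟨e, m, n, U', S, hU', ?_, ?_, ?_⟩
    · rw [infoYXB_cqState hU'.1]
      exact hr.1
    · rw [infoYBgivenX_cqState, infoYEgivenX_cqState]
      exact hr.2.1
    · rw [infoYXB_cqState hU'.1, infoYEgivenX_cqState]
      exact hr.2.2

theorem rateValue_mono {lam mu : ℝ} (hl : 0 ≤ lam) (hm : 0 ≤ mu) {s t : ℝ × ℝ × ℝ} (h : s ≤ t) :
    rateValue lam mu s ≤ rateValue lam mu t :=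
  add_le_add (add_le_add h.1 (mul_le_mul_of_nonneg_left h.2.1 hl))
    (mul_le_mul_of_nonneg_left h.2.2 hm)

theorem rateValue_add (lam mu : ℝ) (s t : ℝ × ℝ × ℝ) :
    rateValue lam mu (s + t) = rateValue lam mu s + rateValue lam mu t := by
  simp only [rateValue, Prod.fst_add, Prod.snd_add]
  ring

/-- The maximum defining the capacity formula exists. -/
theorem IsIsometricExtension.isGreatest [Nonempty A] {N : Matrix A A ℂ →ₗ[ℂ] Matrix B B ℂ}
    {U : Matrix (B × E) A ℂ} (hU : IsIsometricExtension U N) (lam mu : ℝ) :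
    IsGreatest (objectiveValues N lam mu) (privateDynamicFormula N lam mu) := by
  have hc : IsCompact (objectiveValues N lam mu) := by
    rw [objectiveValues_eq hU]
    refine (isCompact_rateSet hU.1).image ?_
    unfold rateValue
    fun_prop
  refine hc.isGreatest_sSup ?_
  rw [objectiveValues_eq hU]
  exact (rateSet_nonempty U).image _

variable {A₁ B₁ E₁ A₂ B₂ E₂ : Type*} [Fintype A₁] [DecidableEq A₁] [Fintype B₁] [DecidableEq B₁]
  [Fintype E₁] [DecidableEq E₁] [Fintype A₂] [DecidableEq A₂] [Fintype B₂] [DecidableEq B₂]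
  [Fintype E₂] [DecidableEq E₂]

theorem IsIsometricExtension.tensorIso {N₁ : Matrix A₁ A₁ ℂ →ₗ[ℂ] Matrix B₁ B₁ ℂ}
    {N₂ : Matrix A₂ A₂ ℂ →ₗ[ℂ] Matrix B₂ B₂ ℂ} {U₁ : Matrix (B₁ × E₁) A₁ ℂ}
    {U₂ : Matrix (B₂ × E₂) A₂ ℂ} (h₁ : IsIsometricExtension U₁ N₁)
    (h₂ : IsIsometricExtension U₂ N₂) :
    IsIsometricExtension (tensorIso U₁ U₂) (channelTensor N₁ N₂) := by
  refine ⟨tensorIso_isometry h₁.1 h₂.1, fun M => ?_⟩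
  change _ = outB (PrivateDynamic.tensorIso U₁ U₂) M
  induction M using kronecker_induction with
  | hadd M N hM hN => rw [map_add, hM, hN, outB_add]
  | h0 => rw [map_zero, outB_zero]
  | hk M N =>
    rw [channelTensor_kronecker, outB_tensorIso_kronecker, h₁.2, h₂.2]
    rfl

/-- Domination instead of equality of the sets suffices because the objective is monotone for
nonnegative multipliers. -/
theorem isGreatest_add_of_forall_rateSet {lam mu : ℝ} (hl : 0 ≤ lam) (hm : 0 ≤ mu)
    {R S T : Set (ℝ × ℝ × ℝ)} {a b : ℝ} (ha : IsGreatest (rateValue lam mu '' R) a)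
    (hb : IsGreatest (rateValue lam mu '' S) b) (hadd : ∀ r ∈ R, ∀ s ∈ S, r + s ∈ T)
    (hle : ∀ t ∈ T, ∃ r ∈ R, ∃ s ∈ S, t ≤ r + s) :
    IsGreatest (rateValue lam mu '' T) (a + b) := by
  obtain ⟨⟨r, hr, rfl⟩, ha⟩ := ha
  obtain ⟨⟨s, hs, rfl⟩, hb⟩ := hb
  refine ⟨⟨r + s, hadd r hr s hs, rateValue_add _ _ _ _⟩, ?_⟩
  rintro _ ⟨t, ht, rfl⟩
  obtain ⟨r', hr', s', hs', h⟩ := hle t ht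
  refine (rateValue_mono hl hm h).trans ?_
  rw [rateValue_add]
  exact add_le_add (ha ⟨r', hr', rfl⟩) (hb ⟨s', hs', rfl⟩)

/-- The maxima of the objective add up for a Hadamard and a degradable isometry. -/
theorem isGreatest_rateValue_tensorIso {U₁ : Matrix (B₁ × E₁) A₁ ℂ} {U₂ : Matrix (B₂ × E₂) A₂ ℂ}
    (h₁ : U₁ᴴ * U₁ = 1) (h₂ : U₂ᴴ * U₂ = 1) (hU₁ : IsHadamardIso U₁) (hU₂ : IsDegradableIso U₂)
    {lam mu : ℝ} (hl : 0 ≤ lam) (hm : 0 ≤ mu) {a b : ℝ}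
    (ha : IsGreatest (rateValue lam mu '' rateSet U₁) a)
    (hb : IsGreatest (rateValue lam mu '' rateSet U₂) b) :
    IsGreatest (rateValue lam mu '' rateSet (tensorIso U₁ U₂)) (a + b) :=
  isGreatest_add_of_forall_rateSet hl hm ha hb
    (fun _ hr _ hs => add_mem_rateSet_tensorIso h₁ h₂ hr hs)
    fun _ ht => exists_le_add_of_mem_rateSet_tensorIso hU₁ hU₂ h₂ ht

/-! ## Tensor powers -/

theorem channelPow_single (N : Matrix A A ℂ →ₗ[ℂ] Matrix B B ℂ) (n : ℕ) (s t : Fin n → A) :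
    channelPow N n (single s t 1) =
      of fun u v => ∏ i, N (single (s i) (t i) 1) (u i) (v i) := by
  simp only [channelPow, LinearMap.coe_mk, AddHom.coe_mk]
  rw [Finset.sum_eq_single s, Finset.sum_eq_single t]
  · simp
  · intro t' _ h
    simp [Ne.symm h]
  · simp
  · intro s' _ h
    exact Finset.sum_eq_zero fun t' _ => by simp [Ne.symm h]
  · simp

/-- Identifies a power with a tensor product up to relabelling, so that the two-channel results
apply inductively with the single copy in front. -/
theorem channelPow_succ (N : Matrix A A ℂ →ₗ[ℂ] Matrix B B ℂ) (n : ℕ)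
    (M : Matrix (Fin (n + 1) → A) (Fin (n + 1) → A) ℂ) :
    channelPow N (n + 1) M =
      (channelTensor N (channelPow N n) (M.submatrix (Fin.consEquiv fun _ => A)
        (Fin.consEquiv fun _ => A))).submatrix (Fin.consEquiv fun _ => B).symm
          (Fin.consEquiv fun _ => B).symm := by
  ext u v
  simp only [channelPow, channelTensor, LinearMap.coe_mk, AddHom.coe_mk, Matrix.sum_apply,
    Matrix.smul_apply, submatrix_apply, of_apply]
  rw [← Equiv.sum_comp (Fin.consEquiv fun _ => A)]
  refine Finset.sum_congr rfl fun s _ => ?_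
  rw [← Equiv.sum_comp (Fin.consEquiv fun _ => A)]
  refine Finset.sum_congr rfl fun t _ => ?_
  have := channelPow_single N n s.2 t.2
  simp only [channelPow, LinearMap.coe_mk, AddHom.coe_mk] at this
  rw [this]
  simp [kroneckerMap_apply, Fin.prod_univ_succ, Fin.consEquiv, Fin.tail]

theorem isIsometricExtension_channelPow_succ {N : Matrix A A ℂ →ₗ[ℂ] Matrix B B ℂ} {n : ℕ}
    {E' : Type*} [Fintype E'] [DecidableEq E']
    {U : Matrix (B × E) A ℂ} (hU : IsIsometricExtension U N)
    {V : Matrix ((Fin n → B) × E') (Fin n → A) ℂ} (hV : IsIsometricExtension V (channelPow N n)) :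
    IsIsometricExtension ((tensorIso U V).submatrix
      (Prod.map (Fin.consEquiv fun _ => B).symm (Equiv.refl (E × E')))
      (Fin.consEquiv fun _ => A).symm) (channelPow N (n + 1)) := by
  refine ⟨submatrix_isometry (tensorIso_isometry hU.1 hV.1) _ _ _, fun M => ?_⟩
  change _ = outB _ M
  rw [channelPow_succ, (hU.tensorIso hV).2, outB_submatrix]
  rfl

theorem rateSet_channelPow_succ {N : Matrix A A ℂ →ₗ[ℂ] Matrix B B ℂ} {n : ℕ}
    {E' E'' : Type*} [Fintype E'] [DecidableEq E'] [Fintype E''] [DecidableEq E'']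
    {U : Matrix (B × E) A ℂ} (hU : IsIsometricExtension U N)
    {V : Matrix ((Fin n → B) × E') (Fin n → A) ℂ} (hV : IsIsometricExtension V (channelPow N n))
    {W : Matrix ((Fin (n + 1) → B) × E'') (Fin (n + 1) → A) ℂ}
    (hW : IsIsometricExtension W (channelPow N (n + 1))) : rateSet W = rateSet (tensorIso U V) := by
  rw [hW.rateSet_eq (isIsometricExtension_channelPow_succ hU hV), rateSet_submatrix]

/-- The trivial isometry between one-dimensional systems. -/
def trivialIso (A B E : Type*) : Matrix (B × E) A ℂ := of fun _ _ => 1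

theorem trivialIso_isometry [Unique A] [Unique B] [Unique E] :
    (trivialIso A B E)ᴴ * trivialIso A B E = 1 := by
  ext i j
  obtain rfl := Subsingleton.elim i j
  simp [trivialIso, Matrix.mul_apply]

theorem outB_trivialIso [Unique A] [Unique B] [Unique E] (M : Matrix A A ℂ) (b b' : B) :
    outB (trivialIso A B E) M b b' = M default default := by
  simp [outB_apply, trivialIso]

theorem outE_trivialIso [Unique A] [Unique B] [Unique E] (M : Matrix A A ℂ) (e e' : E) :
    outE (trivialIso A B E) M e e' = M default default := by
  simp [outE_apply, trivialIso]

theorem isDegradableIso_trivialIso [Unique A] [Unique B] :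
    IsDegradableIso (trivialIso A B Unit) := by
  refine ⟨Unit, inferInstance, inferInstance, trivialIso A Unit Unit, Unit, inferInstance,
    fun _ => 1, trivialIso_isometry, fun M => ?_, by simp, fun M => ?_⟩
  · ext; rw [outE_trivialIso, outE_trivialIso]
  · ext; simp [krausMap, outE_trivialIso, outB_trivialIso]

theorem rateSet_trivialIso [Unique A] [Unique B] [Unique E] : rateSet (trivialIso A B E) = {0} := by
  have h1 : ∀ M : Matrix A A ℂ, M.PosSemidef → hB (trivialIso A B E) M = 0 := fun M hM =>
    homEntropy_of_unique (outB_posSemidef _ hM).1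
  have h2 : ∀ M : Matrix A A ℂ, M.PosSemidef → hE (trivialIso A B E) M = 0 := fun M hM =>
    homEntropy_of_unique (outE_posSemidef _ hM).1
  have h3 : ∀ (m n : ℕ) (G : Fin m → Fin n → Matrix A A ℂ), IsFamily G →
      rateTriple (trivialIso A B E) G = 0 := by
    intro m n G hG
    have h4 : ∀ x, (∑ y, G x y).PosSemidef := fun x =>
      posSemidef_sum _ fun y _ => hG.posSemidef x y
    simp [rateTriple, holevoB, condB, condE, h1 _ (hG.posSemidef _ _), h2 _ (hG.posSemidef _ _),
      h1 _ (h4 _), h2 _ (h4 _), h1 _ (posSemidef_sum _ fun x _ => h4 x)]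
  refine Set.eq_singleton_iff_nonempty_unique_mem.2 ⟨rateSet_nonempty _, ?_⟩
  rintro _ ⟨m, n, G, hG, rfl⟩
  exact h3 m n G hG

theorem isIsometricExtension_channelPow_zero (N : Matrix A A ℂ →ₗ[ℂ] Matrix B B ℂ) :
    IsIsometricExtension (trivialIso (Fin 0 → A) (Fin 0 → B) Unit) (channelPow N 0) := by
  refine ⟨trivialIso_isometry, fun M => ?_⟩
  ext u v
  change _ = outB _ M u v
  rw [outB_trivialIso]
  simp [channelPow]

theorem exists_isDegradableIso_channelPow {N : Matrix A A ℂ →ₗ[ℂ] Matrix B B ℂ} {e : ℕ}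
    {U : Matrix (B × Fin e) A ℂ} (hU : IsIsometricExtension U N) (hdeg : IsDegradableIso U) (n : ℕ) :
    ∃ (E : Type) (_ : Fintype E) (_ : DecidableEq E) (V : Matrix ((Fin n → B) × E) (Fin n → A) ℂ),
      IsIsometricExtension V (channelPow N n) ∧ IsDegradableIso V := by
  induction n with
  | zero => exact ⟨Unit, inferInstance, inferInstance, _, isIsometricExtension_channelPow_zero N,
      isDegradableIso_trivialIso⟩
  | succ n ih =>
    obtain ⟨E, _, _, V, hV, hVd⟩ := ih
    exact ⟨Fin e × E, inferInstance, inferInstance, _, isIsometricExtension_channelPow_succ hU hV,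
      (hdeg.tensorIso hVd).submatrix _ _⟩

end Translation

/-! ## Hadamard channels -/

section Hadamard

variable {A B : Type*} [Fintype A] [DecidableEq A] [Nonempty A] [Fintype B] [DecidableEq B]

theorem IsHadamard.exists_isHadamardIso {N : Matrix A A ℂ →ₗ[ℂ] Matrix B B ℂ} (hN : IsHadamard N) :
    ∃ (e : ℕ) (U : Matrix (B × Fin e) A ℂ), IsIsometricExtension U N ∧ IsHadamardIso U := by
  obtain ⟨-, e, U, hU, h⟩ := hN
  exact ⟨e, U, hU, isHadamardIso_of_isEntanglementBreaking hU.1 h⟩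

variable {N : Matrix A A ℂ →ₗ[ℂ] Matrix B B ℂ} {e : ℕ} {U : Matrix (B × Fin e) A ℂ}

/-- In the induction the front copy plays the Hadamard channel and the remaining power the
degradable one. -/
theorem privateDynamicFormula_channelPow (hU : IsIsometricExtension U N) (hH : IsHadamardIso U)
    {lam mu : ℝ} (hl : 0 ≤ lam) (hm : 0 ≤ mu) (n : ℕ) :
    privateDynamicFormula (channelPow N n) lam mu = n * privateDynamicFormula N lam mu := by
  induction n with
  | zero =>
    have h0 := isIsometricExtension_channelPow_zero N
    rw [privateDynamicFormula, objectiveValues_eq h0, rateSet_trivialIso]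
    simp [rateValue]
  | succ n ih =>
    obtain ⟨_, _, _, V, hV, hVd⟩ := exists_isDegradableIso_channelPow hU hH.isDegradableIso n
    have h := hU.isGreatest lam mu
    have h' := hV.isGreatest lam mu
    have hs := isIsometricExtension_channelPow_succ hU hV
    have h'' := hs.isGreatest lam mu
    rw [objectiveValues_eq hU] at h
    rw [objectiveValues_eq hV] at h'
    rw [objectiveValues_eq hs, rateSet_channelPow_succ hU hV hs] at h''
    rw [h''.unique (isGreatest_rateValue_tensorIso hU.1 hV.1 hH hVd hl hm h h'), ih]
    push_cast
    ring

/-- The vector form of the previous result, needed for the region: each triple of the power is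
dominated by `n` times an averaged single-copy triple, the average being available by time sharing.
-/
theorem exists_le_smul_of_mem_rateSet_channelPow (hU : IsIsometricExtension U N)
    (hH : IsHadamardIso U) (n : ℕ) {E : Type} [Fintype E] [DecidableEq E]
    {V : Matrix ((Fin n → B) × E) (Fin n → A) ℂ} (hV : IsIsometricExtension V (channelPow N n))
    {t : ℝ × ℝ × ℝ} (ht : t ∈ rateSet V) : ∃ r ∈ rateRegion U, t ≤ (n : ℝ) • r := by
  induction n generalizing E t with
  | zero =>
    rw [hV.rateSet_eq (isIsometricExtension_channelPow_zero N), rateSet_trivialIso] at ht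
    obtain ⟨r, hr⟩ := rateSet_nonempty U
    refine ⟨r, ⟨r, hr, le_rfl⟩, ?_⟩
    rw [Set.mem_singleton_iff.1 ht, Nat.cast_zero, zero_smul]
  | succ n ih =>
    obtain ⟨_, _, _, V', hV', hVd⟩ := exists_isDegradableIso_channelPow hU hH.isDegradableIso n
    rw [rateSet_channelPow_succ hU hV' hV] at ht
    obtain ⟨r, hr, s, hs, hle⟩ := exists_le_add_of_mem_rateSet_tensorIso hH hVd hV'.1 ht
    obtain ⟨s', hs', hle'⟩ := ih hV' hs
    have hn : (0 : ℝ) < n + 1 := by positivity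
    -- The new copy has weight 1/(n+1) against the average of the previous `n`.
    refine ⟨((n : ℝ) + 1)⁻¹ • r + ((n : ℝ) / (n + 1)) • s', ?_, ?_⟩
    · refine convex_rateRegion U ⟨r, hr, le_rfl⟩ hs' (by positivity) (by positivity) ?_
      field_simp
      ring
    · rw [Nat.cast_succ, smul_add, smul_smul, smul_smul, mul_inv_cancel₀ hn.ne', one_smul,
        mul_div_cancel₀ _ hn.ne']
      exact hle.trans (add_le_add_right hle' r)

theorem rateBounds_smul (c : ℝ) (r : ℝ × ℝ × ℝ) : rateBounds (c • r) = c • rateBounds r := by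
  simp only [rateBounds, Prod.smul_fst, Prod.smul_snd, smul_eq_mul, Prod.smul_mk, mul_add]

/-- The capacity region of a Hadamard channel single-letterizes. -/
theorem capacityRegion_eq (hU : IsIsometricExtension U N) (hH : IsHadamardIso U) :
    capacityRegion N = oneShotRegion N := by
  refine (closure_minimal (Set.iUnion₂_subset fun k hk => ?_) ?_).antisymm ?_
  · rintro _ ⟨r, hr, rfl⟩
    have hk0 : (0 : ℝ) < k := by exact_mod_cast (Set.mem_Ici.1 hk)
    obtain ⟨_, _, _, V, hV, -⟩ := exists_isDegradableIso_channelPow hU hH.isDegradableIso k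
    rw [oneShotRegion_eq hV] at hr
    obtain ⟨t, ht, hrt⟩ := hr
    obtain ⟨s, ⟨s', hs', hss⟩, hts⟩ := exists_le_smul_of_mem_rateSet_channelPow hU hH k hV ht
    rw [oneShotRegion_eq hU]
    refine ⟨s', hs', le_trans ?_ hss⟩
    change rateBounds ((k : ℝ)⁻¹ • r) ≤ s
    rw [rateBounds_smul, inv_smul_le_iff_of_pos hk0]
    exact hrt.trans hts
  · rw [oneShotRegion_eq hU]
    refine (isClosed_rateRegion hU.1).preimage ?_
    unfold rateBounds
    fun_prop
  -- The first power is the channel tensored with the trivial channel on zero copies, whose only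
  -- triple is 0.
  · refine subset_closure.trans' fun r hr => ?_
    have h0 := isIsometricExtension_channelPow_zero N
    have h1 := isIsometricExtension_channelPow_succ hU h0
    refine Set.mem_iUnion₂.2 ⟨1, Set.mem_Ici.2 le_rfl, r, ?_, by simp⟩
    rw [oneShotRegion_eq hU] at hr
    obtain ⟨t, ht, hrt⟩ := hr
    rw [oneShotRegion_eq h1]
    refine ⟨t, ?_, hrt⟩
    rw [rateSet_channelPow_succ hU h0 h1, ← add_zero t]
    exact add_mem_rateSet_tensorIso hU.1 h0.1 ht (by rw [rateSet_trivialIso]; rfl)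

end Hadamard

end PrivateDynamic

end

/-! ### Additivity, regularization and single-letterization -/

theorem mainTheorem3 {A₁ B₁ A₂ B₂ : Type*}
    [Fintype A₁] [DecidableEq A₁] [Nonempty A₁] [Fintype B₁] [DecidableEq B₁]
    [Fintype A₂] [DecidableEq A₂] [Nonempty A₂] [Fintype B₂] [DecidableEq B₂]
    (NH : Matrix A₁ A₁ ℂ →ₗ[ℂ] Matrix B₁ B₁ ℂ) (ND : Matrix A₂ A₂ ℂ →ₗ[ℂ] Matrix B₂ B₂ ℂ)
    (hH : PrivateDynamic.IsHadamard NH) (hD : PrivateDynamic.IsDegradable ND) :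
    (∀ lam mu : ℝ, 0 ≤ lam → 0 ≤ mu →
      -- the three maxima exist, and the formula is additive
      (IsGreatest (PrivateDynamic.objectiveValues NH lam mu)
          (PrivateDynamic.privateDynamicFormula NH lam mu) ∧
        IsGreatest (PrivateDynamic.objectiveValues ND lam mu)
          (PrivateDynamic.privateDynamicFormula ND lam mu) ∧
        IsGreatest (PrivateDynamic.objectiveValues (PrivateDynamic.channelTensor NH ND) lam mu)
          (PrivateDynamic.privateDynamicFormula (PrivateDynamic.channelTensor NH ND) lam mu) ∧
        PrivateDynamic.privateDynamicFormula (PrivateDynamic.channelTensor NH ND) lam mu =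
          PrivateDynamic.privateDynamicFormula NH lam mu +
            PrivateDynamic.privateDynamicFormula ND lam mu) ∧
      -- the regularized formula of the Hadamard channel is the formula itself
      (∀ n : ℕ, IsGreatest
          (PrivateDynamic.objectiveValues (PrivateDynamic.channelPow NH n) lam mu)
          (PrivateDynamic.privateDynamicFormula (PrivateDynamic.channelPow NH n) lam mu)) ∧
      Filter.Tendsto
        (fun n : ℕ =>
          (1 / (n : ℝ)) *
            PrivateDynamic.privateDynamicFormula (PrivateDynamic.channelPow NH n) lam mu)
        Filter.atTop (nhds (PrivateDynamic.privateDynamicFormula NH lam mu))) ∧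
    -- no regularization is needed in the region of the Hadamard channel
    PrivateDynamic.capacityRegion NH = PrivateDynamic.oneShotRegion NH := by
  obtain ⟨e, U, hU, hUH⟩ := hH.exists_isHadamardIso
  obtain ⟨d, V, hV, hVD⟩ := hD.exists_isDegradableIso
  refine ⟨fun lam mu hl hm => ⟨⟨hU.isGreatest lam mu, hV.isGreatest lam mu,
    (hU.tensorIso hV).isGreatest lam mu, ?_⟩, fun n => ?_, ?_⟩,
    PrivateDynamic.capacityRegion_eq hU hUH⟩
  · have h₁ := hU.isGreatest lam mu
    have h₂ := hV.isGreatest lam mu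
    have h := (hU.tensorIso hV).isGreatest lam mu
    rw [PrivateDynamic.objectiveValues_eq hU] at h₁
    rw [PrivateDynamic.objectiveValues_eq hV] at h₂
    rw [PrivateDynamic.objectiveValues_eq (hU.tensorIso hV)] at h
    exact h.unique (PrivateDynamic.isGreatest_rateValue_tensorIso hU.1 hV.1 hUH hVD hl hm h₁ h₂)
  · obtain ⟨_, _, _, W, hW, -⟩ :=
      PrivateDynamic.exists_isDegradableIso_channelPow hU hUH.isDegradableIso n
    exact hW.isGreatest lam mu
  · refine tendsto_const_nhds.congr' ?_
    -- At `n = 0` the factor `1 / n` is zero by convention, so the sequence is constant only from `n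
    -- = 1` on.
    filter_upwards [Filter.eventually_ge_atTop 1] with n hn
    have hn' : (n : ℝ) ≠ 0 := by exact_mod_cast (Nat.one_le_iff_ne_zero.1 hn)
    rw [PrivateDynamic.privateDynamicFormula_channelPow hU hUH hl hm n, ← mul_assoc,
      one_div_mul_cancel hn', one_mul]
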